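/- Let $m$ be a positive integer and let $\Delta\subset\mathbb R^2$ be the triangle with vertices $(0,0)$, $(m,0)$, $(0,m)$. Let $\tau$ be a convex triangulation of $\Delta$ whose vertices have integer coordinates, and let $\nu:\Delta\to\mathbb R_{\ge 0}$ be a convex function certifying the convexity of $\tau$: $\nu$ is linear (i.e. affine) on each triangle of $\tau$ and is not linear on the union of any two distinct triangles of $\tau$. Let a sign $\sigma_{k,l}=\pm1$ be given at each vertex $(k,l)$ of $\tau$. For $t>0$ put $$b_t(x,y)=\sum_{(k,l)\text{ vertex of }\tau}\sigma_{k,l}\,t^{\nu(k,l)}x^ky^l .$$ Let $A\Delta$ be the square that is the union of the four images of $\Delta$ under $(x,y)\mapsto(\varepsilon x,\delta y)$, $\varepsilon,\delta=\pm1$. Extend $\tau$ to a triangulation of $A\Delta$ symmetric with respect to both coordinate axes, and extend the signs to its vertices by the rule $\sigma_{i,j}\,\sigma_{\varepsilon i,\delta j}\,\varepsilon^i\delta^j=1$. In each triangle of the extended triangulation whose vertices have different signs, take the midline separating pluses from minuses (the segment joining the midpoints of the two sides whose endpoints have different signs), and let $AL\subset A\Delta$ be the union of these midlines. Let $P\Delta$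 be the quotient space of $A\Delta$ obtained by identifying each boundary point $p$ with $-p$, and let $PL\subset P\Delta$ be the image of $AL$. Then for all sufficiently small $t>0$: 1. there is a homeomorphism from the interior $\operatorname{Int}A\Delta$ onto $\mathbb R^2$ mapping $AL\cap\operatorname{Int}A\Delta$ onto the affine curve $\{(x,y)\in\mathbb R^2: b_t(x,y)=0\}$; 2. there is a homeomorphism $P\Delta\to\mathbb R P^2$ mapping $PL$ onto the projective closure of this affine curve, that is, onto the set of points $[x:y:z]\in\mathbb R P^2$ at which the homogenization of $b_t$ vanishes; and this set is also the topological closure in $\mathbb R P^2$ of the image of the affine curve under $(x,y)\mapsto[x:y:1]$. -/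

import Mathlib

open scoped LinearAlgebra.Projectivization

noncomputable section

namespace Patchwork

/-! ### Initial data -/

/-- The lattice point `(i, j)`, viewed in the real plane. -/
def latticePoint (a : ℤ × ℤ) : ℝ × ℝ := ((a.1 : ℝ), (a.2 : ℝ))

/-- The closed triangle `Δ` with vertices `(0,0)`, `(m,0)`, `(0,m)`. -/
def triangle (m : ℕ) : Set (ℝ × ℝ) :=
  convexHull ℝ {((0 : ℝ), (0 : ℝ)), ((m : ℝ), (0 : ℝ)), ((0 : ℝ), (m : ℝ))}

/-- `τ` is a triangulation of `Δ` all of whose vertices have integer coordinates.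
(As a simplicial complex, `τ` is face-to-face and its simplices are nondegenerate.) -/
structure IsLatticeTriangulation (m : ℕ) (τ : Geometry.SimplicialComplex ℝ (ℝ × ℝ)) : Prop where
  space_eq : τ.space = triangle m
  vertices_subset : τ.vertices ⊆ Set.range latticePoint

/-- `ν` certifies that the triangulation `τ` of `Δ` is convex: on `Δ` it is nonnegative and convex,
it is (affine) linear on each triangle of `τ`, and it is not (affine) linear on the union of any
two distinct triangles of `τ`. -/
structure CertifiesConvexity (m : ℕ) (τ : Geometry.SimplicialComplex ℝ (ℝ × ℝ))
    (ν : ℝ × ℝ → ℝ) : Prop where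
  nonneg : ∀ p ∈ triangle m, 0 ≤ ν p
  convexOn : ConvexOn ℝ (triangle m) ν
  linear_on : ∀ T ∈ τ.faces, T.card = 3 →
    ∃ f : (ℝ × ℝ) →ᵃ[ℝ] ℝ, Set.EqOn ν f (convexHull ℝ (T : Set (ℝ × ℝ)))
  not_linear_on_union : ∀ T ∈ τ.faces, ∀ T' ∈ τ.faces, T.card = 3 → T'.card = 3 → T ≠ T' →
    ¬ ∃ f : (ℝ × ℝ) →ᵃ[ℝ] ℝ,
      Set.EqOn ν f (convexHull ℝ (T : Set (ℝ × ℝ)) ∪ convexHull ℝ (T' : Set (ℝ × ℝ)))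

/-! ### Polynomial patchworking -/

open Classical in
/-- The polynomial `b_t(x, y) = ∑ σ_{k,l} t^{ν(k,l)} x^k y^l`, the sum being over the vertices
`(k, l)` of `τ` (which lie in `Δ`, so that `0 ≤ k, l ≤ m`). -/
def patchworkPolynomial (m : ℕ) (τ : Geometry.SimplicialComplex ℝ (ℝ × ℝ))
    (ν : ℝ × ℝ → ℝ) (σ : ℕ → ℕ → ℤˣ) (t : ℝ) : MvPolynomial (Fin 2) ℝ :=
  ∑ a ∈ (Finset.range (m + 1) ×ˢ Finset.range (m + 1)).filter
      (fun a : ℕ × ℕ => ((a.1 : ℝ), (a.2 : ℝ)) ∈ τ.vertices),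
    MvPolynomial.C ((((σ a.1 a.2 : ℤˣ) : ℤ) : ℝ) * t ^ ν ((a.1 : ℝ), (a.2 : ℝ))) *
      MvPolynomial.X 0 ^ a.1 * MvPolynomial.X 1 ^ a.2

/-- The real affine curve `p(x, y) = 0`. -/
def affineCurve (p : MvPolynomial (Fin 2) ℝ) : Set (ℝ × ℝ) :=
  {q | MvPolynomial.eval ![q.1, q.2] p = 0}

/-- The homogenization `z^d p(x/z, y/z)` of `p`, where `d` is the degree of `p`. -/
def homogenization (p : MvPolynomial (Fin 2) ℝ) : MvPolynomial (Fin 3) ℝ :=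
  ∑ e ∈ p.support,
    MvPolynomial.C (p.coeff e) * MvPolynomial.X 0 ^ e 0 * MvPolynomial.X 1 ^ e 1 *
      MvPolynomial.X 2 ^ (p.totalDegree - (e 0 + e 1))

/-- The real projective plane carries the quotient topology from `ℝ³ ∖ {0}`. -/
instance instTopologicalSpaceRealProjectivePlane : TopologicalSpace (ℙ ℝ (Fin 3 → ℝ)) :=
  inferInstanceAs (TopologicalSpace (Quotient (projectivizationSetoid ℝ (Fin 3 → ℝ))))

/-- The projective closure of the affine curve `p = 0`: the set of the points `[x : y : z]` at
which the homogenization of `p` vanishes. -/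
def projectiveCurve (p : MvPolynomial (Fin 2) ℝ) : Set (ℙ ℝ (Fin 3 → ℝ)) :=
  {P | ∃ (v : Fin 3 → ℝ) (hv : v ≠ 0),
    P = Projectivization.mk ℝ v hv ∧ MvPolynomial.eval v (homogenization p) = 0}

/-- The affine chart `(x, y) ↦ [x : y : 1]`. -/
def affineChart (q : ℝ × ℝ) : ℙ ℝ (Fin 3 → ℝ) :=
  Projectivization.mk ℝ ![q.1, q.2, 1] (fun h => one_ne_zero (congrFun h 2))

/-! ### Combinatorial patchworking -/

/-- The map `(x, y) ↦ (ε x, δ y)`, `ε, δ = ±1`: the identity, the reflections `s_x`, `s_y` in the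
coordinate axes, and their composition `s`. -/
def reflect (ε δ : ℤˣ) (p : ℝ × ℝ) : ℝ × ℝ :=
  (((ε : ℤ) : ℝ) * p.1, ((δ : ℤ) : ℝ) * p.2)

/-- The square `AΔ`, the union of the four mirror images of `Δ`. -/
def square (m : ℕ) : Set (ℝ × ℝ) :=
  ⋃ (ε : ℤˣ) (δ : ℤˣ), reflect ε δ '' triangle m

/-- The simplices (as vertex sets) of the symmetric extension of `τ` to `AΔ`. -/
def extendedFaces (τ : Geometry.SimplicialComplex ℝ (ℝ × ℝ)) : Set (Finset (ℝ × ℝ)) :=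
  {F | ∃ ε δ : ℤˣ, ∃ T ∈ τ.faces, (F : Set (ℝ × ℝ)) = reflect ε δ '' (T : Set (ℝ × ℝ))}

/-- The distribution of signs extended to lattice points of all four quadrants: passing to the
mirror image with respect to an axis preserves the sign if the distance to this axis is even
and changes it if the distance is odd. -/
def extendedSign (σ : ℕ → ℕ → ℤˣ) (a : ℤ × ℤ) : ℤˣ :=
  σ a.1.natAbs a.2.natAbs * (if a.1 < 0 then (-1) ^ a.1.natAbs else 1) *
    (if a.2 < 0 then (-1) ^ a.2.natAbs else 1)

/-- On the first quadrant the extended distribution of signs is the given one. -/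
theorem extendedSign_natCast (σ : ℕ → ℕ → ℤˣ) (i j : ℕ) :
    extendedSign σ ((i : ℤ), (j : ℤ)) = σ i j := by
  have h : ∀ n : ℕ, ¬ ((n : ℤ) < 0) := fun n => not_lt.mpr (Int.natCast_nonneg n)
  simp [extendedSign, h]

/-- The rule `σ_{i,j} σ_{εi,δj} ε^i δ^j = 1`. -/
theorem extendedSign_rule (σ : ℕ → ℕ → ℤˣ) (i j : ℕ) (ε δ : ℤˣ) :
    σ i j * extendedSign σ ((ε : ℤ) * i, (δ : ℤ) * j) * ε ^ i * δ ^ j = 1 := by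
  have h : ∀ (n : ℕ) (ε : ℤˣ),
      ((ε : ℤ) * n).natAbs = n ∧
        (if (ε : ℤ) * n < 0 then (-1 : ℤˣ) ^ ((ε : ℤ) * n).natAbs else 1) = ε ^ n := by
    intro n ε
    rcases Int.units_eq_one_or ε with rfl | rfl
    · simp
    · rcases Nat.eq_zero_or_pos n with rfl | hn
      · simp
      · simp [hn]
  obtain ⟨h1, h2⟩ := h i ε
  obtain ⟨h3, h4⟩ := h j δ
  unfold extendedSign
  simp only [h2, h4]
  rw [h1, h3]
  calc σ i j * (σ i j * ε ^ i * δ ^ j) * ε ^ i * δ ^ j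
      = (σ i j * σ i j) * (ε ^ i * ε ^ i) * (δ ^ j * δ ^ j) := by
        ac_rfl
    _ = 1 := by simp only [Int.units_mul_self, mul_one]

/-- The set `AL`: the union of the midlines separating pluses from minuses in the triangles
of the extended triangulation whose vertices have different signs. In such a triangle exactly one
vertex `a` has a sign different from the signs of the two other vertices `b`, `c`, and the midline
is the segment joining the midpoints of the sides `ab` and `ac`. -/
def affineMidlines (τ : Geometry.SimplicialComplex ℝ (ℝ × ℝ)) (σ : ℕ → ℕ → ℤˣ) :
    Set (ℝ × ℝ) :=
  {p | ∃ a b c : ℤ × ℤ, a ≠ b ∧ a ≠ c ∧ b ≠ c ∧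
    (∃ F ∈ extendedFaces τ,
      (F : Set (ℝ × ℝ)) = {latticePoint a, latticePoint b, latticePoint c}) ∧
    extendedSign σ a ≠ extendedSign σ b ∧ extendedSign σ a ≠ extendedSign σ c ∧
    p ∈ segment ℝ (midpoint ℝ (latticePoint a) (latticePoint b))
      (midpoint ℝ (latticePoint a) (latticePoint c))}

/-- The equivalence relation on `AΔ` gluing its sides by `s`: a boundary point `p` is identified
with the opposite boundary point `-p`. -/
def gluing (m : ℕ) : Setoid (square m) where
  r p q := p = q ∨ ((p : ℝ × ℝ) ∈ frontier (square m) ∧ (q : ℝ × ℝ) ∈ frontier (square m) ∧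
    (q : ℝ × ℝ) = -(p : ℝ × ℝ))
  iseqv := by
    refine ⟨fun p => Or.inl rfl, ?_, ?_⟩
    · rintro p q (h | ⟨hp, hq, h⟩)
      · exact Or.inl h.symm
      · exact Or.inr ⟨hq, hp, by rw [h, neg_neg]⟩
    · rintro p q r (rfl | ⟨hp, hq, h⟩) (rfl | ⟨hq', hr, h'⟩)
      · exact Or.inl rfl
      · exact Or.inr ⟨hq', hr, h'⟩
      · exact Or.inr ⟨hp, hq, h⟩
      · exact Or.inl (Subtype.ext (by rw [h', h, neg_neg]))

/-- The space `PΔ` obtained from the square `AΔ` by gluing, with the quotient topology. -/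
abbrev GluedSquare (m : ℕ) : Type := Quotient (gluing m)

/-- The set `PL`, the image of `AL` in `PΔ`. -/
def projectiveMidlines (m : ℕ) (τ : Geometry.SimplicialComplex ℝ (ℝ × ℝ)) (σ : ℕ → ℕ → ℤˣ) :
    Set (GluedSquare m) :=
  Quotient.mk (gluing m) '' {p : square m | (p : ℝ × ℝ) ∈ affineMidlines τ σ}

end Patchwork

end

/-! Fold a quadrant onto the standard simplex of nonnegative homogeneous coordinates. The
homogenized polynomial becomes a combination of monomials with coefficients `t ^ ν` and the signs
`quadrantSign`. Divided by the same polynomial with all signs positive, it becomes F = ∑ σ_e ω_e,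
where ω is the probability vector of the `weight`s of the monomials. The moment map, which sends a
point to the barycenter of the exponents weighted by ω, is a homeomorphism of the simplex
(`momentHomeo`); through it F is a function on the rescaled triangle Δ. On Δ there is also f = ∑ σ_e
w_e, where w are the barycentric weights in a triangle of τ. It is affine on each triangle and its
zero set is the union of the midlines. So {F = 0} must be carried to {f = 0}.

Put L = -log t. Since the heights of the other vertices lie strictly above the plane of a triangle,
ω concentrates on the triangle containing the moment value, with mass O(1/L) elsewhere
(`exists_sum_weight_compl_le`). As ω and w have the same barycenter, F is uniformly close to f. This
alone says nothing about the topology of {F = 0}; control of increments is needed as well. Each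
triangle is the join of its positive and its negative face. Multiplying the positive weights by r
and the negative ones by q (`rescale`) moves a point along the segments of this join, on which f is
monotone. The crux (`sum_abs_sub_weight_le`, `abs_variation_sub_le`) is that where |f| ≤ 1/2 the
increment of F along such a segment equals that of f up to a small relative error. Indeed two weight
vectors ω, ω' over the same open face have ratio exp ψ with ψ a linear form in the exponent; the sum
∑ (ω' - ω) ψ has nonnegative terms, and for given ψ it depends only on the barycenters. This bounds
ψ, except at a vertex of the triangle with small weight, which needs a separate argument.

Consequently `blend f F`, which is F where |f| ≤ 1/4 and f where |f| ≥ 1/2, increases strictly with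
f along every join segment. Sliding each point along its segment until f takes this value is a
homeomorphism (`correctHomeo`) which carries {F = 0} to {f = 0}.

This correction preserves faces, depends on a face only on the signs there, and does not change when
all of them are reversed. So the homeomorphisms of the four quadrants agree along the axes. On k + l
= m the signs of opposite quadrants differ by (-1)^m, so the homeomorphisms are also compatible with
p ↦ -p on the boundary. They glue to a homeomorphism between the upper half of an octahedron and the
square (`glueHomeo`). Central projection turns the half-octahedron into the projective plane, and
its part above the equator into the affine plane. The curve is the closure of its affine part
because every midline without its endpoints lies in the interior of the square. -/

set_option linter.unusedSectionVars false

/-! ### The moment map of a family of monomials on the simplex -/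

namespace Patchwork

/-- A finite family of monomials of the same degree in three variables which contains the powers
of the variables. -/
structure MonomialFamily (ι : Type*) where
  deg : ℕ
  deg_pos : 0 < deg
  exps : ι → Fin 3 → ℕ
  sum_exps : ∀ e, ∑ i, exps e i = deg
  corner : Fin 3 → ι
  exps_corner : ∀ i j, exps (corner i) j = if i = j then deg else 0

namespace MonomialFamily

variable {ι : Type*} [Fintype ι] (M : MonomialFamily ι)

/-- The linear form with coefficients `d` on the exponent of `e`. -/
noncomputable def form (d : Fin 3 → ℝ) (e : ι) : ℝ := ∑ i, d i * M.exps e i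

/-- The polynomial with coefficients `c`. -/
noncomputable def poly (c : ι → ℝ) (x : Fin 3 → ℝ) : ℝ := ∑ e, c e * ∏ i, x i ^ M.exps e i

/-- The share of the monomial `e` in the value of a polynomial with positive coefficients. -/
noncomputable def weight (c : ι → ℝ) (x : Fin 3 → ℝ) (e : ι) : ℝ :=
  c e * (∏ i, x i ^ M.exps e i) / M.poly c x

/-- The barycenter of the normalized exponents with given weights. -/
noncomputable def bary (w : ι → ℝ) (i : Fin 3) : ℝ := (∑ e, w e * M.exps e i) / M.deg

/-- The moment map. -/
noncomputable def moment (c : ι → ℝ) (x : Fin 3 → ℝ) : Fin 3 → ℝ := M.bary (M.weight c x)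

variable {M} {c : ι → ℝ} {x x' : Fin 3 → ℝ}

lemma deg_pos_real : (0 : ℝ) < M.deg := by exact_mod_cast M.deg_pos

lemma sum_exps_real (e : ι) : ∑ i, (M.exps e i : ℝ) = M.deg := by exact_mod_cast M.sum_exps e

lemma form_add_const (d : Fin 3 → ℝ) (s : ℝ) (e : ι) :
    M.form (fun i => d i + s) e = M.form d e + s * M.deg := by
  simp only [form, add_mul, Finset.sum_add_distrib, ← Finset.mul_sum, sum_exps_real]

/-- The mean of a linear form depends on the weights only through their barycenter. All comparisons
of weights with equal moment rest on this. -/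
lemma sum_mul_form (w : ι → ℝ) (d : Fin 3 → ℝ) :
    ∑ e, w e * M.form d e = M.deg * ∑ i, d i * M.bary w i := by
  have h : (M.deg : ℝ) ≠ 0 := deg_pos_real.ne'
  simp only [form, bary, Finset.mul_sum]
  rw [Finset.sum_comm]
  refine Finset.sum_congr rfl fun i _ => ?_
  rw [mul_div_assoc', mul_div_assoc', mul_div_cancel_left₀ _ h, Finset.mul_sum]
  exact Finset.sum_congr rfl fun e _ => by ring

lemma bary_mem {w : ι → ℝ} (hw : w ∈ stdSimplex ℝ ι) : M.bary w ∈ stdSimplex ℝ (Fin 3) := by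
  refine ⟨fun i => div_nonneg (Finset.sum_nonneg fun e _ => mul_nonneg (hw.1 e) (by positivity))
    (by positivity), ?_⟩
  simp only [bary, ← Finset.sum_div]
  rw [Finset.sum_comm]
  simp only [← Finset.mul_sum, sum_exps_real, ← Finset.sum_mul, hw.2, one_mul]
  exact div_self deg_pos_real.ne'

lemma continuous_bary : Continuous (M.bary) := by unfold bary; fun_prop

lemma continuous_poly : Continuous (M.poly c) := by unfold poly; fun_prop

lemma bary_eq_zero_iff {w : ι → ℝ} (hw : ∀ e, 0 ≤ w e) (i : Fin 3) :
    M.bary w i = 0 ↔ ∀ e, w e ≠ 0 → M.exps e i = 0 := by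
  rw [bary, div_eq_zero_iff, or_iff_left deg_pos_real.ne',
    Finset.sum_eq_zero_iff_of_nonneg (fun e _ => mul_nonneg (hw e) (by positivity))]
  refine forall_congr' fun e => ?_
  simp only [Finset.mem_univ, true_imp_iff, mul_eq_zero, Nat.cast_eq_zero]
  tauto

lemma monomial_nonneg (hx : ∀ i, 0 ≤ x i) (e : ι) : 0 ≤ ∏ i, x i ^ M.exps e i :=
  Finset.prod_nonneg fun i _ => pow_nonneg (hx i) _

lemma monomial_eq_zero_iff (e : ι) :
    ∏ i, x i ^ M.exps e i = 0 ↔ ∃ i, x i = 0 ∧ M.exps e i ≠ 0 := by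
  simp [Finset.prod_eq_zero_iff, pow_eq_zero_iff']

lemma monomial_corner (i : Fin 3) : ∏ j, x j ^ M.exps (M.corner i) j = x i ^ M.deg := by
  simp only [M.exps_corner]
  rw [Finset.prod_eq_single i] <;> simp +contextual [eq_comm]

lemma monomial_smul (r : ℝ) (e : ι) :
    ∏ i, (r * x i) ^ M.exps e i = r ^ M.deg * ∏ i, x i ^ M.exps e i := by
  simp only [mul_pow, Finset.prod_mul_distrib, Finset.prod_pow_eq_pow_sum, M.sum_exps]

lemma poly_smul (r : ℝ) : M.poly c (fun i => r * x i) = r ^ M.deg * M.poly c x := by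
  simp only [poly, monomial_smul, Finset.mul_sum]
  exact Finset.sum_congr rfl fun e _ => by ring

lemma exists_pos_of_mem (hx : x ∈ stdSimplex ℝ (Fin 3)) : ∃ i, 0 < x i := by
  by_contra! h
  have := Finset.sum_nonpos fun i (_ : i ∈ Finset.univ) => h i
  rw [hx.2] at this
  linarith

lemma poly_pos (hc : ∀ e, 0 < c e) (hx : x ∈ stdSimplex ℝ (Fin 3)) : 0 < M.poly c x := by
  obtain ⟨i, hi⟩ := exists_pos_of_mem hx
  refine Finset.sum_pos' (fun e _ => mul_nonneg (hc e).le (monomial_nonneg hx.1 e))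
    ⟨M.corner i, Finset.mem_univ _, mul_pos (hc _) ?_⟩
  rw [monomial_corner]
  exact pow_pos hi _

lemma weight_nonneg (hc : ∀ e, 0 < c e) (hx : x ∈ stdSimplex ℝ (Fin 3)) (e : ι) :
    0 ≤ M.weight c x e :=
  div_nonneg (mul_nonneg (hc e).le (monomial_nonneg hx.1 e)) (poly_pos hc hx).le

lemma weight_mem (hc : ∀ e, 0 < c e) (hx : x ∈ stdSimplex ℝ (Fin 3)) :
    M.weight c x ∈ stdSimplex ℝ ι := by
  refine ⟨weight_nonneg hc hx, ?_⟩
  simp only [weight, ← Finset.sum_div]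
  exact div_self (poly_pos hc hx).ne'

lemma weight_eq_zero_iff (hc : ∀ e, 0 < c e) (hx : x ∈ stdSimplex ℝ (Fin 3)) (e : ι) :
    M.weight c x e = 0 ↔ ∃ i, x i = 0 ∧ M.exps e i ≠ 0 := by
  rw [weight, div_eq_zero_iff, or_iff_left (poly_pos hc hx).ne', mul_eq_zero,
    or_iff_right (hc e).ne', monomial_eq_zero_iff]

lemma continuousOn_weight (hc : ∀ e, 0 < c e) (e : ι) :
    ContinuousOn (fun x => M.weight c x e) (stdSimplex ℝ (Fin 3)) := by
  unfold weight
  refine ContinuousOn.div (by fun_prop) continuous_poly.continuousOn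
    fun x hx => (poly_pos hc hx).ne'

lemma moment_mem (hc : ∀ e, 0 < c e) (hx : x ∈ stdSimplex ℝ (Fin 3)) :
    M.moment c x ∈ stdSimplex ℝ (Fin 3) := bary_mem (weight_mem hc hx)

/-- The power of the i-th variable belongs to the family, so a positive i-th coordinate gives
positive weight to an exponent off the i-th side. Hence the moment map preserves all open faces. -/
lemma moment_eq_zero_iff (hc : ∀ e, 0 < c e) (hx : x ∈ stdSimplex ℝ (Fin 3)) (i : Fin 3) :
    M.moment c x i = 0 ↔ x i = 0 := by
  rw [moment, bary_eq_zero_iff (weight_nonneg hc hx)]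
  constructor
  · intro h
    by_contra hi
    have := h (M.corner i) ?_
    · rw [M.exps_corner, if_pos rfl] at this
      exact M.deg_pos.ne' this
    · rw [Ne, weight_eq_zero_iff hc hx]
      rintro ⟨j, hj, hj'⟩
      rw [M.exps_corner] at hj'
      split_ifs at hj' with hij
      · exact hi (hij ▸ hj)
      · exact hj' rfl
  · intro hi e he
    by_contra h
    exact he ((weight_eq_zero_iff hc hx e).2 ⟨i, hi, h⟩)

/-- Two points of the same open face have weights which differ by the exponential of a linear
form. -/
lemma exists_weight_eq_mul_exp (hc : ∀ e, 0 < c e) (hx : x ∈ stdSimplex ℝ (Fin 3))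
    (hx' : x' ∈ stdSimplex ℝ (Fin 3)) (h : ∀ i, x i = 0 ↔ x' i = 0) :
    ∃ d : Fin 3 → ℝ, ∀ e, M.weight c x' e = M.weight c x e * Real.exp (M.form d e) := by
  have hZ := poly_pos (M := M) hc hx
  have hZ' := poly_pos (M := M) hc hx'
  let u : Fin 3 → ℝ := fun i => if x i = 0 then 0 else Real.log (x' i / x i)
  have hu : ∀ i, x' i = x i * Real.exp (u i) := by
    intro i
    by_cases hi : x i = 0
    · rw [(h i).1 hi, hi, zero_mul]
    · have h1 : 0 < x i := lt_of_le_of_ne (hx.1 i) (Ne.symm hi)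
      have h2 : 0 < x' i := lt_of_le_of_ne (hx'.1 i) (fun h' => hi ((h i).2 h'.symm))
      simp only [u, if_neg hi]
      rw [Real.exp_log (div_pos h2 h1)]
      field_simp
  -- The exponents have sum `deg`, so the constant coming from the two denominators can be absorbed
  -- into a homogeneous form.
  refine ⟨fun i => u i + Real.log (M.poly c x / M.poly c x') / M.deg, fun e => ?_⟩
  rw [form_add_const, div_mul_cancel₀ _ deg_pos_real.ne', Real.exp_add,
    Real.exp_log (div_pos hZ hZ')]
  have h3 : ∏ i, x' i ^ M.exps e i = (∏ i, x i ^ M.exps e i) * Real.exp (M.form u e) := by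
    rw [form, Real.exp_sum, ← Finset.prod_mul_distrib]
    refine Finset.prod_congr rfl fun i _ => ?_
    rw [hu i, mul_pow, ← Real.exp_nat_mul, mul_comm (u i)]
  rw [weight, weight, h3]
  field_simp

/-- The weights of the three pure powers determine the point up to a scalar `r`, and `r` is 1
because both points have coordinate sum 1. -/
lemma eq_of_weight_eq (hc : ∀ e, 0 < c e) (hx : x ∈ stdSimplex ℝ (Fin 3))
    (hx' : x' ∈ stdSimplex ℝ (Fin 3)) (h : M.weight c x = M.weight c x') : x = x' := by
  have hZ := poly_pos (M := M) hc hx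
  have hZ' := poly_pos (M := M) hc hx'
  have hm : M.deg ≠ 0 := M.deg_pos.ne'
  set r : ℝ := (M.poly c x' / M.poly c x) ^ ((M.deg : ℝ)⁻¹) with hr
  have hr0 : 0 ≤ r := Real.rpow_nonneg (div_pos hZ' hZ).le _
  have hrm : r ^ M.deg = M.poly c x' / M.poly c x :=
    Real.rpow_inv_natCast_pow (div_pos hZ' hZ).le hm
  have key : ∀ i, x' i = r * x i := by
    intro i
    have h1 := congrFun h (M.corner i)
    simp only [weight, monomial_corner] at h1
    rw [div_eq_div_iff hZ.ne' hZ'.ne'] at h1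
    have h2 : x' i ^ M.deg = (r * x i) ^ M.deg := by
      rw [mul_pow, hrm]
      have := (hc (M.corner i)).ne'
      field_simp
      apply mul_left_cancel₀ this
      linarith
    exact (pow_left_inj₀ (hx'.1 i) (mul_nonneg hr0 (hx.1 i)) hm).1 h2
  have hr1 : r = 1 := by
    have := hx'.2
    simp only [key, ← Finset.mul_sum, hx.2, mul_one] at this
    exact this
  funext i
  rw [key i, hr1, one_mul]

lemma sub_mul_nonneg_of_eq_mul_exp {a b s : ℝ} (ha : 0 ≤ a) (h : b = a * Real.exp s) :
    0 ≤ (b - a) * s := by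
  have : (b - a) * s = a * ((Real.exp s - 1) * s) := by rw [h]; ring
  rw [this]
  refine mul_nonneg ha ?_
  rcases le_total 0 s with hs | hs
  · exact mul_nonneg (by linarith [Real.one_le_exp hs]) hs
  · exact mul_nonneg_of_nonpos_of_nonpos (by linarith [Real.exp_le_one_iff.2 hs]) hs

/-- Monotonicity: the sum of the terms (ω' - ω) ψ vanishes when the barycenters agree, while each
term is nonnegative, so each term is zero and the weights coincide. -/
lemma moment_injOn (hc : ∀ e, 0 < c e) :
    Set.InjOn (M.moment c) (stdSimplex ℝ (Fin 3)) := by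
  intro x hx x' hx' h
  have hz : ∀ i, x i = 0 ↔ x' i = 0 := fun i => by
    rw [← moment_eq_zero_iff hc hx, ← moment_eq_zero_iff hc hx', h]
  obtain ⟨d, hd⟩ := exists_weight_eq_mul_exp (M := M) hc hx hx' hz
  refine eq_of_weight_eq (M := M) hc hx hx' (funext fun e => ?_)
  have hsum : ∑ e, (M.weight c x' e - M.weight c x e) * M.form d e = 0 := by
    have h' : M.bary (M.weight c x) = M.bary (M.weight c x') := h
    simp only [sub_mul, Finset.sum_sub_distrib, sum_mul_form, h', sub_self]
  have h0 := (Finset.sum_eq_zero_iff_of_nonneg fun e _ =>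
    sub_mul_nonneg_of_eq_mul_exp (weight_nonneg hc hx e) (hd e)).1 hsum e (Finset.mem_univ e)
  rcases mul_eq_zero.1 h0 with h1 | h1
  · linarith
  · rw [hd e, h1, Real.exp_zero, mul_one]

/-- Variational argument: the preimage of p is a maximum point of `Θ`, the monomial with exponent
deg · p divided by the polynomial. The vanishing of its logarithmic derivatives is the equation
moment = p. -/
lemma exists_moment_eq_of_pos (hc : ∀ e, 0 < c e) {p : Fin 3 → ℝ}
    (hp : p ∈ stdSimplex ℝ (Fin 3)) (hpos : ∀ i, 0 < p i) :
    ∃ x ∈ stdSimplex ℝ (Fin 3), M.moment c x = p := by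
  classical
  let Θ : (Fin 3 → ℝ) → ℝ := fun x => (∏ i, x i ^ (M.deg * p i)) / M.poly c x
  have hexp : ∀ i, 0 < M.deg * p i := fun i => mul_pos deg_pos_real (hpos i)
  have hΘc : ContinuousOn Θ (stdSimplex ℝ (Fin 3)) := by
    refine ContinuousOn.div ?_ continuous_poly.continuousOn fun x hx => (poly_pos hc hx).ne'
    refine Continuous.continuousOn (continuous_finsetProd _ fun i _ => ?_)
    exact (continuous_apply i).rpow_const fun x => Or.inr (hexp i).le
  obtain ⟨x, hx, hmax⟩ := (isCompact_stdSimplex ℝ (Fin 3)).exists_isMaxOn ⟨p, hp⟩ hΘc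
  have hmax' : ∀ y ∈ stdSimplex ℝ (Fin 3), Θ y ≤ Θ x := fun y hy => hmax hy
  have hΘp : 0 < Θ p := div_pos (Finset.prod_pos fun i _ => Real.rpow_pos_of_pos (hpos i) _)
    (poly_pos hc hp)
  have hΘx : 0 < Θ x := hΘp.trans_le (hmax' p hp)
  -- All exponents of the numerator are positive, so `Θ` vanishes on the boundary and the maximum is
  -- attained inside.
  have hxpos : ∀ i, 0 < x i := by
    intro i
    refine lt_of_le_of_ne (hx.1 i) fun h0 => ?_
    have : ∏ j, x j ^ (M.deg * p j) = 0 :=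
      Finset.prod_eq_zero (Finset.mem_univ i) (by rw [← h0, Real.zero_rpow (hexp i).ne'])
    simp only [Θ, this, zero_div, lt_irrefl] at hΘx
  -- `Θ` is homogeneous of degree 0, so the maximum on the simplex is one over the whole open octant
  -- and single coordinates can be varied freely.
  have hhom : ∀ y : Fin 3 → ℝ, (∀ i, 0 < y i) → Θ y ≤ Θ x := by
    intro y hy
    have hS : 0 < ∑ i, y i := Finset.sum_pos (fun i _ => hy i) Finset.univ_nonempty
    set r : ℝ := (∑ i, y i)⁻¹
    have hr : 0 < r := inv_pos.2 hS
    have hmem : (fun i => r * y i) ∈ stdSimplex ℝ (Fin 3) :=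
      ⟨fun i => (mul_pos hr (hy i)).le, by rw [← Finset.mul_sum, inv_mul_cancel₀ hS.ne']⟩
    have : Θ (fun i => r * y i) = Θ y := by
      simp only [Θ, poly_smul]
      have : ∏ i, (r * y i) ^ (M.deg * p i) = r ^ M.deg * ∏ i, y i ^ (M.deg * p i) := by
        rw [show r ^ M.deg = ∏ i, r ^ (M.deg * p i) by
          rw [← Real.rpow_sum_of_pos hr, ← Finset.mul_sum, hp.2, mul_one, Real.rpow_natCast],
          ← Finset.prod_mul_distrib]
        exact Finset.prod_congr rfl fun i _ => Real.mul_rpow hr.le (hy i).le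
      rw [this, mul_div_mul_left _ _ (pow_pos hr _).ne']
    rw [← this]
    exact hmax' _ hmem
  refine ⟨x, hx, funext fun j => ?_⟩
  have hZ := poly_pos (M := M) hc hx
  -- Multiplying the j-th coordinate by exp s turns maximality into `g ≥ 0`, with equality at 0.
  let g : ℝ → ℝ := fun s =>
    (∑ e, M.weight c x e * Real.exp (s * M.exps e j)) - Real.exp (s * (M.deg * p j))
  have hg0 : g 0 = 0 := by simp [g, (weight_mem (M := M) hc hx).2]
  have hg : ∀ s, 0 ≤ g s := by
    intro s
    let y : Fin 3 → ℝ := fun i => x i * (if i = j then Real.exp s else 1)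
    have hy : ∀ i, 0 < y i := fun i => mul_pos (hxpos i) (by split_ifs <;> positivity)
    have h1 := hhom y hy
    have hprod : ∏ i, y i ^ (M.deg * p i)
        = (∏ i, x i ^ (M.deg * p i)) * Real.exp (s * (M.deg * p j)) := by
      simp only [y]
      rw [Finset.prod_congr rfl fun i _ => Real.mul_rpow (hxpos i).le
        (by split_ifs <;> positivity), Finset.prod_mul_distrib]
      congr 1
      rw [Finset.prod_eq_single j (fun i _ h => by rw [if_neg h, Real.one_rpow]) (by simp),
        if_pos rfl, ← Real.exp_mul]
    have hpoly : M.poly c y = M.poly c x * ∑ e, M.weight c x e * Real.exp (s * M.exps e j) := by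
      simp only [poly, Finset.mul_sum]
      refine Finset.sum_congr rfl fun e _ => ?_
      have : ∏ i, y i ^ M.exps e i = (∏ i, x i ^ M.exps e i) * Real.exp (s * M.exps e j) := by
        simp only [y, mul_pow, Finset.prod_mul_distrib]
        congr 1
        rw [Finset.prod_eq_single j (fun i _ h => by rw [if_neg h, one_pow]) (by simp),
          if_pos rfl, ← Real.exp_nat_mul, mul_comm]
      rw [this, weight]
      simp only [poly] at hZ ⊢
      field_simp
    have hypos : 0 < M.poly c y := by
      refine Finset.sum_pos (fun e _ => mul_pos (hc e) (Finset.prod_pos fun i _ =>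
        pow_pos (hy i) _)) ⟨M.corner 0, Finset.mem_univ _⟩
    simp only [Θ] at h1
    rw [hprod, div_le_div_iff₀ hypos hZ, hpoly] at h1
    have hP : 0 < ∏ i, x i ^ (M.deg * p i) :=
      Finset.prod_pos fun i _ => Real.rpow_pos_of_pos (hxpos i) _
    have h2 := le_of_mul_le_mul_left (a := (∏ i, x i ^ (M.deg * p i)) * M.poly c x)
      (b := Real.exp (s * (M.deg * p j)))
      (c := ∑ e, M.weight c x e * Real.exp (s * M.exps e j)) (by linarith) (mul_pos hP hZ)
    simp only [g]
    linarith
  have hmin : IsLocalMin g 0 := Filter.Eventually.of_forall fun s => by rw [hg0]; exact hg s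
  have hderiv : HasDerivAt g ((∑ e, M.weight c x e * M.exps e j) - M.deg * p j) 0 := by
    refine HasDerivAt.sub (HasDerivAt.fun_sum fun e _ => ?_) ?_
    · have := (((hasDerivAt_id (0 : ℝ)).mul_const (M.exps e j : ℝ)).exp).const_mul
        (M.weight c x e)
      simpa using this
    · have := ((hasDerivAt_id (0 : ℝ)).mul_const (M.deg * p j : ℝ)).exp
      simpa using this
  have h0 := hmin.hasDerivAt_eq_zero hderiv
  rw [moment, bary, div_eq_iff deg_pos_real.ne']
  linarith

lemma continuousOn_moment (hc : ∀ e, 0 < c e) :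
    ContinuousOn (M.moment c) (stdSimplex ℝ (Fin 3)) :=
  continuous_bary.comp_continuousOn (continuousOn_pi.2 fun e => continuousOn_weight hc e)

lemma stdSimplex_subset_closure_pos (p : Fin 3 → ℝ) (hp : p ∈ stdSimplex ℝ (Fin 3)) :
    p ∈ closure {q | q ∈ stdSimplex ℝ (Fin 3) ∧ ∀ i, 0 < q i} := by
  have hc : Filter.Tendsto (fun s : ℝ => fun i => (1 - s) * p i + s * (1 / 3))
      (nhdsWithin 0 (Set.Ioi 0)) (nhds p) := by
    have : Continuous (fun s : ℝ => fun i : Fin 3 => (1 - s) * p i + s * (1 / 3)) := by fun_prop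
    have h := this.tendsto 0
    simp only [sub_zero, one_mul, zero_mul, add_zero] at h
    exact h.mono_left nhdsWithin_le_nhds
  refine mem_closure_of_tendsto hc ?_
  have : Set.Ioo (0 : ℝ) 1 ∈ nhdsWithin 0 (Set.Ioi 0) := Ioo_mem_nhdsGT one_pos
  filter_upwards [this] with s hs
  have h1 : ∀ i, 0 < (1 - s) * p i + s * (1 / 3) := fun i => by
    have := mul_nonneg (sub_nonneg.2 hs.2.le) (hp.1 i)
    linarith [hs.1]
  refine ⟨⟨fun i => (h1 i).le, ?_⟩, h1⟩
  rw [Finset.sum_add_distrib, ← Finset.mul_sum, hp.2]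
  simp
  ring

/-- The image is compact and contains all points with positive coordinates, which are dense. -/
lemma moment_surjOn (hc : ∀ e, 0 < c e) :
    Set.SurjOn (M.moment c) (stdSimplex ℝ (Fin 3)) (stdSimplex ℝ (Fin 3)) := by
  intro p hp
  have hcl : IsClosed (M.moment c '' stdSimplex ℝ (Fin 3)) :=
    ((isCompact_stdSimplex ℝ (Fin 3)).image_of_continuousOn (continuousOn_moment hc)).isClosed
  refine (hcl.closure_subset_iff.2 ?_) (stdSimplex_subset_closure_pos p hp)
  rintro q ⟨hq, hq'⟩
  obtain ⟨x, hx, h⟩ := exists_moment_eq_of_pos (M := M) hc hq hq'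
  exact ⟨x, hx, h⟩

/-- The moment map is a homeomorphism of the closed triangle. -/
noncomputable def momentHomeo (M : MonomialFamily ι) (hc : ∀ e, 0 < c e) :
    stdSimplex ℝ (Fin 3) ≃ₜ stdSimplex ℝ (Fin 3) :=
  haveI : CompactSpace (stdSimplex ℝ (Fin 3)) :=
    isCompact_iff_compactSpace.1 (isCompact_stdSimplex ℝ (Fin 3))
  Continuous.homeoOfEquivCompactToT2
    (f := Equiv.ofBijective
      (fun x : stdSimplex ℝ (Fin 3) => (⟨M.moment c x.1, moment_mem hc x.2⟩ : stdSimplex ℝ (Fin 3)))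
      ⟨fun x y h => Subtype.ext (moment_injOn (M := M) hc x.2 y.2 (congrArg Subtype.val h)),
        fun p => by
          obtain ⟨x, hx, h⟩ := moment_surjOn (M := M) hc p.2
          exact ⟨⟨x, hx⟩, Subtype.ext h⟩⟩)
    (Continuous.subtype_mk (continuousOn_iff_continuous_domRestrict.1 (continuousOn_moment hc)) _)

lemma coe_momentHomeo (hc : ∀ e, 0 < c e) (x : stdSimplex ℝ (Fin 3)) :
    (M.momentHomeo hc x).1 = M.moment c x.1 := rfl

end MonomialFamily

/-! ### Estimates for weights that differ by the exponential of a linear form -/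

lemma abs_sub_le_of_eq_mul_exp {a b s : ℝ} (ha : 0 ≤ a) (h : b = a * Real.exp s) :
    |b - a| ≤ |s| * (a + b) := by
  have e1 := Real.add_one_le_exp s
  have e2 := Real.add_one_le_exp (-s)
  have hpos := Real.exp_pos s
  have h1 : Real.exp (-s) * Real.exp s = 1 := by rw [← Real.exp_add]; simp
  have h2 : b - a = a * (Real.exp s - 1) := by rw [h]; ring
  have h3 : a + b = a * (1 + Real.exp s) := by rw [h]; ring
  rw [h2, h3, abs_mul, abs_of_nonneg ha, mul_left_comm]
  refine mul_le_mul_of_nonneg_left ?_ ha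
  rcases le_total 0 s with hs | hs
  · rw [abs_of_nonneg hs, abs_of_nonneg (by linarith)]
    have : (-s + 1) * Real.exp s ≤ 1 := by
      have := mul_le_mul_of_nonneg_right e2 hpos.le
      rwa [h1] at this
    nlinarith
  · rw [abs_of_nonpos hs, abs_of_nonpos (by linarith [Real.exp_le_one_iff.2 hs])]
    nlinarith

/-- The inequality exp s ≥ 1 + s is applied from the smaller of a and b. This is the coercivity
which bounds ψ at vertices of definite weight. -/
lemma mul_sq_le_sub_mul_of_eq_mul_exp {a b s κ : ℝ} (hκ : 0 ≤ κ) (ha : κ ≤ a) (hb : κ ≤ b)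
    (h : b = a * Real.exp s) : κ * s ^ 2 ≤ (b - a) * s := by
  have e1 := Real.add_one_le_exp s
  have e2 := Real.add_one_le_exp (-s)
  have h1 : b * Real.exp (-s) = a := by
    rw [h, mul_assoc, ← Real.exp_add]; simp
  rcases le_total 0 s with hs | hs
  · have : a * (s + 1) ≤ b := by rw [h]; exact mul_le_mul_of_nonneg_left e1 (hκ.trans ha)
    nlinarith [mul_le_mul_of_nonneg_right ha hs, mul_nonneg hs hs]
  · have : b * (-s + 1) ≤ a := by rw [← h1]; exact mul_le_mul_of_nonneg_left e2 (hκ.trans hb)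
    have h2 : κ * (-s) ≤ a - b := by
      nlinarith [mul_le_mul_of_nonneg_right hb (neg_nonneg.2 hs)]
    nlinarith [mul_le_mul_of_nonneg_right h2 (neg_nonneg.2 hs)]

set_option maxHeartbeats 2000000 in
/-- If two families of weights differ by the exponential of an affine function, and the barycentric
coordinates of their barycenters with respect to a triangle `abc` differ little, then so do the
weights outside of the triangle. -/
lemma sum_abs_sub_weight_le {ι : Type*} [Fintype ι] {a b c : ι} (hab : a ≠ b) {U : Finset ι}
    {ω ω' ψ la lb lc : ι → ℝ} {C δ κ s : ℝ}
    (hω : ∀ e, 0 ≤ ω e) (hexp : ∀ e, ω' e = ω e * Real.exp (ψ e))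
    (hψ : ∀ e, ψ e = la e * ψ a + lb e * ψ b + lc e * ψ c)
    (hca : lc a = 0) (hcb : lc b = 0) (hcc : lc c = 1)
    (hC : 1 ≤ C) (hla : ∀ e, |la e| ≤ C) (hlb : ∀ e, |lb e| ≤ C) (hlc : ∀ e, |lc e| ≤ C)
    (hlc' : ∀ e, lc e ≠ 0 → 1 ≤ C * |lc e|)
    (hδ : 0 ≤ δ) (hκ : 0 < κ) (hκ1 : κ ≤ 1) (hs : 0 < s) (hsC : 6 * C * s ≤ 1)
    (hwa : |∑ e, (ω' e - ω e) * la e| ≤ 2 * δ) (hwb : |∑ e, (ω' e - ω e) * lb e| ≤ 2 * δ)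
    (hwc : |∑ e, (ω' e - ω e) * lc e| ≤ 2 * δ * ∑ e, ω e * lc e)
    (hwc1 : ∑ e, ω e * lc e ≤ 1)
    (hwc3 : ∑ e, ω e * lc e ≤ 3 * ∑ e, ω' e * lc e)
    (hca1 : ∑ e, ω e * lc e ≤ ω c + C * s ^ 2) (hca2 : ∑ e, ω' e * lc e ≤ ω' c + C * s ^ 2)
    (h1 : κ ≤ ω a) (h2 : κ ≤ ω b) (h3 : κ ≤ ω' a) (h4 : κ ≤ ω' b)
    (hU : ∑ e ∈ U, ω e ≤ s ^ 2) (hU' : ∑ e ∈ U, ω' e ≤ s ^ 2) :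
    ∑ e ∈ U, |ω' e - ω e| ≤ 100 * C ^ 5 / κ * s * δ := by
  classical
  set A := |ψ a| + |ψ b| with hA
  set wc := ∑ e, ω e * lc e with hwcdef
  have hA0 : 0 ≤ A := by positivity
  have hC0 : 0 < C := by linarith
  have hω' : ∀ e, 0 ≤ ω' e := fun e => by rw [hexp]; exact mul_nonneg (hω e) (Real.exp_pos _).le
  have hwc0 : 0 ≤ 2 * δ * wc := (abs_nonneg _).trans hwc
  have hterm : ∀ e, 0 ≤ (ω' e - ω e) * ψ e := fun e =>
    MonomialFamily.sub_mul_nonneg_of_eq_mul_exp (hω e) (hexp e)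
  have hab_lin : ∀ e, |la e * ψ a + lb e * ψ b| ≤ C * A := fun e => by
    calc _ ≤ |la e * ψ a| + |lb e * ψ b| := abs_add_le _ _
      _ ≤ C * |ψ a| + C * |ψ b| := by
        rw [abs_mul, abs_mul]
        gcongr
        · exact hla e
        · exact hlb e
      _ = C * A := by ring
  have hAB : |ψ a * ∑ e, (ω' e - ω e) * la e + ψ b * ∑ e, (ω' e - ω e) * lb e| ≤ 2 * δ * A := by
    calc _ ≤ |ψ a * ∑ e, (ω' e - ω e) * la e| + |ψ b * ∑ e, (ω' e - ω e) * lb e| := abs_add_le _ _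
      _ ≤ |ψ a| * (2 * δ) + |ψ b| * (2 * δ) := by
        rw [abs_mul, abs_mul]; gcongr
      _ = 2 * δ * A := by ring
  have hkey2 : κ * A ^ 2 / 2 ≤ (ω' a - ω a) * ψ a + (ω' b - ω b) * ψ b := by
    have ha := mul_sq_le_sub_mul_of_eq_mul_exp hκ.le h1 h3 (hexp a)
    have hb := mul_sq_le_sub_mul_of_eq_mul_exp hκ.le h2 h4 (hexp b)
    have : A ^ 2 ≤ 2 * (ψ a ^ 2 + ψ b ^ 2) := by
      rw [← sq_abs (ψ a), ← sq_abs (ψ b), hA]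
      nlinarith [sq_nonneg (|ψ a| - |ψ b|)]
    linarith [mul_le_mul_of_nonneg_left this hκ.le]
  -- A sum which is at least quadratic and at most linear in `A` forces `A` = O(δ). It is used with
  -- S the whole sum of (ω' - ω) ψ, or its part over the exponents on the line ab.
  have hAle : ∀ {S : ℝ}, κ * A ^ 2 / 2 ≤ S → S ≤ 4 * C ^ 2 * δ * A → A ≤ 8 * C ^ 2 * δ / κ := by
    intro S hS1 hS2
    rw [le_div_iff₀ hκ]
    rcases hA0.eq_or_lt with h0 | h0
    · rw [← h0, zero_mul]; positivity
    · have : A * (A * κ) ≤ A * (8 * C ^ 2 * δ) := by linarith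
      exact le_of_mul_le_mul_left this h0
  have hsmall : ∀ (V : Finset ι) (B : ℝ), V ⊆ U → 0 ≤ B → (∀ e ∈ V, |ψ e| ≤ B) →
      ∑ e ∈ V, |ω' e - ω e| ≤ B * (2 * s ^ 2) := by
    intro V B hV hB h
    calc ∑ e ∈ V, |ω' e - ω e| ≤ ∑ e ∈ V, B * (ω e + ω' e) := by
          refine Finset.sum_le_sum fun e he =>
            (abs_sub_le_of_eq_mul_exp (hω e) (hexp e)).trans ?_
          exact mul_le_mul_of_nonneg_right (h e he) (add_nonneg (hω e) (hω' e))
      _ ≤ ∑ e ∈ U, B * (ω e + ω' e) := Finset.sum_le_sum_of_subset_of_nonneg hV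
          fun e _ _ => mul_nonneg hB (add_nonneg (hω e) (hω' e))
      _ = B * (∑ e ∈ U, ω e + ∑ e ∈ U, ω' e) := by
          rw [← Finset.mul_sum, Finset.sum_add_distrib]
      _ ≤ B * (2 * s ^ 2) := mul_le_mul_of_nonneg_left (by linarith) hB
  have hC2 : 1 ≤ C ^ 2 := one_le_pow₀ hC
  have hC35 : C ^ 3 ≤ C ^ 5 := pow_le_pow_right₀ hC (by norm_num)
  have hC15 : C ≤ C ^ 5 := le_self_pow₀ hC (by norm_num)
  have hs1 : s ≤ 1 := by linarith [mul_le_mul_of_nonneg_right hC hs.le]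
  have hfin : ∀ {Q R : ℝ}, Q ≤ R → R * κ ≤ 100 * C ^ 5 * s * δ →
      Q ≤ 100 * C ^ 5 / κ * s * δ := by
    intro Q R h h'
    refine h.trans ?_
    rw [div_mul_eq_mul_div, div_mul_eq_mul_div, le_div_iff₀ hκ]
    exact h'
  have hsδ : 0 ≤ s * δ := mul_nonneg hs.le hδ
  have hssδ : s ^ 2 * δ ≤ s * δ := by linarith [mul_le_mul_of_nonneg_right hs1 hsδ]
  -- The weight at c has no lower bound, so `ψ c` is not controlled by coercivity. Either it is
  -- comparable to `A`, or it dominates `ψ` at every exponent off the line ab.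
  by_cases hcase : |ψ c| ≤ C ^ 2 * A
  · have hE : ∑ e, (ω' e - ω e) * ψ e ≤ 4 * C ^ 2 * δ * A := by
      have : ∑ e, (ω' e - ω e) * ψ e = (ψ a * ∑ e, (ω' e - ω e) * la e +
          ψ b * ∑ e, (ω' e - ω e) * lb e) + ψ c * ∑ e, (ω' e - ω e) * lc e := by
        simp only [Finset.mul_sum, ← Finset.sum_add_distrib]
        exact Finset.sum_congr rfl fun e _ => by rw [hψ e]; ring
      rw [this]
      have h5 := (le_abs_self _).trans hAB
      have h6 : ψ c * ∑ e, (ω' e - ω e) * lc e ≤ C ^ 2 * A * (2 * δ) := by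
        refine (le_abs_self _).trans ?_
        rw [abs_mul]
        refine mul_le_mul hcase (hwc.trans ?_) (abs_nonneg _) (by positivity)
        linarith [mul_le_mul_of_nonneg_left hwc1 hδ]
      linarith [mul_le_mul_of_nonneg_right hC2 (mul_nonneg hδ hA0)]
    have hE' : (ω' a - ω a) * ψ a + (ω' b - ω b) * ψ b ≤ ∑ e, (ω' e - ω e) * ψ e := by
      rw [← Finset.sum_pair (f := fun e => (ω' e - ω e) * ψ e) hab]
      exact Finset.sum_le_sum_of_subset_of_nonneg (Finset.subset_univ _) fun e _ _ => hterm e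
    have hAle' := hAle (hkey2.trans hE') hE
    have hall : ∀ e ∈ U, |ψ e| ≤ 2 * C ^ 3 * A := fun e _ => by
      rw [hψ e]
      refine (abs_add_le _ _).trans ?_
      have h7 : |lc e * ψ c| ≤ C * (C ^ 2 * A) := by
        rw [abs_mul]; exact mul_le_mul (hlc e) hcase (abs_nonneg _) hC0.le
      have : C ≤ C ^ 3 := le_self_pow₀ hC (by norm_num)
      linarith [hab_lin e, mul_le_mul_of_nonneg_right this hA0]
    refine hfin (hsmall U _ subset_rfl (by positivity) hall) ?_
    rw [le_div_iff₀ hκ] at hAle'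
    calc 2 * C ^ 3 * A * (2 * s ^ 2) * κ = 4 * C ^ 3 * s ^ 2 * (A * κ) := by ring
      _ ≤ 4 * C ^ 3 * s ^ 2 * (8 * C ^ 2 * δ) := by gcongr
      _ = 32 * C ^ 5 * (s ^ 2 * δ) := by ring
      _ ≤ 32 * C ^ 5 * (s * δ) := by gcongr
      _ ≤ 100 * C ^ 5 * s * δ := by linarith [mul_nonneg (pow_nonneg hC0.le 5) hsδ]
  · push Not at hcase
    -- Off the line ab the term `lc e * ψ c` exceeds the rest of `ψ e`, so `ψ e`, and with it ω' -
    -- ω, has its sign.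
    have hsign : ∀ e, 0 ≤ (ω' e - ω e) * lc e * ψ c := by
      intro e
      by_cases he : lc e = 0
      · simp [he]
      have h5 : 0 ≤ ψ e * (lc e * ψ c) := by
        have h6 : C * A < |lc e * ψ c| := by
          rw [abs_mul]
          have := hlc' e he
          have h7 : C * (C * A) < C * (|lc e| * |ψ c|) := by
            linarith [mul_le_mul_of_nonneg_right this (abs_nonneg (ψ c))]
          exact lt_of_mul_lt_mul_left h7 hC0.le
        have h8 := abs_le.1 (hab_lin e)
        rw [hψ e]
        rcases le_total 0 (lc e * ψ c) with h9 | h9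
        · rw [abs_of_nonneg h9] at h6
          exact mul_nonneg (by linarith) h9
        · rw [abs_of_nonpos h9] at h6
          exact mul_nonneg_of_nonpos_of_nonpos (by linarith) h9
      have h10 := hterm e
      by_cases hpe : ψ e = 0
      · rw [hexp e, hpe]; simp
      · have : 0 < ψ e ^ 2 := by positivity
        have h11 : 0 ≤ ((ω' e - ω e) * lc e * ψ c) * ψ e ^ 2 := by
          have := mul_nonneg h10 h5
          linarith
        exact nonneg_of_mul_nonneg_left h11 this
    have hc0 : 0 < |ψ c| := lt_of_le_of_lt (by positivity) hcase
    -- No cancellation occurs: all terms have the sign of `ψ c`. The change of the barycentric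
    -- coordinate at c thus bounds the total variation off the line ab.
    have hsumabs : ∑ e, |ω' e - ω e| * |lc e| = |∑ e, (ω' e - ω e) * lc e| := by
      have h5 : ∑ e, |ω' e - ω e| * |lc e| * |ψ c| = |(∑ e, (ω' e - ω e) * lc e) * ψ c| := by
        rw [Finset.sum_mul, abs_of_nonneg (Finset.sum_nonneg fun e _ => hsign e)]
        refine Finset.sum_congr rfl fun e _ => ?_
        rw [← abs_mul, ← abs_mul, abs_of_nonneg (hsign e)]
      rw [← Finset.sum_mul, abs_mul] at h5
      exact mul_right_cancel₀ hc0.ne' h5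
    have hoff : ∑ e ∈ Finset.univ.filter (fun e => lc e ≠ 0), |ω' e - ω e| ≤ 2 * C * δ * wc := by
      calc _ ≤ ∑ e ∈ Finset.univ.filter (fun e => lc e ≠ 0), C * (|ω' e - ω e| * |lc e|) := by
            refine Finset.sum_le_sum fun e he => ?_
            have := hlc' e (Finset.mem_filter.1 he).2
            linarith [mul_le_mul_of_nonneg_left this (abs_nonneg (ω' e - ω e))]
        _ ≤ ∑ e, C * (|ω' e - ω e| * |lc e|) :=
            Finset.sum_le_sum_of_subset_of_nonneg (Finset.subset_univ _)
              fun e _ _ => by positivity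
        _ = C * |∑ e, (ω' e - ω e) * lc e| := by rw [← Finset.mul_sum, hsumabs]
        _ ≤ C * (2 * δ * wc) := mul_le_mul_of_nonneg_left hwc hC0.le
        _ = 2 * C * δ * wc := by ring
    -- The sum is restricted to the line ab, where `ψ` depends only on its values at a and b. The
    -- omitted terms are bounded by `hoff`.
    have hAle' : A ≤ 8 * C ^ 2 * δ / κ := by
      have hsplit : ∑ e ∈ Finset.univ.filter (fun e => ¬ lc e ≠ 0), (ω' e - ω e) * ψ e =
          (ψ a * ∑ e, (ω' e - ω e) * la e + ψ b * ∑ e, (ω' e - ω e) * lb e) -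
          ∑ e ∈ Finset.univ.filter (fun e => lc e ≠ 0),
            (ω' e - ω e) * (la e * ψ a + lb e * ψ b) := by
        have h5 : ψ a * ∑ e, (ω' e - ω e) * la e + ψ b * ∑ e, (ω' e - ω e) * lb e =
            ∑ e, (ω' e - ω e) * (la e * ψ a + lb e * ψ b) := by
          simp only [Finset.mul_sum, ← Finset.sum_add_distrib]
          exact Finset.sum_congr rfl fun e _ => by ring
        rw [h5, ← Finset.sum_filter_add_sum_filter_not Finset.univ (fun e => lc e ≠ 0),
          add_sub_cancel_left]
        refine Finset.sum_congr rfl fun e he => ?_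
        have : lc e = 0 := not_not.1 (Finset.mem_filter.1 he).2
        rw [hψ e, this]; ring
      refine hAle (S := ∑ e ∈ Finset.univ.filter (fun e => ¬ lc e ≠ 0), (ω' e - ω e) * ψ e) ?_ ?_
      · refine hkey2.trans ?_
        rw [← Finset.sum_pair (f := fun e => (ω' e - ω e) * ψ e) hab]
        refine Finset.sum_le_sum_of_subset_of_nonneg ?_ fun e _ _ => hterm e
        intro e he
        rcases Finset.mem_insert.1 he with rfl | he
        · simp [hca]
        · rw [Finset.mem_singleton.1 he]; simp [hcb]
      · rw [hsplit]
        have h6 : |∑ e ∈ Finset.univ.filter (fun e => lc e ≠ 0),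
            (ω' e - ω e) * (la e * ψ a + lb e * ψ b)| ≤ C * A * (2 * C * δ) := by
          refine (Finset.abs_sum_le_sum_abs _ _).trans ?_
          calc _ ≤ ∑ e ∈ Finset.univ.filter (fun e => lc e ≠ 0), C * A * |ω' e - ω e| := by
                refine Finset.sum_le_sum fun e _ => ?_
                rw [abs_mul, mul_comm]
                exact mul_le_mul_of_nonneg_right (hab_lin e) (abs_nonneg _)
            _ ≤ C * A * (2 * C * δ * wc) := by
                rw [← Finset.mul_sum]
                exact mul_le_mul_of_nonneg_left hoff (by positivity)
            _ ≤ C * A * (2 * C * δ) := by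
                refine mul_le_mul_of_nonneg_left ?_ (by positivity)
                exact mul_le_of_le_one_right (by positivity) hwc1
        have h7 := (le_abs_self _).trans hAB
        have h8 := neg_le_of_abs_le h6
        linarith [mul_le_mul_of_nonneg_right hC2 (mul_nonneg hδ hA0)]
    have hAκ := hAle'
    rw [le_div_iff₀ hκ] at hAκ
    -- If the coordinate at c is at most s, `hoff` already has the required factor s. Otherwise the
    -- weights at c are at least s / 6, and coercivity at c gives s |ψ c| ≤ 12 δ.
    by_cases hwcs : wc ≤ s
    · have h5 : ∑ e ∈ U.filter (fun e => lc e ≠ 0), |ω' e - ω e| ≤ 2 * C * δ * s := by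
        refine (Finset.sum_le_sum_of_subset_of_nonneg (Finset.filter_subset_filter _
          (Finset.subset_univ U)) fun e _ _ => abs_nonneg _).trans (hoff.trans ?_)
        gcongr
      have h6 : ∑ e ∈ U.filter (fun e => ¬ lc e ≠ 0), |ω' e - ω e| ≤ C * A * (2 * s ^ 2) := by
        refine hsmall _ _ (Finset.filter_subset _ _) (by positivity) fun e he => ?_
        have : lc e = 0 := not_not.1 (Finset.mem_filter.1 he).2
        rw [hψ e, this, zero_mul, add_zero]
        exact hab_lin e
      rw [← Finset.sum_filter_add_sum_filter_not U (fun e => lc e ≠ 0)]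
      refine hfin (add_le_add h5 h6) ?_
      calc (2 * C * δ * s + C * A * (2 * s ^ 2)) * κ
          = 2 * C * (s * δ) * κ + 2 * C * s ^ 2 * (A * κ) := by ring
        _ ≤ 2 * C * (s * δ) * 1 + 2 * C * s ^ 2 * (8 * C ^ 2 * δ) := by gcongr
        _ = 2 * C * (s * δ) + 16 * C ^ 3 * (s ^ 2 * δ) := by ring
        _ ≤ 2 * C ^ 5 * (s * δ) + 16 * C ^ 5 * (s * δ) := by gcongr
        _ ≤ 100 * C ^ 5 * s * δ := by linarith [mul_nonneg (pow_nonneg hC0.le 5) hsδ]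
    · push Not at hwcs
      have hCs : C * s ^ 2 ≤ s / 6 := by linarith [mul_le_mul_of_nonneg_right hsC hs.le]
      have k1 : s / 6 ≤ ω c := by linarith
      have k2 : s / 6 ≤ ω' c := by linarith
      have k3 := mul_sq_le_sub_mul_of_eq_mul_exp (by positivity) k1 k2 (hexp c)
      have k4 : |ω' c - ω c| ≤ 2 * δ := by
        have h5 : |ω' c - ω c| * |lc c| ≤ ∑ e, |ω' e - ω e| * |lc e| :=
          Finset.single_le_sum (f := fun e => |ω' e - ω e| * |lc e|)
            (fun e _ => by positivity) (Finset.mem_univ c)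
        rw [hcc, abs_one, mul_one, hsumabs] at h5
        refine h5.trans (hwc.trans ?_)
        exact mul_le_of_le_one_right (by positivity) hwc1
      have k5 : s * |ψ c| ≤ 12 * δ := by
        have h5 : (ω' c - ω c) * ψ c ≤ 2 * δ * |ψ c| := by
          refine (le_abs_self _).trans ?_
          rw [abs_mul]; gcongr
        rw [← sq_abs] at k3
        have h6 : |ψ c| * (s * |ψ c|) ≤ |ψ c| * (12 * δ) := by linarith
        exact le_of_mul_le_mul_left h6 hc0
      have hall : ∀ e ∈ U, |ψ e| ≤ C * A + C * |ψ c| := fun e _ => by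
        rw [hψ e]
        refine (abs_add_le _ _).trans (add_le_add (hab_lin e) ?_)
        rw [abs_mul]; exact mul_le_mul_of_nonneg_right (hlc e) (abs_nonneg _)
      refine hfin (hsmall U _ subset_rfl (by positivity) hall) ?_
      calc (C * A + C * |ψ c|) * (2 * s ^ 2) * κ
          = 2 * C * s ^ 2 * (A * κ) + 2 * C * s * (s * |ψ c|) * κ := by ring
        _ ≤ 2 * C * s ^ 2 * (8 * C ^ 2 * δ) + 2 * C * s * (12 * δ) * 1 := by gcongr
        _ = 16 * C ^ 3 * (s ^ 2 * δ) + 24 * C * (s * δ) := by ring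
        _ ≤ 16 * C ^ 5 * (s * δ) + 24 * C ^ 5 * (s * δ) := by gcongr
        _ ≤ 100 * C ^ 5 * s * δ := by linarith [mul_nonneg (pow_nonneg hC0.le 5) hsδ]

/-! ### Convex triangulations and concentration of the weights -/

/-- A convex triangulation, given by its vertices (the exponents of a family of monomials), its
triangles, with their barycentric coordinates, and the heights of the vertices. -/
structure ConvexTriangulation {ι : Type*} [Fintype ι] (M : MonomialFamily ι) where
  tri : Set (Finset ι)
  card_tri : ∀ T ∈ tri, T.card = 3
  coord : Finset ι → ι → Fin 3 → ℝ
  coord_self : ∀ T ∈ tri, ∀ a ∈ T, M.form (coord T a) a = 1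
  coord_ne : ∀ T ∈ tri, ∀ a ∈ T, ∀ b ∈ T, a ≠ b → M.form (coord T a) b = 0
  form_eq : ∀ T ∈ tri, ∀ d e, M.form d e = ∑ a ∈ T, M.form (coord T a) e * M.form d a
  unique : ∀ T ∈ tri, ∀ T' ∈ tri, ∀ w ∈ stdSimplex ℝ ι, ∀ w' ∈ stdSimplex ℝ ι,
    (∀ e ∉ T, w e = 0) → (∀ e ∉ T', w' e = 0) → M.bary w = M.bary w' → w = w'
  cover : ∀ p ∈ stdSimplex ℝ (Fin 3), ∃ T ∈ tri, ∃ w ∈ stdSimplex ℝ ι,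
    (∀ e ∉ T, w e = 0) ∧ M.bary w = p
  height : ι → ℝ
  exists_form_lt : ∀ T ∈ tri, ∃ d, (∀ e ∈ T, height e = M.form d e) ∧
    ∀ e ∉ T, M.form d e < height e

namespace ConvexTriangulation

open MonomialFamily

variable {ι : Type*} [Fintype ι] {M : MonomialFamily ι} (K : ConvexTriangulation M)

/-- The geometric realization: weights of vertices which are supported on a triangle. -/
def body : Set (ι → ℝ) := {w | w ∈ stdSimplex ℝ ι ∧ ∃ T ∈ K.tri, ∀ e ∉ T, w e = 0}

/-- The coefficients given by the heights. -/
noncomputable def coeff (L : ℝ) (e : ι) : ℝ := Real.exp (-(L * K.height e))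

variable {K}

lemma coeff_pos (L : ℝ) (e : ι) : 0 < K.coeff L e := Real.exp_pos _

/-- There are finitely many triangles and vertices, so the strict inequalities have a common margin.
-/
lemma exists_gap : ∃ g > 0, ∀ T ∈ K.tri, ∃ d, (∀ e ∈ T, K.height e = M.form d e) ∧
    ∀ e ∉ T, M.form d e + g ≤ K.height e := by
  have h : ∀ T : Finset ι, ∀ᶠ g in nhdsWithin (0 : ℝ) (Set.Ioi 0), T ∈ K.tri →
      ∃ d, (∀ e ∈ T, K.height e = M.form d e) ∧ ∀ e ∉ T, M.form d e + g ≤ K.height e := by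
    intro T
    by_cases hT : T ∈ K.tri
    · obtain ⟨d, hd, hd'⟩ := K.exists_form_lt T hT
      have : ∀ e, ∀ᶠ g in nhdsWithin (0 : ℝ) (Set.Ioi 0), e ∉ T → M.form d e + g ≤ K.height e := by
        intro e
        by_cases he : e ∈ T
        · simp [he]
        · have := hd' e he
          filter_upwards [Ioo_mem_nhdsGT (sub_pos.2 this)] with g hg _
          linarith [hg.2]
      filter_upwards [Filter.eventually_all.2 this] with g hg _
      exact ⟨d, hd, hg⟩
    · simp [hT]
  obtain ⟨g, hg, hg0⟩ := ((Filter.eventually_all.2 h).and self_mem_nhdsWithin).exists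
  exact ⟨g, hg0, hg⟩

lemma exists_coord_bound : ∃ C : ℝ, 1 ≤ C ∧ ∀ T a e, |M.form (K.coord T a) e| ≤ C ∧
    (M.form (K.coord T a) e ≠ 0 → 1 ≤ C * |M.form (K.coord T a) e|) := by
  have h : ∀ T a e, ∀ᶠ C : ℝ in Filter.atTop, |M.form (K.coord T a) e| ≤ C ∧
      (M.form (K.coord T a) e ≠ 0 → 1 ≤ C * |M.form (K.coord T a) e|) := by
    intro T a e
    filter_upwards [Filter.eventually_ge_atTop |M.form (K.coord T a) e|,
      Filter.eventually_ge_atTop |M.form (K.coord T a) e|⁻¹] with C h1 h2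
    refine ⟨h1, fun h => ?_⟩
    have h0 : 0 < |M.form (K.coord T a) e| := abs_pos.2 h
    rw [← div_le_iff₀ h0, one_div]
    exact h2
  obtain ⟨C, h1, h2⟩ := ((Filter.eventually_ge_atTop (1 : ℝ)).and (Filter.eventually_all.2
    fun T => Filter.eventually_all.2 fun a => Filter.eventually_all.2 fun e => h T a e)).exists
  exact ⟨C, h1, h2⟩

open Classical in
/-- As the parameter grows, the weights concentrate on the triangle which contains the value of the
moment map. -/
lemma exists_sum_weight_compl_le : ∃ B : ℝ, ∀ L > 0, ∀ T ∈ K.tri, ∀ w ∈ stdSimplex ℝ ι,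
    (∀ e ∉ T, w e = 0) → ∀ x ∈ stdSimplex ℝ (Fin 3), M.moment (K.coeff L) x = M.bary w →
    L * ∑ e ∈ Tᶜ, M.weight (K.coeff L) x e ≤ B := by
  obtain ⟨g, hg, hgap⟩ := K.exists_gap
  refine ⟨Fintype.card ι / g, fun L hL T hT w hw hwT x hx hxw => ?_⟩
  obtain ⟨d, hd, hd'⟩ := hgap T hT
  set ω := M.weight (K.coeff L) x with hω
  have hc : ∀ e, 0 < K.coeff L e := coeff_pos L
  have hω0 : ∀ e, 0 ≤ ω e := weight_nonneg hc hx
  have hZ : 0 < M.poly (K.coeff L) x := poly_pos hc hx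
  -- The linear part of log ω, corrected by the form which supports the heights on T. The default
  -- value log 0 = 0 is harmless: if x i = 0, then every e with ω e ≠ 0 has i-th exponent 0.
  let u : Fin 3 → ℝ := fun i => Real.log (x i) - L * d i
  let ψ : Fin 3 → ℝ := fun i => u i + -(Real.log (M.poly (K.coeff L) x) / M.deg)
  have hψ : ∀ e, ω e ≠ 0 → Real.log (ω e) = M.form ψ e - L * (K.height e - M.form d e) := by
    intro e he
    have hxe : ∀ i, x i ^ M.exps e i ≠ 0 := by
      intro i h0
      have h1 := pow_eq_zero_iff'.1 h0
      exact he ((weight_eq_zero_iff hc hx e).2 ⟨i, h1.1, h1.2⟩)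
    have hprod : ∏ i, x i ^ M.exps e i ≠ 0 := Finset.prod_ne_zero_iff.2 fun i _ => hxe i
    rw [hω, weight, Real.log_div (mul_ne_zero (hc e).ne' hprod) hZ.ne',
      Real.log_mul (hc e).ne' hprod, coeff, Real.log_exp, Real.log_prod fun i _ => hxe i,
      form_add_const, neg_mul, div_mul_cancel₀ _ deg_pos_real.ne']
    have : M.form u e = ∑ i, Real.log (x i ^ M.exps e i) - L * M.form d e := by
      simp only [form, Finset.mul_sum, ← Finset.sum_sub_distrib, u, Real.log_pow]
      exact Finset.sum_congr rfl fun i _ => by ring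
    rw [this]
    ring
  -- Equal barycenters allow ω to be replaced by w, which lives on T; there `ψ` is the logarithm of
  -- a number at most 1.
  have h1 : ∑ e, ω e * M.form ψ e ≤ 0 := by
    have : ∑ e, ω e * M.form ψ e = ∑ e, w e * M.form ψ e := by
      rw [sum_mul_form, sum_mul_form, ← hxw, moment]
    rw [this]
    refine Finset.sum_nonpos fun e _ => ?_
    by_cases he : w e = 0
    · simp [he]
    · have heT : e ∈ T := by
        by_contra h
        exact he (hwT e h)
      have hωe : ω e ≠ 0 := by
        intro h
        obtain ⟨i, hi, hi'⟩ := (weight_eq_zero_iff hc hx e).1 h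
        have := (moment_eq_zero_iff (M := M) hc hx i).2 hi
        rw [hxw, bary_eq_zero_iff hw.1] at this
        exact hi' (this e he)
      refine mul_nonpos_of_nonneg_of_nonpos (hw.1 e) ?_
      have h2 := hψ e hωe
      rw [hd e heT, sub_self, mul_zero, sub_zero] at h2
      rw [← h2]
      refine Real.log_nonpos (hω0 e) ?_
      rw [← (weight_mem (M := M) hc hx).2]
      exact Finset.single_le_sum (fun e _ => hω0 e) (Finset.mem_univ e)
  -- The entropy term is bounded below by ω log ω ≥ ω - 1 ≥ -1. Summation gives the constant
  -- `Fintype.card ι`, and division by the gap gives B.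
  have h2 : ∀ e, -1 + L * (ω e * (K.height e - M.form d e)) ≤ ω e * M.form ψ e := by
    intro e
    rcases (hω0 e).eq_or_lt with h | h
    · rw [← h]; simp
    · have h3 := Real.one_sub_inv_le_log_of_pos h
      have h4 : ω e - 1 ≤ ω e * Real.log (ω e) := by
        have := mul_le_mul_of_nonneg_left h3 h.le
        rwa [mul_sub, mul_one, mul_inv_cancel₀ h.ne'] at this
      rw [hψ e h.ne'] at h4
      linarith
  have h3 := (Finset.sum_le_sum fun e (_ : e ∈ Finset.univ) => h2 e).trans h1
  rw [Finset.sum_add_distrib, ← Finset.mul_sum, Finset.sum_const, Finset.card_univ,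
    nsmul_eq_mul] at h3
  have h4 : g * ∑ e ∈ Tᶜ, ω e ≤ ∑ e, ω e * (K.height e - M.form d e) := by
    rw [Finset.mul_sum, ← Finset.sum_add_sum_compl T]
    have : ∑ e ∈ T, ω e * (K.height e - M.form d e) = 0 :=
      Finset.sum_eq_zero fun e he => by rw [hd e he, sub_self, mul_zero]
    rw [this, zero_add]
    refine Finset.sum_le_sum fun e he => ?_
    rw [mul_comm]
    exact mul_le_mul_of_nonneg_left (by linarith [hd' e (Finset.mem_compl.1 he)]) (hω0 e)
  rw [le_div_iff₀ hg]
  have := mul_le_mul_of_nonneg_left h4 hL.le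
  linarith

/-- Barycentric coordinates are linear forms, hence their means depend only on the barycenter; for
weights supported on T they return the weights themselves. -/
lemma coord_sum_eq {T : Finset ι} (hT : T ∈ K.tri) {w v : ι → ℝ} (hwT : ∀ e ∉ T, w e = 0)
    (hv : M.bary v = M.bary w) {a : ι} (ha : a ∈ T) :
    ∑ e, v e * M.form (K.coord T a) e = w a := by
  rw [sum_mul_form, hv, ← sum_mul_form, Finset.sum_eq_single a, K.coord_self T hT a ha, mul_one]
  · intro b _ hb
    by_cases hbT : b ∈ T
    · rw [K.coord_ne T hT a ha b hbT hb.symm, mul_zero]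
    · rw [hwT b hbT, zero_mul]
  · simp

open Classical in
/-- The difference between a function on the vertices and its interpolation from a triangle. -/
lemma abs_sum_sub_interpolation_le {T : Finset ι} (hT : T ∈ K.tri) {C : ℝ}
    (hC : ∀ a e, |M.form (K.coord T a) e| ≤ C) {σ : ι → ℝ} (hσ : ∀ e, |σ e| ≤ 1) (v : ι → ℝ) :
    |∑ e, σ e * v e - ∑ a ∈ T, σ a * ∑ e, v e * M.form (K.coord T a) e| ≤
      (1 + 3 * C) * ∑ e ∈ Tᶜ, |v e| := by
  have h1 : ∑ e, σ e * v e - ∑ a ∈ T, σ a * ∑ e, v e * M.form (K.coord T a) e =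
      ∑ e, (σ e - ∑ a ∈ T, σ a * M.form (K.coord T a) e) * v e := by
    simp only [sub_mul, Finset.sum_sub_distrib, Finset.mul_sum, Finset.sum_mul]
    rw [Finset.sum_comm]
    congr 1
    exact Finset.sum_congr rfl fun e _ => Finset.sum_congr rfl fun a _ => by ring
  have h2 : ∑ e ∈ T, (σ e - ∑ a ∈ T, σ a * M.form (K.coord T a) e) * v e = 0 := by
    refine Finset.sum_eq_zero fun e he => ?_
    rw [Finset.sum_eq_single e, K.coord_self T hT e he, mul_one, sub_self, zero_mul]
    · intro a ha hae
      rw [K.coord_ne T hT a ha e he hae, mul_zero]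
    · exact fun h => (h he).elim
  rw [h1, ← Finset.sum_add_sum_compl T, h2, zero_add, Finset.mul_sum]
  refine (Finset.abs_sum_le_sum_abs _ _).trans (Finset.sum_le_sum fun e _ => ?_)
  rw [abs_mul]
  refine mul_le_mul_of_nonneg_right ((abs_sub _ _).trans (add_le_add (hσ e) ?_)) (abs_nonneg _)
  refine (Finset.abs_sum_le_sum_abs _ _).trans ?_
  calc ∑ a ∈ T, |σ a * M.form (K.coord T a) e| ≤ ∑ a ∈ T, C := by
        refine Finset.sum_le_sum fun a _ => ?_
        rw [abs_mul]
        exact (mul_le_of_le_one_left (abs_nonneg _) (hσ a)).trans (hC a e)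
    _ = 3 * C := by rw [Finset.sum_const, K.card_tri T hT]; simp

end ConvexTriangulation

/-! ### Join segments and the variation of the sign function along them -/

/-- Multiplication of the weights of the positive vertices by `r` and of the other ones by `q`. -/
noncomputable def rescale {ι : Type*} (σ : ι → ℝ) (r q : ℝ) (w : ι → ℝ) (e : ι) : ℝ :=
  w e * if σ e = 1 then r else q

section Rescale

variable {ι : Type*} [Fintype ι] {σ : ι → ℝ} {w : ι → ℝ}

/-- The total weight of the positive vertices. -/
noncomputable def posPart (σ : ι → ℝ) (w : ι → ℝ) : ℝ := ∑ e, if σ e = 1 then w e else 0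

lemma sum_eq_posPart (hw : ∑ e, w e = 1) :
    ∑ e, (if σ e = 1 then 0 else w e) = 1 - posPart σ w := by
  rw [posPart, eq_sub_iff_add_eq, ← Finset.sum_add_distrib]
  exact (Finset.sum_congr rfl fun e _ => by split_ifs <;> simp).trans hw

lemma sum_sign_mul (hσ : ∀ e, σ e = 1 ∨ σ e = -1) (hw : ∑ e, w e = 1) :
    ∑ e, σ e * w e = 2 * posPart σ w - 1 := by
  have : 2 * posPart σ w - 1 = posPart σ w - ∑ e, (if σ e = 1 then 0 else w e) := by
    rw [sum_eq_posPart hw]; ring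
  rw [this, posPart, ← Finset.sum_sub_distrib]
  refine Finset.sum_congr rfl fun e _ => ?_
  rcases hσ e with h | h
  · simp [h]
  · have : (-1 : ℝ) ≠ 1 := by norm_num
    simp [h, this]

lemma posPart_rescale (r q : ℝ) : posPart σ (rescale σ r q w) = r * posPart σ w := by
  simp only [posPart, rescale, Finset.mul_sum]
  exact Finset.sum_congr rfl fun e _ => by split_ifs <;> ring

lemma sum_rescale (hw : ∑ e, w e = 1) (r q : ℝ) :
    ∑ e, rescale σ r q w e = r * posPart σ w + q * (1 - posPart σ w) := by
  rw [← sum_eq_posPart hw, posPart, Finset.mul_sum, Finset.mul_sum, ← Finset.sum_add_distrib]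
  refine Finset.sum_congr rfl fun e _ => ?_
  simp only [rescale]
  split_ifs <;> ring

lemma factor_bounds {α α' r δ : ℝ} (h1 : 1 / 4 ≤ α) (h2 : α ≤ 3 / 4) (h3 : 1 / 4 ≤ α')
    (h : α' = r * α) (hδ : 2 * |α' - α| ≤ δ) : |r - 1| ≤ 2 * δ ∧ 1 ≤ 3 * r := by
  constructor
  · have h4 : |α' - α| = |r - 1| * α := by
      rw [h, ← abs_of_nonneg (by linarith : 0 ≤ α), ← abs_mul, abs_of_nonneg (by linarith : 0 ≤ α)]
      congr 1; ring
    rw [h4] at hδ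
    nlinarith [abs_nonneg (r - 1)]
  · nlinarith

/-- For |f| ≤ 1/2 the positive and the negative mass both lie in [1/4, 3/4], and r and q are ratios
of such masses. The relative bound, proportional to `w e`, is essential at a vertex of small weight.
-/
lemma rescale_bounds (hσ : ∀ e, σ e = 1 ∨ σ e = -1) {r q δ : ℝ} (hw : w ∈ stdSimplex ℝ ι)
    (hw' : rescale σ r q w ∈ stdSimplex ℝ ι) (hf : |∑ e, σ e * w e| ≤ 1 / 2)
    (hf' : |∑ e, σ e * rescale σ r q w e| ≤ 1 / 2)
    (hδ : |∑ e, σ e * rescale σ r q w e - ∑ e, σ e * w e| ≤ δ) (e : ι) :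
    |rescale σ r q w e - w e| ≤ 2 * δ * w e ∧ w e ≤ 3 * rescale σ r q w e := by
  rw [sum_sign_mul hσ hw.2, abs_le] at hf
  rw [sum_sign_mul hσ hw'.2, abs_le] at hf'
  rw [sum_sign_mul hσ hw.2, sum_sign_mul hσ hw'.2,
    show ∀ a b : ℝ, 2 * a - 1 - (2 * b - 1) = 2 * (a - b) by intros; ring, abs_mul,
    abs_of_pos (by norm_num : (0 : ℝ) < 2)] at hδ
  have hP := posPart_rescale (σ := σ) (w := w) r q
  have hS := sum_rescale (σ := σ) hw.2 r q
  rw [hw'.2] at hS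
  have hr := factor_bounds (by linarith [hf.1]) (by linarith [hf.2]) (by linarith [hf'.1]) hP hδ
  have hq : |q - 1| ≤ 2 * δ ∧ 1 ≤ 3 * q := by
    refine factor_bounds (α := 1 - posPart σ w) (α' := 1 - posPart σ (rescale σ r q w))
      (by linarith [hf.2]) (by linarith [hf.1]) (by linarith [hf'.2]) (by rw [hP]; linarith) ?_
    rw [show ∀ a b : ℝ, 1 - a - (1 - b) = -(a - b) by intros; ring, abs_neg]
    exact hδ
  have main : ∀ k : ℝ, |k - 1| ≤ 2 * δ ∧ 1 ≤ 3 * k →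
      |w e * k - w e| ≤ 2 * δ * w e ∧ w e ≤ 3 * (w e * k) := by
    rintro k ⟨h1, h2⟩
    have := hw.1 e
    constructor
    · rw [show w e * k - w e = (k - 1) * w e by ring, abs_mul, abs_of_nonneg this]
      exact mul_le_mul_of_nonneg_right h1 this
    · nlinarith
  simp only [rescale]
  split_ifs
  · exact main r hr
  · exact main q hq

end Rescale

namespace ConvexTriangulation

open MonomialFamily

variable {ι : Type*} [Fintype ι] {M : MonomialFamily ι} {K : ConvexTriangulation M}

lemma exists_mem_of_sum_ge {T : Finset ι} (hT : T.card = 3) {w : ι → ℝ} {P : ι → Prop}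
    [DecidablePred P] (hwT : ∀ e ∉ T, w e = 0)
    (h : 1 / 4 ≤ ∑ e, if P e then w e else 0) : ∃ a ∈ T, P a ∧ 1 / 12 ≤ w a := by
  by_contra! hcon
  have h1 : ∑ e, (if P e then w e else 0) = ∑ e ∈ T, if P e then w e else 0 := by
    refine (Finset.sum_subset (Finset.subset_univ T) fun e _ he => ?_).symm
    rw [hwT e he, ite_self]
  have h2 : ∑ e ∈ T, (if P e then w e else 0) < ∑ e ∈ T, (1 / 12 : ℝ) := by
    refine Finset.sum_lt_sum_of_nonempty (Finset.card_pos.1 (by omega)) fun e he => ?_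
    split_ifs with hP
    · exact hcon e he hP
    · norm_num
  rw [Finset.sum_const, hT] at h2
  norm_num at h2
  linarith

open Classical in
/-- The variation of the value of the sign function along a segment of the join structure is
almost the same on the triangulation and on the toric side. -/
lemma abs_variation_sub_le {T : Finset ι} (hT : T ∈ K.tri) {C : ℝ} (hC1 : 1 ≤ C)
    (hC : ∀ T a e, |M.form (K.coord T a) e| ≤ C ∧
      (M.form (K.coord T a) e ≠ 0 → 1 ≤ C * |M.form (K.coord T a) e|))
    {s : ℝ} (hs : 0 < s) (hsC : 72 * C * s ≤ 1) {c : ι → ℝ} (hc : ∀ e, 0 < c e)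
    {σ : ι → ℝ} (hσ : ∀ e, σ e = 1 ∨ σ e = -1) {r q : ℝ} {w : ι → ℝ} (hw : w ∈ stdSimplex ℝ ι)
    (hw' : rescale σ r q w ∈ stdSimplex ℝ ι) (hwT : ∀ e ∉ T, w e = 0)
    {x x' : Fin 3 → ℝ} (hx : x ∈ stdSimplex ℝ (Fin 3)) (hx' : x' ∈ stdSimplex ℝ (Fin 3))
    (hxw : M.moment c x = M.bary w) (hxw' : M.moment c x' = M.bary (rescale σ r q w))
    (hU : ∑ e ∈ Tᶜ, M.weight c x e ≤ s ^ 2) (hU' : ∑ e ∈ Tᶜ, M.weight c x' e ≤ s ^ 2)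
    (hf : |∑ e, σ e * w e| ≤ 1 / 2) (hf' : |∑ e, σ e * rescale σ r q w e| ≤ 1 / 2) :
    |(∑ e, σ e * M.weight c x' e - ∑ e, σ e * M.weight c x e) -
        (∑ e, σ e * rescale σ r q w e - ∑ e, σ e * w e)| ≤
      28800 * C ^ 6 * s * |∑ e, σ e * rescale σ r q w e - ∑ e, σ e * w e| := by
  set w' := rescale σ r q w with hw'def
  set ω := M.weight c x with hω
  set ω' := M.weight c x' with hω'
  set δ := |∑ e, σ e * w' e - ∑ e, σ e * w e| with hδ
  have hb := rescale_bounds hσ hw hw' hf hf' le_rfl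
  rw [← hw'def, ← hδ] at hb
  have hw'T : ∀ e ∉ T, w' e = 0 := fun e he => by simp [hw'def, rescale, hwT e he]
  have hω0 : ∀ e, 0 ≤ ω e := weight_nonneg hc hx
  have hω'0 : ∀ e, 0 ≤ ω' e := weight_nonneg hc hx'
  have hw1 : ∀ e, w e ≤ 1 := fun e => by
    rw [← hw.2]; exact Finset.single_le_sum (fun e _ => hw.1 e) (Finset.mem_univ e)
  have hC0 : 0 ≤ C := by linarith
  have hCs : C * s ^ 2 ≤ 1 / 72 := by
    have : s ≤ 1 := by nlinarith
    nlinarith [mul_nonneg hC0 hs.le]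
  -- the two weights of a vertex of the triangle are close
  have hclose : ∀ v u : ι → ℝ, (∀ e ∉ T, u e = 0) → M.bary v = M.bary u → (∀ e, 0 ≤ v e) →
      ∑ e ∈ Tᶜ, v e ≤ s ^ 2 → ∀ a ∈ T, u a ≤ v a + C * s ^ 2 := by
    intro v u hu huv hv hvs a ha
    rw [← coord_sum_eq hT hu huv ha, ← Finset.sum_add_sum_compl T]
    refine add_le_add (le_of_eq ?_) ?_
    · rw [Finset.sum_eq_single a, K.coord_self T hT a ha, mul_one]
      · intro b hb hba
        rw [K.coord_ne T hT a ha b hb hba.symm, mul_zero]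
      · exact fun h => (h ha).elim
    · calc ∑ e ∈ Tᶜ, v e * M.form (K.coord T a) e ≤ ∑ e ∈ Tᶜ, v e * C :=
            Finset.sum_le_sum fun e _ => mul_le_mul_of_nonneg_left
              ((le_abs_self _).trans (hC T a e).1) (hv e)
        _ ≤ C * s ^ 2 := by rw [← Finset.sum_mul, mul_comm]; gcongr
  have hcl := hclose ω w hwT hxw hω0 hU
  have hcl' := hclose ω' w' hw'T hxw' hω'0 hU'
  -- By `hb` the rescaled weights have the same support, so both toric points lie in the same open
  -- face and their weights can be compared by an exponential.
  have hpat : ∀ i, x i = 0 ↔ x' i = 0 := by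
    intro i
    rw [← moment_eq_zero_iff (M := M) hc hx, ← moment_eq_zero_iff (M := M) hc hx', hxw, hxw',
      bary_eq_zero_iff hw.1, bary_eq_zero_iff hw'.1]
    refine forall_congr' fun e => ?_
    have : w e ≠ 0 ↔ w' e ≠ 0 := by
      constructor
      · intro h h'
        have := (hb e).2
        rw [h', mul_zero] at this
        exact h (le_antisymm this (hw.1 e))
      · intro h h'
        exact h (by simp [hw'def, rescale, h'])
    rw [this]
  obtain ⟨d, hd⟩ := exists_weight_eq_mul_exp (M := M) hc hx hx' hpat
  -- Each sign carries mass at least 1/4, spread over at most three vertices: one of them has weight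
  -- at least 1/12.
  obtain ⟨a, haT, haσ, haw⟩ := exists_mem_of_sum_ge (P := fun e => σ e = 1) (K.card_tri T hT) hwT (by
    have h1 := sum_sign_mul hσ hw.2
    have h2 := (abs_le.1 hf).1
    rw [h1] at h2
    change 1 / 4 ≤ posPart σ w
    linarith)
  obtain ⟨b, hbT, hbσ, hbw⟩ := exists_mem_of_sum_ge (P := fun e => ¬ σ e = 1) (K.card_tri T hT) hwT
    (by
      have h1 := sum_sign_mul hσ hw.2
      have h2 := (abs_le.1 hf).2
      rw [h1] at h2
      have h3 := sum_eq_posPart (σ := σ) hw.2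
      have : ∑ e, (if ¬ σ e = 1 then w e else 0) = ∑ e, (if σ e = 1 then 0 else w e) :=
        Finset.sum_congr rfl fun e _ => by split_ifs <;> simp_all
      rw [this, h3]
      linarith)
  have hab : a ≠ b := fun h => hbσ (h ▸ haσ)
  obtain ⟨k, hk⟩ : ∃ k, (T.erase a).erase b = {k} := by
    rw [← Finset.card_eq_one, Finset.card_erase_of_mem (Finset.mem_erase.2 ⟨hab.symm, hbT⟩),
      Finset.card_erase_of_mem haT, K.card_tri T hT]
  have hkm : k ∈ (T.erase a).erase b := by rw [hk]; exact Finset.mem_singleton_self k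
  have hkb : k ≠ b := (Finset.mem_erase.1 hkm).1
  have hka : k ≠ a := (Finset.mem_erase.1 (Finset.mem_erase.1 hkm).2).1
  have hkT : k ∈ T := (Finset.mem_erase.1 (Finset.mem_erase.1 hkm).2).2
  have hTeq : T = {a, b, k} := by
    rw [← Finset.insert_erase haT, ← Finset.insert_erase (Finset.mem_erase.2 ⟨hab.symm, hbT⟩), hk]
  have hdiff : ∀ v ∈ T, ∑ e, (ω' e - ω e) * M.form (K.coord T v) e = w' v - w v := by
    intro v hv
    simp only [sub_mul, Finset.sum_sub_distrib]
    rw [coord_sum_eq hT hw'T hxw' hv, coord_sum_eq hT hwT hxw hv]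
  have hδ0 : 0 ≤ δ := abs_nonneg _
  have hdiff' : ∀ v ∈ T, |∑ e, (ω' e - ω e) * M.form (K.coord T v) e| ≤ 2 * δ := fun v hv => by
    rw [hdiff v hv]
    refine (hb v).1.trans ?_
    exact mul_le_of_le_one_right (by positivity) (hw1 v)
  -- At a and b the weights w, w' are at least 1/12 and 1/36. Passing to ω, ω' costs at most C s² ≤
  -- 1/72, which leaves κ = 1/72.
  have hcore : ∑ e ∈ Tᶜ, |ω' e - ω e| ≤ 100 * C ^ 5 / (1 / 72) * s * δ := by
    refine sum_abs_sub_weight_le (c := k) (ψ := M.form d) (la := M.form (K.coord T a))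
      (lb := M.form (K.coord T b)) (lc := M.form (K.coord T k)) hab hω0 hd ?_
      (K.coord_ne T hT k hkT a haT hka) (K.coord_ne T hT k hkT b hbT hkb)
      (K.coord_self T hT k hkT) hC1 (fun e => (hC T a e).1) (fun e => (hC T b e).1)
      (fun e => (hC T k e).1) (fun e => (hC T k e).2) hδ0 (by norm_num) (by norm_num) hs
      (by nlinarith [mul_nonneg hC0 hs.le])
      (hdiff' a haT) (hdiff' b hbT) ?_ ?_ ?_ ?_ ?_ ?_ ?_ ?_ ?_ hU hU'
    · intro e
      rw [K.form_eq T hT d e]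
      conv_lhs => rw [show T.sum = ({a, b, k} : Finset ι).sum by rw [← hTeq]]
      rw [Finset.sum_insert (by simp [hab, hka.symm]), Finset.sum_insert (by simp [hkb.symm]),
        Finset.sum_singleton, ← add_assoc]
    · rw [hdiff k hkT, coord_sum_eq hT hwT hxw hkT]
      exact (hb k).1
    · rw [coord_sum_eq hT hwT hxw hkT]; exact hw1 k
    · rw [coord_sum_eq hT hwT hxw hkT, coord_sum_eq hT hw'T hxw' hkT]; exact (hb k).2
    · rw [coord_sum_eq hT hwT hxw hkT]; exact hcl k hkT
    · rw [coord_sum_eq hT hw'T hxw' hkT]; exact hcl' k hkT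
    · linarith [hcl a haT]
    · linarith [hcl b hbT]
    · linarith [hcl' a haT, (hb a).2]
    · linarith [hcl' b hbT, (hb b).2]
  have hσ1 : ∀ e, |σ e| ≤ 1 := fun e => by rcases hσ e with h | h <;> simp [h]
  have hint := abs_sum_sub_interpolation_le hT (fun a e => (hC T a e).1) hσ1 (fun e => ω' e - ω e)
  have h1 : ∑ v ∈ T, σ v * ∑ e, (ω' e - ω e) * M.form (K.coord T v) e =
      ∑ e, σ e * w' e - ∑ e, σ e * w e := by
    rw [← Finset.sum_sub_distrib, ← Finset.sum_subset (Finset.subset_univ T)]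
    · exact Finset.sum_congr rfl fun v hv => by rw [hdiff v hv]; ring
    · intro e _ he
      rw [hwT e he, hw'T e he]; ring
  have h2 : ∑ e, σ e * (ω' e - ω e) = ∑ e, σ e * ω' e - ∑ e, σ e * ω e := by
    rw [← Finset.sum_sub_distrib]; exact Finset.sum_congr rfl fun e _ => by ring
  rw [h1, h2] at hint
  refine hint.trans ?_
  calc (1 + 3 * C) * ∑ e ∈ Tᶜ, |ω' e - ω e|
      ≤ (4 * C) * (100 * C ^ 5 / (1 / 72) * s * δ) :=
        mul_le_mul (by linarith) hcore (Finset.sum_nonneg fun _ _ => abs_nonneg _) (by linarith)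
    _ = 28800 * C ^ 6 * s * δ := by ring

-- A function on the vertices has the same mean for v and w up to its deviation from the affine
-- interpolation on T, and this deviation is charged only to the mass outside T.
open Classical in
lemma abs_sum_sign_sub_le {T : Finset ι} (hT : T ∈ K.tri) {C : ℝ} (hC1 : 1 ≤ C)
    (hC : ∀ a e, |M.form (K.coord T a) e| ≤ C) {σ : ι → ℝ} (hσ : ∀ e, |σ e| ≤ 1)
    {w v : ι → ℝ} (hwT : ∀ e ∉ T, w e = 0) (hv0 : ∀ e, 0 ≤ v e) (hv : M.bary v = M.bary w) :
    |∑ e, σ e * v e - ∑ e, σ e * w e| ≤ 4 * C * ∑ e ∈ Tᶜ, v e := by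
  have h := abs_sum_sub_interpolation_le hT hC hσ v
  have h1 : ∑ a ∈ T, σ a * ∑ e, v e * M.form (K.coord T a) e = ∑ e, σ e * w e := by
    rw [← Finset.sum_subset (Finset.subset_univ T)]
    · exact Finset.sum_congr rfl fun a ha => by rw [coord_sum_eq hT hwT hv ha]
    · intro e _ he
      rw [hwT e he, mul_zero]
  rw [h1] at h
  refine h.trans ?_
  simp only [abs_of_nonneg (hv0 _)]
  exact mul_le_mul_of_nonneg_right (by linarith) (Finset.sum_nonneg fun e _ => hv0 e)

/-- For all coefficients given by a large parameter, the sign function on the toric side is close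
to the sign function on the triangulation, also as regards its variation along the segments of the
join structure. -/
lemma exists_parameter_forall_close (K : ConvexTriangulation M) {ε : ℝ} (hε : 0 < ε) :
    ∃ L₀ : ℝ, ∀ L > L₀, ∀ σ : ι → ℝ,
    (∀ e, σ e = 1 ∨ σ e = -1) → ∀ w ∈ K.body, ∀ x ∈ stdSimplex ℝ (Fin 3),
    M.moment (K.coeff L) x = M.bary w →
    |∑ e, σ e * M.weight (K.coeff L) x e - ∑ e, σ e * w e| ≤ ε ∧
    ∀ r q : ℝ, rescale σ r q w ∈ stdSimplex ℝ ι → ∀ x' ∈ stdSimplex ℝ (Fin 3),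
      M.moment (K.coeff L) x' = M.bary (rescale σ r q w) →
      |∑ e, σ e * w e| ≤ 1 / 2 → |∑ e, σ e * rescale σ r q w e| ≤ 1 / 2 →
      |(∑ e, σ e * M.weight (K.coeff L) x' e - ∑ e, σ e * M.weight (K.coeff L) x e) -
        (∑ e, σ e * rescale σ r q w e - ∑ e, σ e * w e)| ≤
      ε * |∑ e, σ e * rescale σ r q w e - ∑ e, σ e * w e| := by
  classical
  obtain ⟨C, hC1, hC⟩ := K.exists_coord_bound
  obtain ⟨B, hB⟩ := K.exists_sum_weight_compl_le
  have hC0 : 0 < C := by linarith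
  have hC6 : C ≤ C ^ 6 := le_self_pow₀ hC1 (by norm_num)
  -- The number s² bounds the mass outside the triangle; with this s the relative error 28800 C⁶ s
  -- of the variation is at most ε.
  set s : ℝ := min ε 1 / (28800 * C ^ 6) with hsdef
  have hs : 0 < s := by positivity
  have hs1 : 28800 * C ^ 6 * s = min ε 1 := by rw [hsdef]; field_simp
  have hsC : 72 * C * s ≤ 1 := by
    have h1 : C * s ≤ C ^ 6 * s := mul_le_mul_of_nonneg_right hC6 hs.le
    linarith [min_le_right ε 1, mul_pos hC0 hs]
  have hs4 : 4 * C * s ^ 2 ≤ ε := by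
    have h1 : C * s ≤ C ^ 6 * s := mul_le_mul_of_nonneg_right hC6 hs.le
    have h2 : s ≤ 1 := by nlinarith
    have h3 : 4 * C * s ^ 2 ≤ 4 * C * s := by nlinarith [mul_pos hC0 hs]
    linarith [min_le_left ε 1, mul_pos hC0 hs]
  -- The outer mass is at most B / L, hence at most s² from here on. The bound does not involve σ,
  -- so one parameter serves all quadrants.
  refine ⟨max 0 (B / s ^ 2), fun L hL σ hσ w hw x hx hxw => ?_⟩
  have hL0 : 0 < L := (le_max_left _ _).trans_lt hL
  have hLB : B ≤ L * s ^ 2 := by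
    have := (le_max_right 0 (B / s ^ 2)).trans hL.le
    rwa [div_le_iff₀ (by positivity)] at this
  have hc : ∀ e, 0 < K.coeff L e := coeff_pos L
  obtain ⟨hw, T, hT, hwT⟩ := hw
  have hsum : ∀ w ∈ stdSimplex ℝ ι, (∀ e ∉ T, w e = 0) → ∀ x ∈ stdSimplex ℝ (Fin 3),
      M.moment (K.coeff L) x = M.bary w → ∑ e ∈ Tᶜ, M.weight (K.coeff L) x e ≤ s ^ 2 :=
    fun w hw hwT x hx hxw =>
      le_of_mul_le_mul_left ((hB L hL0 T hT w hw hwT x hx hxw).trans hLB) hL0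
  have hσ1 : ∀ e, |σ e| ≤ 1 := fun e => by rcases hσ e with h | h <;> simp [h]
  have hU := hsum w hw hwT x hx hxw
  refine ⟨?_, fun r q hw' x' hx' hxw' hf hf' => ?_⟩
  · refine (abs_sum_sign_sub_le hT hC1 (fun a e => (hC T a e).1) hσ1 hwT
      (weight_nonneg hc hx) hxw).trans (le_trans ?_ hs4)
    gcongr
  · have hU' := hsum _ hw' (fun e he => by simp [rescale, hwT e he]) x' hx' hxw'
    refine (abs_variation_sub_le hT hC1 hC hs hsC hc hσ hw hw' hwT hx hx' hxw hxw' hU hU' hf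
      hf').trans (mul_le_mul_of_nonneg_right ?_ (abs_nonneg _))
    rw [hs1]
    exact min_le_left _ _

end ConvexTriangulation

/-! ### Correction along the join segments -/

/-- A cut-off function: `1` for `|f| ≤ 1/4` and `0` for `|f| ≥ 1/2`. -/
noncomputable def cutoff (f : ℝ) : ℝ := max 0 (min 1 (2 - 4 * |f|))

/-- The function which interpolates between `F` near the zero set of `f` and `f`. -/
noncomputable def blend (f F : ℝ) : ℝ := f + cutoff f * (F - f)

/-- The factor by which the positive weights are multiplied in order to replace `f` by
`blend f F`. -/
noncomputable def blendFactor (f F : ℝ) : ℝ := 1 + cutoff f * (F - f) / max (1 + f) (1 / 2)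

section Blend

variable {f F f' F' : ℝ}

lemma cutoff_nonneg : 0 ≤ cutoff f := le_max_left _ _

lemma cutoff_le_one : cutoff f ≤ 1 := max_le zero_le_one (min_le_left _ _)

lemma cutoff_neg : cutoff (-f) = cutoff f := by simp [cutoff]

lemma cutoff_eq_zero (h : 1 / 2 ≤ |f|) : cutoff f = 0 :=
  max_eq_left ((min_le_right _ _).trans (by linarith))

lemma cutoff_eq_one (h : |f| ≤ 1 / 4) : cutoff f = 1 := by
  rw [cutoff, min_eq_left (by linarith), max_eq_right zero_le_one]

lemma abs_cutoff_sub_le : |cutoff f' - cutoff f| ≤ 4 * |f' - f| := by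
  unfold cutoff
  have h1 := abs_min_sub_min_le_max (1 : ℝ) (2 - 4 * |f'|) 1 (2 - 4 * |f|)
  have h2 := abs_abs_sub_abs_le f' f
  have h3 := abs_max_sub_max_le_max (0 : ℝ) (min 1 (2 - 4 * |f'|)) 0 (min 1 (2 - 4 * |f|))
  simp only [sub_self, abs_zero] at h1 h3
  have h4 : |2 - 4 * |f'| - (2 - 4 * |f|)| = 4 * |(|f'| - |f|)| := by
    rw [show 2 - 4 * |f'| - (2 - 4 * |f|) = -(4 * (|f'| - |f|)) by ring, abs_neg, abs_mul]
    norm_num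
  rw [h4, max_eq_right (by positivity)] at h1
  rw [max_eq_right (abs_nonneg (min 1 (2 - 4 * |f'|) - min 1 (2 - 4 * |f|)))] at h3
  exact h3.trans (h1.trans (by linarith))

/-- Twice the positive mass is 1 + f. The maximum in the denominator only prevents division by zero
at f = -1: where the cut-off is nonzero, 1 + f exceeds 1/2. -/
lemma blendFactor_mul (f F : ℝ) : blendFactor f F * (1 + f) = 1 + blend f F := by
  unfold blendFactor blend
  rcases le_or_gt (1 / 2) |f| with hf | hf
  · rw [cutoff_eq_zero hf]; simp
  · have := abs_lt.1 hf
    rw [max_eq_left (by linarith), add_mul, div_mul_cancel₀ _ (by linarith)]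
    ring

lemma blendFactor_neg_mul (f F : ℝ) :
    blendFactor (-f) (-F) * (1 - f) = 1 - blend f F := by
  have := blendFactor_mul (-f) (-F)
  rw [← sub_eq_add_neg] at this
  rw [this]
  simp only [blend, cutoff_neg]
  ring

lemma blendFactor_of_ge (h : 1 / 2 ≤ |f|) : blendFactor f F = 1 := by
  simp [blendFactor, cutoff_eq_zero h]

lemma blend_of_ge (h : 1 / 2 ≤ |f|) : blend f F = f := by
  simp [blend, cutoff_eq_zero h]

lemma blendFactor_pos (h : |F - f| ≤ 1 / 8) : 0 < blendFactor f F := by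
  have h1 : |cutoff f * (F - f) / max (1 + f) (1 / 2)| ≤ 1 / 4 := by
    have hm : (1 / 2 : ℝ) ≤ max (1 + f) (1 / 2) := le_max_right _ _
    rw [abs_div, abs_mul, abs_of_nonneg cutoff_nonneg, abs_of_pos (by linarith : 0 < max (1 + f) (1 / 2)),
      div_le_iff₀ (by linarith)]
    have := mul_le_mul (cutoff_le_one (f := f)) h (abs_nonneg _) zero_le_one
    linarith
  have := (abs_le.1 h1).1
  unfold blendFactor
  linarith

/-- For |f| ≤ 1/4 the blend is F. Otherwise f and F have the same sign, and so does their convex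
combination. -/
lemma blend_eq_zero_iff (h : |F - f| ≤ 1 / 8) : blend f F = 0 ↔ F = 0 := by
  have hb := abs_le.1 h
  have h0 := cutoff_nonneg (f := f)
  have h1 := cutoff_le_one (f := f)
  rcases le_or_gt |f| (1 / 4) with hf | hf
  · rw [blend, cutoff_eq_one hf]; simp
  · have e : blend f F = (1 - cutoff f) * f + cutoff f * F := by unfold blend; ring
    rcases lt_abs.1 hf with hf | hf
    · have : 0 < F := by linarith
      refine iff_of_false ?_ this.ne'
      rw [e]
      refine ne_of_gt (lt_of_lt_of_le (by norm_num : (0 : ℝ) < 1 / 8) ?_)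
      nlinarith
    · have : F < 0 := by linarith
      refine iff_of_false ?_ this.ne
      rw [e]
      refine ne_of_lt (lt_of_le_of_lt (b := -(1 / 8 : ℝ)) ?_ (by norm_num))
      nlinarith

/-- The cut-off is 4-Lipschitz and multiplies a quantity of size 1/8, so it can cost half of the
increment of f. The variation of F - f costs at most another eighth. -/
lemma blend_lt_blend (h : |F - f| ≤ 1 / 8) (h' : |F' - f'| ≤ 1 / 8) (hlt : f < f')
    (hvar : |f| ≤ 1 / 2 → |f'| ≤ 1 / 2 → |(F' - F) - (f' - f)| ≤ 1 / 8 * |f' - f|) :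
    blend f F < blend f' F' := by
  have hl := abs_cutoff_sub_le (f := f) (f' := f')
  have hd : |f' - f| = f' - f := abs_of_pos (by linarith)
  rw [hd] at hl hvar
  have hbound : ∀ c y : ℝ, |c| ≤ 4 * (f' - f) → |y| ≤ 1 / 8 → |c * y| ≤ (f' - f) / 2 := by
    intro c y hc hy
    rw [abs_mul]
    have := mul_le_mul hc hy (abs_nonneg _) (by linarith)
    linarith
  have h0' := cutoff_nonneg (f := f')
  have h1' := cutoff_le_one (f := f')
  rcases le_or_gt |f| (1 / 2) with hf | hf
  · rcases le_or_gt |f'| (1 / 2) with hf' | hf'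
    · have hv := hvar hf hf'
      have h1 := (abs_le.1 (hbound _ _ hl h)).1
      have h2 : |cutoff f' * ((F' - F) - (f' - f))| ≤ 1 / 8 * (f' - f) := by
        rw [abs_mul, abs_of_nonneg h0']
        exact (mul_le_of_le_one_left (abs_nonneg _) h1').trans hv
      have h3 := (abs_le.1 h2).1
      unfold blend
      linarith
    · rw [blend_of_ge hf'.le]
      rw [cutoff_eq_zero hf'.le, zero_sub, abs_neg] at hl
      have h1 := (abs_le.1 (hbound _ _ hl h)).2
      unfold blend
      linarith
  · rw [blend_of_ge hf.le]
    rw [cutoff_eq_zero hf.le, sub_zero] at hl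
    have h1 := (abs_le.1 (hbound _ _ hl h')).1
    unfold blend
    linarith

end Blend

lemma continuous_cutoff : Continuous cutoff := by unfold cutoff; fun_prop

lemma continuous_blendFactor : Continuous fun p : ℝ × ℝ => blendFactor p.1 p.2 := by
  unfold blendFactor
  refine continuous_const.add (Continuous.div ?_ ?_ fun p => ?_)
  · exact (continuous_cutoff.comp continuous_fst).mul (by fun_prop)
  · fun_prop
  · exact ne_of_gt (lt_of_lt_of_le (by norm_num) (le_max_right _ _))

lemma continuous_blend : Continuous fun p : ℝ × ℝ => blend p.1 p.2 := by
  unfold blend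
  exact continuous_fst.add ((continuous_cutoff.comp continuous_fst).mul (by fun_prop))

section Rescale

variable {ι : Type*} [Fintype ι] {σ : ι → ℝ}

lemma rescale_rescale (r q r' q' : ℝ) (w : ι → ℝ) :
    rescale σ r' q' (rescale σ r q w) = rescale σ (r' * r) (q' * q) w := by
  funext e
  simp only [rescale]
  split_ifs <;> ring

lemma rescale_one_one (w : ι → ℝ) : rescale σ 1 1 w = w := by
  funext e; simp [rescale]

lemma rescale_mem {w : ι → ℝ} (hw : w ∈ stdSimplex ℝ ι) {r q : ℝ} (hr : 0 ≤ r) (hq : 0 ≤ q)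
    (h : r * posPart σ w + q * (1 - posPart σ w) = 1) : rescale σ r q w ∈ stdSimplex ℝ ι := by
  refine ⟨fun e => mul_nonneg (hw.1 e) ?_, by rw [sum_rescale hw.2, h]⟩
  split_ifs <;> assumption

end Rescale

namespace ConvexTriangulation

open MonomialFamily

variable {ι : Type*} [Fintype ι] {M : MonomialFamily ι} (K : ConvexTriangulation M)

lemma isCompact_body : IsCompact K.body := by
  have h : K.body = ⋃ T ∈ K.tri, (stdSimplex ℝ ι ∩ {w | ∀ e ∉ T, w e = 0}) := by
    ext w; simp [body]
  rw [h]
  refine Set.Finite.isCompact_biUnion (Set.toFinite _) fun T _ => ?_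
  refine (isCompact_stdSimplex ℝ ι).inter_right ?_
  simp only [Set.ofPred_forall]
  exact isClosed_iInter fun e => isClosed_iInter fun _ =>
    isClosed_eq (continuous_apply e) continuous_const

/-- The geometric realization is homeomorphic to the triangle. -/
noncomputable def baryHomeo : K.body ≃ₜ stdSimplex ℝ (Fin 3) :=
  haveI : CompactSpace K.body := isCompact_iff_compactSpace.1 K.isCompact_body
  Continuous.homeoOfEquivCompactToT2
    (f := Equiv.ofBijective
      (fun w : K.body => (⟨M.bary w, bary_mem w.2.1⟩ : stdSimplex ℝ (Fin 3)))
      ⟨fun w w' h => by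
          obtain ⟨hw, T, hT, hwT⟩ := w.2
          obtain ⟨hw', T', hT', hwT'⟩ := w'.2
          exact Subtype.ext (K.unique T hT T' hT' _ hw _ hw' hwT hwT' (congrArg Subtype.val h)),
        fun p => by
          obtain ⟨T, hT, w, hw, hwT, h⟩ := K.cover p p.2
          exact ⟨⟨w, hw, T, hT, hwT⟩, Subtype.ext h⟩⟩)
    (Continuous.subtype_mk (continuous_bary.comp continuous_subtype_val) _)

variable {K}

lemma coe_baryHomeo (w : K.body) : (K.baryHomeo w).1 = M.bary w.1 := rfl

lemma rescale_mem_body {σ : ι → ℝ} {w : ι → ℝ} (hw : w ∈ K.body) {r q : ℝ} (hr : 0 ≤ r)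
    (hq : 0 ≤ q) (h : r * posPart σ w + q * (1 - posPart σ w) = 1) :
    rescale σ r q w ∈ K.body := by
  obtain ⟨hw, T, hT, hwT⟩ := hw
  exact ⟨rescale_mem hw hr hq h, T, hT, fun e he => by simp [rescale, hwT e he]⟩

/-- A function on the geometric realization is close to the sign function, also as regards its
variation along the segments of the join structure. -/
structure IsClose (σ : ι → ℝ) (F : K.body → ℝ) : Prop where
  continuous : Continuous F
  abs_sub_le : ∀ w : K.body, |F w - ∑ e, σ e * (w : ι → ℝ) e| ≤ 1 / 8
  abs_variation_le : ∀ (w w' : K.body) (r q : ℝ), (w' : ι → ℝ) = rescale σ r q w →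
    |∑ e, σ e * (w : ι → ℝ) e| ≤ 1 / 2 → |∑ e, σ e * (w' : ι → ℝ) e| ≤ 1 / 2 →
    |(F w' - F w) - (∑ e, σ e * (w' : ι → ℝ) e - ∑ e, σ e * (w : ι → ℝ) e)| ≤
      1 / 8 * |∑ e, σ e * (w' : ι → ℝ) e - ∑ e, σ e * (w : ι → ℝ) e|

/-- The map of the geometric realization which moves each point along the segment of the join
structure through it, so that the sign function of the image is the given function. -/
noncomputable def correct (σ : ι → ℝ) (F : K.body → ℝ) (w : K.body) : ι → ℝ :=
  rescale σ (blendFactor (∑ e, σ e * (w : ι → ℝ) e) (F w))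
    (blendFactor (-∑ e, σ e * (w : ι → ℝ) e) (-F w)) w

variable {σ : ι → ℝ} {F : K.body → ℝ}

lemma correct_mem (hσ : ∀ e, σ e = 1 ∨ σ e = -1) (hF : IsClose σ F) (w : K.body) :
    correct σ F w ∈ K.body := by
  have h := hF.abs_sub_le w
  have h1 := blendFactor_mul (∑ e, σ e * (w : ι → ℝ) e) (F w)
  have h2 := blendFactor_neg_mul (∑ e, σ e * (w : ι → ℝ) e) (F w)
  have h' : |-F w - -∑ e, σ e * (w : ι → ℝ) e| ≤ 1 / 8 := by
    rwa [neg_sub_neg, abs_sub_comm]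
  refine rescale_mem_body w.2 (blendFactor_pos h).le (blendFactor_pos h').le ?_
  have h3 := sum_sign_mul hσ w.2.1.2
  have e1 : posPart σ w = (1 + ∑ e, σ e * (w : ι → ℝ) e) / 2 := by linarith
  have e2 : 1 - posPart σ w = (1 - ∑ e, σ e * (w : ι → ℝ) e) / 2 := by linarith
  rw [e2, e1]
  linarith

lemma sum_sign_correct (hσ : ∀ e, σ e = 1 ∨ σ e = -1) (hF : IsClose σ F) (w : K.body) :
    ∑ e, σ e * correct σ F w e = blend (∑ e, σ e * (w : ι → ℝ) e) (F w) := by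
  have h1 := blendFactor_mul (∑ e, σ e * (w : ι → ℝ) e) (F w)
  have h3 := sum_sign_mul hσ w.2.1.2
  rw [sum_sign_mul hσ (correct_mem hσ hF w).1.2]
  have := posPart_rescale (σ := σ) (w := (w : ι → ℝ))
    (blendFactor (∑ e, σ e * (w : ι → ℝ) e) (F w))
    (blendFactor (-∑ e, σ e * (w : ι → ℝ) e) (-F w))
  rw [correct, this]
  have e1 : posPart σ w = (1 + ∑ e, σ e * (w : ι → ℝ) e) / 2 := by linarith
  rw [e1]
  linarith

lemma correct_eq_zero_iff (hF : IsClose σ F) (w : K.body) (e : ι) :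
    correct σ F w e = 0 ↔ (w : ι → ℝ) e = 0 := by
  have h := hF.abs_sub_le w
  have h' : |-F w - -∑ e, σ e * (w : ι → ℝ) e| ≤ 1 / 8 := by
    rwa [neg_sub_neg, abs_sub_comm]
  have h1 := blendFactor_pos h
  have h2 := blendFactor_pos h'
  rw [correct, rescale, mul_eq_zero, or_iff_left]
  split_ifs
  · exact h1.ne'
  · exact h2.ne'

lemma continuous_correct (hF : IsClose σ F) : Continuous (correct σ F) := by
  have hs : Continuous fun w : K.body => ∑ e, σ e * (w : ι → ℝ) e := by
    refine continuous_finsetSum _ fun e _ => continuous_const.mul ?_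
    exact (continuous_apply e).comp continuous_subtype_val
  refine continuous_pi fun e => ?_
  refine ((continuous_apply e).comp continuous_subtype_val).mul ?_
  split_ifs
  · exact continuous_blendFactor.comp (hs.prodMk hF.continuous)
  · exact continuous_blendFactor.comp (hs.neg.prodMk hF.continuous.neg)

lemma blend_lt_of_rescale (hF : IsClose σ F) {w w' : K.body} {r q : ℝ}
    (h : (w' : ι → ℝ) = rescale σ r q w)
    (hlt : ∑ e, σ e * (w : ι → ℝ) e < ∑ e, σ e * (w' : ι → ℝ) e) :
    blend (∑ e, σ e * (w : ι → ℝ) e) (F w) < blend (∑ e, σ e * (w' : ι → ℝ) e) (F w') :=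
  blend_lt_blend (hF.abs_sub_le w) (hF.abs_sub_le w') hlt (hF.abs_variation_le w w' r q h)

/-- Points with the same image lie on one join segment, on which the blend is strictly monotone in
f; so they have the same f, the same factors, and coincide. -/
lemma correct_injective (hσ : ∀ e, σ e = 1 ∨ σ e = -1) (hF : IsClose σ F) {w w' : K.body}
    (h : correct σ F w = correct σ F w') : w = w' := by
  have hpos : ∀ w : K.body, 0 < blendFactor (∑ e, σ e * (w : ι → ℝ) e) (F w) ∧
      0 < blendFactor (-∑ e, σ e * (w : ι → ℝ) e) (-F w) := fun w =>
    ⟨blendFactor_pos (hF.abs_sub_le w), blendFactor_pos (by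
      rw [neg_sub_neg, abs_sub_comm]; exact hF.abs_sub_le w)⟩
  have hseg : ∀ w w' : K.body, correct σ F w = correct σ F w' →
      ∃ r q, (w' : ι → ℝ) = rescale σ r q w := by
    intro w w' h
    obtain ⟨h1, h2⟩ := hpos w'
    refine ⟨(blendFactor (∑ e, σ e * (w' : ι → ℝ) e) (F w'))⁻¹ *
        blendFactor (∑ e, σ e * (w : ι → ℝ) e) (F w),
      (blendFactor (-∑ e, σ e * (w' : ι → ℝ) e) (-F w'))⁻¹ *
        blendFactor (-∑ e, σ e * (w : ι → ℝ) e) (-F w), ?_⟩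
    rw [← rescale_rescale]
    change _ = rescale σ _ _ (correct σ F w)
    rw [h, correct, rescale_rescale, inv_mul_cancel₀ h1.ne', inv_mul_cancel₀ h2.ne',
      rescale_one_one]
  have hG : blend (∑ e, σ e * (w : ι → ℝ) e) (F w) =
      blend (∑ e, σ e * (w' : ι → ℝ) e) (F w') := by
    rw [← sum_sign_correct hσ hF, ← sum_sign_correct hσ hF, h]
  have hf : ∑ e, σ e * (w : ι → ℝ) e = ∑ e, σ e * (w' : ι → ℝ) e := by
    rcases lt_trichotomy (∑ e, σ e * (w : ι → ℝ) e) (∑ e, σ e * (w' : ι → ℝ) e) with h1 | h1 | h1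
    · obtain ⟨r, q, hrq⟩ := hseg w w' h
      exact absurd hG (blend_lt_of_rescale hF hrq h1).ne
    · exact h1
    · obtain ⟨r, q, hrq⟩ := hseg w' w h.symm
      exact absurd hG (blend_lt_of_rescale hF hrq h1).ne'
  have hr := blendFactor_mul (∑ e, σ e * (w : ι → ℝ) e) (F w)
  have hr' := blendFactor_mul (∑ e, σ e * (w' : ι → ℝ) e) (F w')
  have hq := blendFactor_neg_mul (∑ e, σ e * (w : ι → ℝ) e) (F w)
  have hq' := blendFactor_neg_mul (∑ e, σ e * (w' : ι → ℝ) e) (F w')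
  -- For |f| ≥ 1/2 all factors are 1. Otherwise 1 ± f are nonzero and the factors are determined by
  -- f and the blended value.
  have heq : blendFactor (∑ e, σ e * (w : ι → ℝ) e) (F w) =
        blendFactor (∑ e, σ e * (w' : ι → ℝ) e) (F w') ∧
      blendFactor (-∑ e, σ e * (w : ι → ℝ) e) (-F w) =
        blendFactor (-∑ e, σ e * (w' : ι → ℝ) e) (-F w') := by
    rcases le_or_gt (1 / 2) |∑ e, σ e * (w : ι → ℝ) e| with h1 | h1
    · have h2 := h1
      rw [← abs_neg] at h2
      rw [← hf, blendFactor_of_ge h1, blendFactor_of_ge h1, blendFactor_of_ge h2,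
        blendFactor_of_ge h2]
      exact ⟨rfl, rfl⟩
    · have h2 := abs_lt.1 h1
      rw [hG, ← hr'] at hr
      rw [hG, ← hq'] at hq
      rw [hf] at h2
      nth_rewrite 2 [hf] at hr
      nth_rewrite 2 [hf] at hq
      exact ⟨mul_right_cancel₀ (by linarith) hr, mul_right_cancel₀ (by linarith) hq⟩
  refine Subtype.ext ?_
  obtain ⟨h1, h2⟩ := hpos w
  have := congrArg (rescale σ (blendFactor (∑ e, σ e * (w : ι → ℝ) e) (F w))⁻¹
    (blendFactor (-∑ e, σ e * (w : ι → ℝ) e) (-F w))⁻¹) h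
  rw [correct, correct, ← heq.1, ← heq.2, rescale_rescale, rescale_rescale,
    inv_mul_cancel₀ h1.ne', inv_mul_cancel₀ h2.ne', rescale_one_one, rescale_one_one] at this
  exact this

lemma correct_surjective (hσ : ∀ e, σ e = 1 ∨ σ e = -1) (hF : IsClose σ F) (u : K.body) :
    ∃ w : K.body, correct σ F w = u := by
  set g := ∑ e, σ e * (u : ι → ℝ) e with hg
  rcases le_or_gt (1 / 2) |g| with h | h
  · refine ⟨u, ?_⟩
    have h2 := h
    rw [← abs_neg] at h2
    rw [correct, ← hg, blendFactor_of_ge h, blendFactor_of_ge h2, rescale_one_one]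
  set α := posPart σ (u : ι → ℝ) with hα
  have hgα : g = 2 * α - 1 := sum_sign_mul hσ u.2.1.2
  have hlt := abs_lt.1 h
  have hα0 : 0 < α := by linarith
  have hα1 : 0 < 1 - α := by linarith
  -- The middle part of the join segment through u, with the positive mass β as parameter. At its
  -- ends |f| = 1/2, so the blend equals f there and the intermediate value theorem applies.
  let p : Set.Icc (1 / 4 : ℝ) (3 / 4) → K.body := fun β =>
    ⟨rescale σ (β / α) ((1 - β) / (1 - α)) u, rescale_mem_body u.2
      (div_nonneg (by linarith [β.2.1]) hα0.le) (div_nonneg (by linarith [β.2.2]) hα1.le) (by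
        rw [← hα, div_mul_cancel₀ _ hα0.ne', div_mul_cancel₀ _ hα1.ne']; ring)⟩
  have hp : Continuous p := by
    refine Continuous.subtype_mk (continuous_pi fun e => ?_) _
    refine continuous_const.mul ?_
    split_ifs <;> fun_prop
  have hfp : ∀ β, ∑ e, σ e * (p β : ι → ℝ) e = 2 * β - 1 := by
    intro β
    rw [sum_sign_mul hσ (p β).2.1.2]
    have := posPart_rescale (σ := σ) (w := (u : ι → ℝ)) (β / α) ((1 - β) / (1 - α))
    change 2 * posPart σ (rescale σ (β / α) ((1 - β) / (1 - α)) u) - 1 = _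
    rw [this, ← hα, div_mul_cancel₀ _ hα0.ne']
  have hcont : Continuous fun β : Set.Icc (1 / 4 : ℝ) (3 / 4) => blend (2 * (β : ℝ) - 1) (F (p β)) :=
    continuous_blend.comp (Continuous.prodMk (by fun_prop) (hF.continuous.comp hp))
  have h14 : (1 / 4 : ℝ) ∈ Set.Icc (1 / 4 : ℝ) (3 / 4) := by norm_num
  have h34 : (3 / 4 : ℝ) ∈ Set.Icc (1 / 4 : ℝ) (3 / 4) := by norm_num
  have hconn : IsPreconnected (Set.univ : Set (Set.Icc (1 / 4 : ℝ) (3 / 4))) :=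
    (isPreconnected_iff_preconnectedSpace.1 isPreconnected_Icc).isPreconnected_univ
  have hg1 : blend (2 * (1 / 4) - 1) (F (p ⟨1 / 4, h14⟩)) ≤ g := by
    rw [blend_of_ge (by rw [abs_of_nonpos] <;> norm_num)]; linarith
  have hg2 : g ≤ blend (2 * (3 / 4) - 1) (F (p ⟨3 / 4, h34⟩)) := by
    rw [blend_of_ge (by rw [abs_of_nonneg] <;> norm_num)]; linarith
  obtain ⟨β, -, hβ⟩ := hconn.intermediate_value (Set.mem_univ ⟨1 / 4, h14⟩)
    (Set.mem_univ ⟨3 / 4, h34⟩) hcont.continuousOn ⟨hg1, hg2⟩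
  refine ⟨p β, ?_⟩
  have hβ' : blend (2 * (β : ℝ) - 1) (F (p β)) = g := hβ
  have h1 := blendFactor_mul (∑ e, σ e * (p β : ι → ℝ) e) (F (p β))
  have h2 := blendFactor_neg_mul (∑ e, σ e * (p β : ι → ℝ) e) (F (p β))
  rw [correct]
  rw [hfp] at h1 h2 ⊢
  rw [hβ'] at h1 h2
  have h3 : blendFactor (2 * (β : ℝ) - 1) (F (p β)) * (β / α) = 1 := by
    rw [mul_div_assoc', div_eq_one_iff_eq hα0.ne']
    linarith
  have h4 : blendFactor (-(2 * (β : ℝ) - 1)) (-F (p β)) * ((1 - β) / (1 - α)) = 1 := by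
    rw [mul_div_assoc', div_eq_one_iff_eq hα1.ne']
    linarith
  change rescale σ _ _ (rescale σ (β / α) ((1 - β) / (1 - α)) u) = u
  rw [rescale_rescale, h3, h4, rescale_one_one]

/-- The correction as a homeomorphism. -/
noncomputable def correctHomeo (hσ : ∀ e, σ e = 1 ∨ σ e = -1) (hF : IsClose σ F) :
    K.body ≃ₜ K.body :=
  haveI : CompactSpace K.body := isCompact_iff_compactSpace.1 K.isCompact_body
  Continuous.homeoOfEquivCompactToT2
    (f := Equiv.ofBijective (fun w : K.body => (⟨correct σ F w, correct_mem hσ hF w⟩ : K.body))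
      ⟨fun w w' h => correct_injective hσ hF (congrArg Subtype.val h),
        fun u => by
          obtain ⟨w, hw⟩ := correct_surjective hσ hF u
          exact ⟨w, Subtype.ext hw⟩⟩)
    (Continuous.subtype_mk (continuous_correct hF) _)

lemma correct_congr {σ σ' : ι → ℝ} {F F' : K.body → ℝ} {w : K.body}
    (h : ∀ e, (w : ι → ℝ) e ≠ 0 → σ e = σ' e) (hF : F w = F' w) :
    correct σ F w = correct σ' F' w := by
  have h1 : ∀ e, σ e * (w : ι → ℝ) e = σ' e * (w : ι → ℝ) e := fun e => by
    by_cases he : (w : ι → ℝ) e = 0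
    · simp [he]
    · rw [h e he]
  funext e
  simp only [correct, rescale, h1, hF]
  by_cases he : (w : ι → ℝ) e = 0
  · simp [he]
  · rw [h e he]

/-- Reversal of all signs on the support exchanges the two parts of the join together with their
factors. This gives compatibility with the antipodal gluing for odd degree. -/
lemma correct_congr_neg {σ σ' : ι → ℝ} {F F' : K.body → ℝ} {w : K.body}
    (hσ' : ∀ e, σ' e = 1 ∨ σ' e = -1)
    (h : ∀ e, (w : ι → ℝ) e ≠ 0 → σ e = -σ' e) (hF : F w = -F' w) :
    correct σ F w = correct σ' F' w := by
  have h1 : ∀ e, σ e * (w : ι → ℝ) e = -(σ' e * (w : ι → ℝ) e) := fun e => by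
    by_cases he : (w : ι → ℝ) e = 0
    · simp [he]
    · rw [h e he]; ring
  funext e
  simp only [correct, rescale, h1, hF, Finset.sum_neg_distrib, neg_neg]
  by_cases he : (w : ι → ℝ) e = 0
  · simp [he]
  · have : (-1 : ℝ) ≠ 1 := by norm_num
    rw [h e he]
    rcases hσ' e with h2 | h2 <;> simp [h2, this]

end ConvexTriangulation

/-! ### From the toric zero set to the piecewise linear one -/

namespace ConvexTriangulation

open MonomialFamily

variable {ι : Type*} [Fintype ι] {M : MonomialFamily ι} (K : ConvexTriangulation M)

/-- The point of the coordinate triangle which the moment map sends to a given point of the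
triangulation. -/
noncomputable def toricPoint (L : ℝ) (w : K.body) : stdSimplex ℝ (Fin 3) :=
  (M.momentHomeo (c := K.coeff L) (coeff_pos L)).symm (K.baryHomeo w)

/-- The sign function on the toric side. -/
noncomputable def toricSign (L : ℝ) (σ : ι → ℝ) (w : K.body) : ℝ :=
  ∑ e, σ e * M.weight (K.coeff L) (K.toricPoint L w).1 e

variable {K}

lemma moment_toricPoint (L : ℝ) (w : K.body) :
    M.moment (K.coeff L) (K.toricPoint L w).1 = M.bary w := by
  rw [← coe_momentHomeo (coeff_pos L), toricPoint, Homeomorph.apply_symm_apply, coe_baryHomeo]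

lemma continuous_toricSign (L : ℝ) (σ : ι → ℝ) : Continuous (K.toricSign L σ) := by
  unfold toricSign
  refine continuous_finsetSum _ fun e _ => continuous_const.mul ?_
  have h1 : Continuous (K.toricPoint L) :=
    (Homeomorph.continuous _).comp (Homeomorph.continuous _)
  exact (continuousOn_iff_continuous_domRestrict.1
    (continuousOn_weight (M := M) (coeff_pos L) e)).comp h1

lemma exists_parameter_forall_isClose (K : ConvexTriangulation M) :
    ∃ L₀ : ℝ, ∀ L > L₀, ∀ σ : ι → ℝ, (∀ e, σ e = 1 ∨ σ e = -1) →
      IsClose σ (K.toricSign L σ) := by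
  obtain ⟨L₀, h⟩ := K.exists_parameter_forall_close (ε := 1 / 8) (by norm_num)
  refine ⟨L₀, fun L hL σ hσ => ⟨continuous_toricSign L σ, fun w => ?_, fun w w' r q hw' hf hf' => ?_⟩⟩
  · exact (h L hL σ hσ w w.2 _ (K.toricPoint L w).2 (moment_toricPoint L w)).1
  · have := (h L hL σ hσ w w.2 _ (K.toricPoint L w).2 (moment_toricPoint L w)).2 r q
      (hw' ▸ w'.2.1) _ (K.toricPoint L w').2 (hw' ▸ moment_toricPoint L w') hf (hw' ▸ hf')
    rw [← hw'] at this
    exact this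

lemma weight_ne_zero_imp {w : K.body} {i : Fin 3} (hi : M.bary w i = 0) {e : ι}
    (he : (w : ι → ℝ) e ≠ 0) : M.exps e i = 0 := (bary_eq_zero_iff w.2.1.1 i).1 hi e he

/-- For a large parameter there are homeomorphisms of the triangle which map the zero set of the
polynomial with given signs to the zero set of the piecewise linear sign function. They preserve
the faces, and on a face they depend only on the signs on that face, up to a common factor. -/
theorem exists_homeomorph (K : ConvexTriangulation M) :
    ∃ L₀ : ℝ, ∀ L > L₀, ∃ J : (ι → ℤˣ) → (stdSimplex ℝ (Fin 3) ≃ₜ stdSimplex ℝ (Fin 3)),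
      (∀ σ (x : stdSimplex ℝ (Fin 3)) i, (J σ x).1 i = 0 ↔ x.1 i = 0) ∧
      (∀ σ (x : stdSimplex ℝ (Fin 3)), ∀ w ∈ K.body, M.bary w = (J σ x).1 →
        (∑ e, ((σ e : ℤ) : ℝ) * w e = 0 ↔
          M.poly (fun e => ((σ e : ℤ) : ℝ) * K.coeff L e) x.1 = 0)) ∧
      (∀ σ σ' (x : stdSimplex ℝ (Fin 3)) i, x.1 i = 0 → (∀ e, M.exps e i = 0 → σ e = σ' e) →
        J σ x = J σ' x) ∧
      (∀ σ σ' (x : stdSimplex ℝ (Fin 3)) i, x.1 i = 0 → (∀ e, M.exps e i = 0 → σ e = -σ' e) →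
        J σ x = J σ' x) := by
  obtain ⟨L₀, h⟩ := K.exists_parameter_forall_isClose
  refine ⟨L₀, fun L hL => ?_⟩
  have hc : ∀ e, 0 < K.coeff L e := coeff_pos L
  let s : (ι → ℤˣ) → ι → ℝ := fun σ e => ((σ e : ℤ) : ℝ)
  have hs : ∀ σ e, s σ e = 1 ∨ s σ e = -1 := fun σ e => by
    rcases Int.units_eq_one_or (σ e) with h | h <;> simp [s, h]
  have hcl : ∀ σ, IsClose (s σ) (K.toricSign L (s σ)) := fun σ => h L hL _ (hs σ)
  let Q : stdSimplex ℝ (Fin 3) ≃ₜ K.body :=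
    (M.momentHomeo (c := K.coeff L) (coeff_pos L)).trans K.baryHomeo.symm
  have hQ : ∀ x, K.toricPoint L (Q x) = x := fun x => by simp [Q, toricPoint]
  have hQb : ∀ x, M.bary (Q x) = M.moment (K.coeff L) x.1 := fun x => by
    have := moment_toricPoint L (Q x)
    rwa [hQ, eq_comm] at this
  -- The moment map, lifted to the weights on the triangulation, followed by the correction. Only
  -- the correction depends on σ.
  let J : (ι → ℤˣ) → (stdSimplex ℝ (Fin 3) ≃ₜ stdSimplex ℝ (Fin 3)) := fun σ =>
    Q.trans ((correctHomeo (hs σ) (hcl σ)).trans K.baryHomeo)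
  have hJ : ∀ σ x, (J σ x).1 = M.bary (correct (s σ) (K.toricSign L (s σ)) (Q x)) :=
    fun σ x => rfl
  have hsup : ∀ {x : stdSimplex ℝ (Fin 3)} {i}, x.1 i = 0 → ∀ e,
      (Q x : ι → ℝ) e ≠ 0 → M.exps e i = 0 := fun {x i} hi e he =>
    weight_ne_zero_imp (by rw [hQb, moment_eq_zero_iff hc x.2, hi]) he
  have hωsup : ∀ {x : stdSimplex ℝ (Fin 3)} {i}, x.1 i = 0 → ∀ e,
      M.weight (K.coeff L) x.1 e ≠ 0 → M.exps e i = 0 := fun {x i} hi e he => by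
    by_contra hne
    exact he ((weight_eq_zero_iff hc x.2 e).2 ⟨i, hi, hne⟩)
  have hF : ∀ σ x, K.toricSign L (s σ) (Q x) = ∑ e, s σ e * M.weight (K.coeff L) x.1 e :=
    fun σ x => by rw [toricSign, hQ]
  refine ⟨J, fun σ x i => ?_, fun σ x w hw hwx => ?_, fun σ σ' x i hi hσ => ?_,
    fun σ σ' x i hi hσ => ?_⟩
  · rw [hJ, bary_eq_zero_iff (correct_mem (hs σ) (hcl σ) (Q x)).1.1,
      ← moment_eq_zero_iff (M := M) hc x.2, ← hQb, bary_eq_zero_iff (Q x).2.1.1]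
    exact forall_congr' fun e => by rw [Ne, Ne, correct_eq_zero_iff (hcl σ)]
  · have h1 : (⟨w, hw⟩ : K.body) = correctHomeo (hs σ) (hcl σ) (Q x) :=
      K.baryHomeo.injective (Subtype.ext (hwx.trans (hJ σ x)))
    have h2 : w = correct (s σ) (K.toricSign L (s σ)) (Q x) := congrArg Subtype.val h1
    change ∑ e, s σ e * w e = 0 ↔ _
    rw [h2, sum_sign_correct (hs σ) (hcl σ), blend_eq_zero_iff ((hcl σ).abs_sub_le _), hF]
    -- The toric sign function is the signed polynomial divided by the positive one, so both have
    -- the same zeros.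
    have h3 : ∑ e, s σ e * M.weight (K.coeff L) x.1 e =
        M.poly (fun e => ((σ e : ℤ) : ℝ) * K.coeff L e) x.1 / M.poly (K.coeff L) x.1 := by
      rw [poly, Finset.sum_div]
      exact Finset.sum_congr rfl fun e _ => by simp only [weight, s]; ring
    rw [h3, div_eq_zero_iff, or_iff_left (poly_pos hc x.2).ne']
  · refine Subtype.ext ?_
    rw [hJ, hJ, correct_congr (fun e he => ?_)]
    · rw [hF, hF]
      refine Finset.sum_congr rfl fun e _ => ?_
      by_cases he : M.weight (K.coeff L) x.1 e = 0
      · simp [he]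
      · simp only [s, hσ e (hωsup hi e he)]
    · simp only [s, hσ e (hsup hi e he)]
  · refine Subtype.ext ?_
    rw [hJ, hJ, correct_congr_neg (hs σ') (fun e he => ?_)]
    · rw [hF, hF, ← Finset.sum_neg_distrib]
      refine Finset.sum_congr rfl fun e _ => ?_
      by_cases he : M.weight (K.coeff L) x.1 e = 0
      · simp [he]
      · simp [s, hσ e (hωsup hi e he)]
    · simp [s, hσ e (hsup hi e he)]

end ConvexTriangulation

/-! ### Geometry of lattice triangulations of the triangle -/

lemma triangle_eq {m : ℕ} (hm : 0 < m) :
    triangle m = {p : ℝ × ℝ | 0 ≤ p.1 ∧ 0 ≤ p.2 ∧ p.1 + p.2 ≤ m} := by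
  have hm' : (0 : ℝ) < m := by exact_mod_cast hm
  apply Set.Subset.antisymm
  · refine convexHull_min ?_ ?_
    · rintro p (rfl | rfl | rfl) <;> simp
    · rintro p ⟨h1, h2, h3⟩ q ⟨h4, h5, h6⟩ a b ha hb hab
      simp only [Set.mem_ofPred_eq, Prod.fst_add, Prod.snd_add, Prod.smul_fst, Prod.smul_snd,
        smul_eq_mul]
      refine ⟨by positivity, by positivity, ?_⟩
      have e1 := mul_le_mul_of_nonneg_left h3 ha
      have e2 := mul_le_mul_of_nonneg_left h6 hb
      have e3 : a * m + b * m = m := by rw [← add_mul, hab, one_mul]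
      linarith
  · rintro p ⟨h1, h2, h3⟩
    have hconv := convex_convexHull ℝ
      {((0 : ℝ), (0 : ℝ)), ((m : ℝ), (0 : ℝ)), ((0 : ℝ), (m : ℝ))}
    have := hconv.sum_mem (t := Finset.univ) (w := ![1 - (p.1 + p.2) / m, p.1 / m, p.2 / m])
      (z := ![((0 : ℝ), (0 : ℝ)), ((m : ℝ), (0 : ℝ)), ((0 : ℝ), (m : ℝ))]) (by
        intro i _
        fin_cases i
        · simp only [Fin.zero_eta, Matrix.cons_val_zero, sub_nonneg]
          rwa [div_le_one hm']
        · simpa using div_nonneg h1 hm'.le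
        · simpa using div_nonneg h2 hm'.le) (by
        rw [Fin.sum_univ_three]
        change 1 - (p.1 + p.2) / m + p.1 / m + p.2 / m = 1
        ring) (by
        intro i _
        apply subset_convexHull
        fin_cases i <;> simp)
    change p ∈ convexHull ℝ _
    convert this using 1
    rw [Fin.sum_univ_three]
    ext
    · simp [div_mul_cancel₀ _ hm'.ne']
    · simp [div_mul_cancel₀ _ hm'.ne']

lemma convex_triangle (m : ℕ) : Convex ℝ (triangle m) := convex_convexHull _ _

lemma nonempty_interior_triangle {m : ℕ} (hm : 0 < m) : (interior (triangle m)).Nonempty := by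
  have hm' : (0 : ℝ) < m := by exact_mod_cast hm
  refine ⟨(m / 3, m / 3), ?_⟩
  have ho : IsOpen {p : ℝ × ℝ | 0 < p.1 ∧ 0 < p.2 ∧ p.1 + p.2 < m} :=
    (isOpen_lt continuous_const continuous_fst).inter
      ((isOpen_lt continuous_const continuous_snd).inter
        (isOpen_lt (continuous_fst.add continuous_snd) continuous_const))
  refine interior_maximal ?_ ho ?_
  · rw [triangle_eq hm]
    exact fun p hp => ⟨hp.1.le, hp.2.1.le, hp.2.2.le⟩
  · exact ⟨by positivity, by positivity, by
      change (m : ℝ) / 3 + m / 3 < m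
      linarith⟩

/-- The point of the plane with given natural coordinates. -/
def natPoint (a : ℕ × ℕ) : ℝ × ℝ := ((a.1 : ℝ), (a.2 : ℝ))

lemma natPoint_injective : Function.Injective natPoint := by
  rintro ⟨a, b⟩ ⟨c, d⟩ h
  simpa [natPoint] using h

section Complex

variable {m : ℕ} {τ : Geometry.SimplicialComplex ℝ (ℝ × ℝ)} {ν : ℝ × ℝ → ℝ}

open Classical in
/-- The vertices of a lattice triangulation, as pairs of natural numbers. -/
noncomputable def vertexSet (m : ℕ) (τ : Geometry.SimplicialComplex ℝ (ℝ × ℝ)) :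
    Finset (ℕ × ℕ) :=
  (Finset.range (m + 1) ×ˢ Finset.range (m + 1)).filter
    (fun a : ℕ × ℕ => ((a.1 : ℝ), (a.2 : ℝ)) ∈ τ.vertices)

lemma vertices_subset_triangle (hτ : IsLatticeTriangulation m τ) : τ.vertices ⊆ triangle m := by
  rw [← hτ.space_eq]
  exact Geometry.SimplicialComplex.vertices_subset_space

lemma mem_vertices_iff (hm : 0 < m) (hτ : IsLatticeTriangulation m τ) {v : ℝ × ℝ} :
    v ∈ τ.vertices ↔ ∃ a ∈ vertexSet m τ, natPoint a = v := by
  constructor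
  · intro hv
    have h := vertices_subset_triangle hτ hv
    rw [triangle_eq hm] at h
    obtain ⟨⟨i, j⟩, rfl⟩ := hτ.vertices_subset hv
    obtain ⟨h1, h2, h3⟩ := h
    simp only [latticePoint] at h1 h2 h3 hv ⊢
    lift i to ℕ using by exact_mod_cast h1
    lift j to ℕ using by exact_mod_cast h2
    have h3 : i + j ≤ m := by exact_mod_cast h3
    refine ⟨(i, j), ?_, by simp [natPoint]⟩
    simp only [vertexSet, Finset.mem_filter, Finset.mem_product, Finset.mem_range]
    exact ⟨⟨by omega, by omega⟩, by simpa using hv⟩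
  · rintro ⟨a, ha, rfl⟩
    classical
    exact (Finset.mem_filter.1 ha).2

lemma add_le_of_mem_vertexSet (hm : 0 < m) (hτ : IsLatticeTriangulation m τ) {a : ℕ × ℕ}
    (ha : a ∈ vertexSet m τ) : a.1 + a.2 ≤ m := by
  have h := vertices_subset_triangle hτ ((mem_vertices_iff hm hτ).2 ⟨a, ha, rfl⟩)
  rw [triangle_eq hm] at h
  have h2 : (a.1 : ℝ) + a.2 ≤ m := h.2.2
  exact_mod_cast h2

lemma mem_vertices_of_mem_face {T : Finset (ℝ × ℝ)} (hT : T ∈ τ.faces) {v : ℝ × ℝ} (hv : v ∈ T) :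
    v ∈ τ.vertices := by
  rw [Geometry.SimplicialComplex.vertices_eq]
  exact Set.mem_biUnion hT hv

lemma finite_faces (hm : 0 < m) (hτ : IsLatticeTriangulation m τ) : τ.faces.Finite := by
  classical
  refine ((vertexSet m τ).image natPoint).powerset.finite_toSet.subset fun T hT => ?_
  simp only [Finset.coe_powerset, Set.mem_preimage, Set.mem_powerset_iff, Finset.coe_subset]
  intro v hv
  obtain ⟨a, ha, rfl⟩ := (mem_vertices_iff hm hτ).1 (mem_vertices_of_mem_face hT hv)
  exact Finset.mem_image_of_mem _ ha

lemma finrank_plane : Module.finrank ℝ (ℝ × ℝ) = 2 := by simp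

lemma affineSpan_face_eq_top_iff {T : Finset (ℝ × ℝ)} (hT : T ∈ τ.faces) :
    affineSpan ℝ (T : Set (ℝ × ℝ)) = ⊤ ↔ T.card = 3 := by
  have := (τ.indep hT).affineSpan_eq_top_iff_card_eq_finrank_add_one
  rw [finrank_plane, Fintype.card_coe] at this
  simpa using this

lemma isClosed_convexHull_finset (T : Finset (ℝ × ℝ)) :
    IsClosed (convexHull ℝ (T : Set (ℝ × ℝ))) :=
  T.finite_toSet.isClosed_convexHull ℝ

lemma convexHull_face_subset (hτ : IsLatticeTriangulation m τ) {T : Finset (ℝ × ℝ)}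
    (hT : T ∈ τ.faces) : convexHull ℝ (T : Set (ℝ × ℝ)) ⊆ triangle m := by
  rw [← hτ.space_eq]
  exact Geometry.SimplicialComplex.convexHull_subset_space hT

/-- The triangles of a triangulation cover `Δ`. -/
lemma exists_triangle_mem (hm : 0 < m) (hτ : IsLatticeTriangulation m τ) {p : ℝ × ℝ}
    (hp : p ∈ triangle m) :
    ∃ T ∈ τ.faces, T.card = 3 ∧ p ∈ convexHull ℝ (T : Set (ℝ × ℝ)) := by
  let D : Set (ℝ × ℝ) := ⋃ T ∈ {T | T ∈ τ.faces ∧ T.card = 3}, convexHull ℝ (T : Set (ℝ × ℝ))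
  have hfin := finite_faces hm hτ
  have hD : IsClosed D := (hfin.subset fun T hT => hT.1).isClosed_biUnion
    fun T _ => isClosed_convexHull_finset T
  suffices h : p ∈ D by
    obtain ⟨T, hT, h⟩ := Set.mem_iUnion₂.1 h
    exact ⟨T, hT.1, hT.2, h⟩
  by_contra hpD
  have hcl : p ∈ closure (interior (triangle m)) := by
    rw [(convex_triangle m).closure_interior_eq_closure_of_nonempty_interior
      (nonempty_interior_triangle hm)]
    exact subset_closure hp
  obtain ⟨q, hqD, hq⟩ := mem_closure_iff.1 hcl Dᶜ hD.isOpen_compl hpD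
  have hU : IsOpen (Dᶜ ∩ interior (triangle m)) := hD.isOpen_compl.inter isOpen_interior
  -- An uncovered point yields a nonempty open set met only by faces of lower dimension. Their
  -- affine spans are finitely many null sets, a contradiction.
  have hpos := hU.measure_pos MeasureTheory.volume ⟨q, hqD, hq⟩
  refine hpos.ne' ?_
  have hsub : Dᶜ ∩ interior (triangle m) ⊆
      ⋃ T ∈ {T | T ∈ τ.faces ∧ T.card ≠ 3}, (affineSpan ℝ (T : Set (ℝ × ℝ)) : Set (ℝ × ℝ)) := by
    rintro z ⟨hzD, hz⟩
    have hz := interior_subset hz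
    rw [← hτ.space_eq, Geometry.SimplicialComplex.mem_space_iff] at hz
    obtain ⟨T, hT, hzT⟩ := hz
    refine Set.mem_biUnion (⟨hT, fun h => hzD (Set.mem_biUnion (⟨hT, h⟩ : T ∈ {T | T ∈ τ.faces ∧ T.card = 3}) hzT)⟩ : T ∈ {T | T ∈ τ.faces ∧ T.card ≠ 3})
      (convexHull_subset_affineSpan _ hzT)
  refine MeasureTheory.measure_mono_null hsub ?_
  rw [MeasureTheory.measure_biUnion_null_iff (hfin.subset fun T hT => hT.1).countable]
  intro T hT
  exact MeasureTheory.Measure.addHaar_affineSubspace _ _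
    (fun h => hT.2 ((affineSpan_face_eq_top_iff hT.1).1 h))

lemma nonempty_interior_convexHull {T : Finset (ℝ × ℝ)} (hT : T ∈ τ.faces) (h3 : T.card = 3) :
    (interior (convexHull ℝ (T : Set (ℝ × ℝ)))).Nonempty :=
  interior_convexHull_nonempty_iff_affineSpan_eq_top.2 ((affineSpan_face_eq_top_iff hT).2 h3)

lemma affineMap_lineMap_eq (f : (ℝ × ℝ) →ᵃ[ℝ] ℝ) (p q : ℝ × ℝ) (s : ℝ) :
    f ((1 - s) • p + s • q) = (1 - s) * f p + s * f q := by
  rw [← AffineMap.lineMap_apply_module, AffineMap.apply_lineMap, AffineMap.lineMap_apply_module,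
    smul_eq_mul, smul_eq_mul]

/-- The affine extension of a convex function from a set with nonempty interior is a lower
bound. -/
lemma affineMap_le_of_eqOn {A : Set (ℝ × ℝ)} (hν : ConvexOn ℝ (triangle m) ν)
    {f : (ℝ × ℝ) →ᵃ[ℝ] ℝ} (hf : Set.EqOn ν f A) (hA : A ⊆ triangle m) (hAi : (interior A).Nonempty)
    {z : ℝ × ℝ} (hz : z ∈ triangle m) : f z ≤ ν z := by
  obtain ⟨q, hq⟩ := hAi
  have hc : Filter.Tendsto (fun s : ℝ => (1 - s) • q + s • z) (nhdsWithin 0 (Set.Ioi 0))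
      (nhds q) := by
    have : Continuous fun s : ℝ => (1 - s) • q + s • z := by fun_prop
    have h := this.tendsto 0
    simp only [sub_zero, one_smul, zero_smul, add_zero] at h
    exact h.mono_left nhdsWithin_le_nhds
  obtain ⟨s, hs1, hs2⟩ := ((hc.eventually (isOpen_interior.mem_nhds hq)).and
    (Ioo_mem_nhdsGT (one_pos : (0 : ℝ) < 1))).exists
  have h1 := hf (interior_subset hs1)
  have h2 := hf (interior_subset hq)
  have h3 := hν.2 (hA (interior_subset hq)) hz (sub_nonneg.2 hs2.2.le) hs2.1.le (by ring)
  rw [h1, affineMap_lineMap_eq, h2, smul_eq_mul, smul_eq_mul] at h3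
  exact le_of_mul_le_mul_left (by linarith) hs2.1

lemma affineMap_eq_of_eqOn {U : Set (ℝ × ℝ)} (hU : (interior U).Nonempty)
    {f g : (ℝ × ℝ) →ᵃ[ℝ] ℝ} (h : Set.EqOn f g U) : f = g := by
  refine AffineMap.ext_on (s := U) ?_ h
  rw [eq_top_iff, ← isOpen_interior.affineSpan_eq_top hU]
  exact affineSpan_mono ℝ interior_subset

/-- The heights of the other vertices lie strictly above the plane of a triangle. -/
lemma affineMap_lt_of_notMem (hm : 0 < m) (hτ : IsLatticeTriangulation m τ)
    (hν : CertifiesConvexity m τ ν) {T : Finset (ℝ × ℝ)} (hT : T ∈ τ.faces) (h3 : T.card = 3)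
    {f : (ℝ × ℝ) →ᵃ[ℝ] ℝ} (hf : Set.EqOn ν f (convexHull ℝ (T : Set (ℝ × ℝ)))) {v : ℝ × ℝ}
    (hv : v ∈ τ.vertices) (hvT : v ∉ T) : f v < ν v := by
  have hTsub := convexHull_face_subset hτ hT
  have hTi := nonempty_interior_convexHull hT h3
  have hle : ∀ z ∈ triangle m, f z ≤ ν z := fun z hz =>
    affineMap_le_of_eqOn hν.convexOn hf hTsub hTi hz
  have hvt := vertices_subset_triangle hτ hv
  -- If equality held at v, convexity would force ν = f on every segment from v to T. Near v,
  -- outside T, these segments fill an open set, which meets the interior of another triangle.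
  refine lt_of_le_of_ne (hle v hvt) fun heq => ?_
  have hvc : v ∉ convexHull ℝ (T : Set (ℝ × ℝ)) := fun h =>
    hvT ((Geometry.SimplicialComplex.vertex_mem_convexHull_iff hv hT).1 h)
  obtain ⟨q, hq⟩ := hTi
  have hc : Filter.Tendsto (fun s : ℝ => (1 - s) • v + s • q) (nhdsWithin 0 (Set.Ioi 0))
      (nhds v) := by
    have : Continuous fun s : ℝ => (1 - s) • v + s • q := by fun_prop
    have h := this.tendsto 0
    simp only [sub_zero, one_smul, zero_smul, add_zero] at h
    exact h.mono_left nhdsWithin_le_nhds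
  obtain ⟨s, hs1, hs2⟩ := ((hc.eventually
    ((isClosed_convexHull_finset T).isOpen_compl.mem_nhds hvc)).and
    (Ioo_mem_nhdsGT (one_pos : (0 : ℝ) < 1))).exists
  set z := (1 - s) • v + s • q with hzdef
  -- a neighbourhood of `z` in which the function is affine
  let E : Set (ℝ × ℝ) := (fun y => (1 - s) • v + s • y) '' interior (convexHull ℝ (T : Set (ℝ × ℝ)))
  have hE : IsOpen E := by
    have h1 : IsOpenMap fun y : ℝ × ℝ => (1 - s) • v + s • y :=
      ((Homeomorph.addLeft ((1 - s) • v)).isOpenMap).comp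
        ((Homeomorph.smulOfNeZero s hs2.1.ne').isOpenMap)
    exact h1 _ isOpen_interior
  have hEf : ∀ y ∈ E, y ∈ triangle m ∧ ν y = f y := by
    rintro _ ⟨y, hy, rfl⟩
    have hy' := interior_subset hy
    have hmem := convex_triangle m hvt (hTsub hy') (sub_nonneg.2 hs2.2.le) hs2.1.le (by ring)
    refine ⟨hmem, le_antisymm ?_ (hle _ hmem)⟩
    have h1 := hν.convexOn.2 hvt (hTsub hy') (sub_nonneg.2 hs2.2.le) hs2.1.le (by ring)
    rw [← heq, hf hy', smul_eq_mul, smul_eq_mul] at h1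
    dsimp only
    rw [affineMap_lineMap_eq]
    exact h1
  have hzE : z ∈ E := ⟨q, hq, rfl⟩
  obtain ⟨T', hT', h3', hzT'⟩ := exists_triangle_mem hm hτ (hEf z hzE).1
  have hne : T ≠ T' := by rintro rfl; exact hs1 hzT'
  have hTi' := nonempty_interior_convexHull hT' h3'
  have hcl : z ∈ closure (interior (convexHull ℝ (T' : Set (ℝ × ℝ)))) := by
    rw [(convex_convexHull ℝ _).closure_interior_eq_closure_of_nonempty_interior hTi']
    exact subset_closure hzT'
  obtain ⟨y, hyE, hyT'⟩ := mem_closure_iff.1 hcl E hE hzE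
  obtain ⟨g, hg⟩ := hν.linear_on T' hT' h3'
  -- The affine functions of T and T' agree on a nonempty open set, so ν is affine on the union of
  -- the two triangles.
  have hfg : f = g := by
    refine affineMap_eq_of_eqOn (U := E ∩ interior (convexHull ℝ (T' : Set (ℝ × ℝ)))) ?_ ?_
    · rw [(hE.inter isOpen_interior).interior_eq]; exact ⟨y, hyE, hyT'⟩
    · rintro u ⟨hu1, hu2⟩
      rw [← (hEf u hu1).2, hg (interior_subset hu2)]
  refine hν.not_linear_on_union T hT T' hT' h3 h3' hne ⟨f, ?_⟩
  rintro u (hu | hu)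
  · exact hf hu
  · rw [hfg]; exact hg hu

/-- The corners of `Δ` are vertices of the triangulation. -/
lemma mem_vertices_of_forall_lt (hm : 0 < m) (hτ : IsLatticeTriangulation m τ) {c : ℝ × ℝ}
    (hc : c ∈ triangle m) (g : (ℝ × ℝ) →ₗ[ℝ] ℝ) (hg : ∀ y ∈ triangle m, y ≠ c → g y < g c) :
    c ∈ τ.vertices := by
  obtain ⟨T, hT, -, hcT⟩ := exists_triangle_mem hm hτ hc
  by_contra h
  -- If c were not a vertex, all vertices of a triangle containing it would lie in an open
  -- half-plane which misses c.
  have hsub : (T : Set (ℝ × ℝ)) ⊆ {y | g y < g c} := fun y hy => by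
    have hyv := mem_vertices_of_mem_face hT hy
    exact hg y (vertices_subset_triangle hτ hyv) (fun hyc => h (hyc ▸ hyv))
  have : g c < g c := convexHull_min hsub (convex_halfSpace_lt g.isLinear _) hcT
  exact lt_irrefl _ this

end Complex

/-! ### Combinatorial data of a convex lattice triangulation -/

section Complex

variable {m : ℕ} {τ : Geometry.SimplicialComplex ℝ (ℝ × ℝ)} {ν : ℝ × ℝ → ℝ}

/-- The type of vertices of a lattice triangulation. -/
abbrev Vertex (m : ℕ) (τ : Geometry.SimplicialComplex ℝ (ℝ × ℝ)) : Type := vertexSet m τ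

/-- The position of a vertex. -/
def vertexPoint : Vertex m τ ↪ ℝ × ℝ :=
  ⟨fun a => natPoint a, natPoint_injective.comp Subtype.val_injective⟩

lemma exists_corner (hm : 0 < m) (hτ : IsLatticeTriangulation m τ) (i : Fin 3) :
    ∃ a : Vertex m τ, ∀ j, ![a.1.1, a.1.2, m - (a.1.1 + a.1.2)] j = if i = j then m else 0 := by
  have hm' : (0 : ℝ) < m := by exact_mod_cast hm
  have key : ∀ (c : ℕ × ℕ) (g : (ℝ × ℝ) →ₗ[ℝ] ℝ), c.1 + c.2 ≤ m →
      (∀ y : ℝ × ℝ, 0 ≤ y.1 → 0 ≤ y.2 → y.1 + y.2 ≤ m → g (natPoint c) ≤ g y → y = natPoint c) →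
      c ∈ vertexSet m τ := by
    intro c g hc hg
    have hct : natPoint c ∈ triangle m := by
      rw [triangle_eq hm]
      refine ⟨Nat.cast_nonneg _, Nat.cast_nonneg _, ?_⟩
      change (c.1 : ℝ) + c.2 ≤ m
      exact_mod_cast hc
    have := mem_vertices_of_forall_lt hm hτ hct g (fun y hy hne => by
      rw [triangle_eq hm] at hy
      by_contra hlt
      exact hne (hg y hy.1 hy.2.1 hy.2.2 (not_lt.1 hlt)))
    obtain ⟨a, ha, hac⟩ := (mem_vertices_iff hm hτ).1 this
    rwa [← natPoint_injective hac]
  have h0 : ((m, 0) : ℕ × ℕ) ∈ vertexSet m τ := by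
    refine key _ (LinearMap.fst ℝ ℝ ℝ) (by simp) fun y h1 h2 h3 h4 => ?_
    simp only [natPoint, LinearMap.fst_apply] at h4
    ext <;> simp only [natPoint, Nat.cast_zero] <;> linarith
  have h1 : ((0, m) : ℕ × ℕ) ∈ vertexSet m τ := by
    refine key _ (LinearMap.snd ℝ ℝ ℝ) (by simp) fun y h1 h2 h3 h4 => ?_
    simp only [natPoint, LinearMap.snd_apply] at h4
    ext <;> simp only [natPoint, Nat.cast_zero] <;> linarith
  have h2 : ((0, 0) : ℕ × ℕ) ∈ vertexSet m τ := by
    refine key _ (-(LinearMap.fst ℝ ℝ ℝ + LinearMap.snd ℝ ℝ ℝ)) (by simp) fun y h1 h2 h3 h4 => ?_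
    simp only [natPoint, LinearMap.neg_apply, LinearMap.add_apply, LinearMap.fst_apply,
      LinearMap.snd_apply, Nat.cast_zero, add_zero, neg_zero] at h4
    ext <;> simp only [natPoint, Nat.cast_zero] <;> linarith
  fin_cases i
  · refine ⟨⟨_, h0⟩, fun j => ?_⟩
    fin_cases j <;> simp
  · refine ⟨⟨_, h1⟩, fun j => ?_⟩
    fin_cases j <;> simp
  · refine ⟨⟨_, h2⟩, fun j => ?_⟩
    fin_cases j <;> simp

/-- The homogeneous monomials which correspond to the vertices. -/
noncomputable def vertexFamily (hm : 0 < m) (hτ : IsLatticeTriangulation m τ) :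
    MonomialFamily (Vertex m τ) where
  deg := m
  deg_pos := hm
  exps a := ![a.1.1, a.1.2, m - (a.1.1 + a.1.2)]
  sum_exps a := by
    have := add_le_of_mem_vertexSet hm hτ a.2
    rw [Fin.sum_univ_three]
    change a.1.1 + a.1.2 + (m - (a.1.1 + a.1.2)) = m
    omega
  corner i := (exists_corner hm hτ i).choose
  exps_corner i j := (exists_corner hm hτ i).choose_spec j

/-- The coordinates on `Δ` in which it is the standard simplex. -/
noncomputable def simplexCoord (m : ℕ) (p : ℝ × ℝ) : Fin 3 → ℝ :=
  ![p.1 / m, p.2 / m, 1 - (p.1 + p.2) / m]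

lemma simplexCoord_injective (hm : 0 < m) : Function.Injective (simplexCoord m) := by
  intro p q h
  have hm' : (m : ℝ) ≠ 0 := by exact_mod_cast hm.ne'
  have h0 : p.1 / m = q.1 / m := congrFun h 0
  have h1 : p.2 / m = q.2 / m := congrFun h 1
  ext
  · field_simp at h0; exact h0
  · field_simp at h1; exact h1

lemma simplexCoord_mem_iff (hm : 0 < m) {p : ℝ × ℝ} :
    simplexCoord m p ∈ stdSimplex ℝ (Fin 3) ↔ p ∈ triangle m := by
  have hm' : (0 : ℝ) < m := by exact_mod_cast hm
  have hle : 0 ≤ 1 - (p.1 + p.2) / m ↔ p.1 + p.2 ≤ m := by rw [sub_nonneg, div_le_one hm']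
  rw [triangle_eq hm]
  constructor
  · rintro ⟨h, -⟩
    have h0 : 0 ≤ p.1 / m := h 0
    have h1 : 0 ≤ p.2 / m := h 1
    refine ⟨?_, ?_, hle.1 (h 2)⟩
    · have := mul_nonneg h0 hm'.le
      rwa [div_mul_cancel₀ _ hm'.ne'] at this
    · have := mul_nonneg h1 hm'.le
      rwa [div_mul_cancel₀ _ hm'.ne'] at this
  · rintro ⟨h0, h1, h2⟩
    constructor
    · intro i
      fin_cases i
      · exact div_nonneg h0 hm'.le
      · exact div_nonneg h1 hm'.le
      · exact hle.2 h2
    · rw [Fin.sum_univ_three]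
      change p.1 / m + p.2 / m + (1 - (p.1 + p.2) / m) = 1
      ring

lemma exists_simplexCoord_eq (hm : 0 < m) {x : Fin 3 → ℝ} (hx : x ∈ stdSimplex ℝ (Fin 3)) :
    ∃ p ∈ triangle m, simplexCoord m p = x := by
  have hm' : (m : ℝ) ≠ 0 := by exact_mod_cast hm.ne'
  have h : simplexCoord m (m * x 0, m * x 1) = x := by
    have hs := hx.2
    rw [Fin.sum_univ_three] at hs
    funext i
    fin_cases i
    · change m * x 0 / m = x 0
      field_simp
    · change m * x 1 / m = x 1
      field_simp
    · change 1 - (m * x 0 + m * x 1) / m = x 2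
      field_simp
      linarith
  exact ⟨_, (simplexCoord_mem_iff hm).1 (by rw [h]; exact hx), h⟩

lemma bary_vertexFamily (hm : 0 < m) (hτ : IsLatticeTriangulation m τ) {w : Vertex m τ → ℝ}
    (hw : ∑ a, w a = 1) :
    (vertexFamily hm hτ).bary w = simplexCoord m (∑ a, w a • vertexPoint a) := by
  have hm' : (m : ℝ) ≠ 0 := by exact_mod_cast hm.ne'
  have e1 : (∑ a, w a • vertexPoint a : ℝ × ℝ).1 = ∑ a, w a * (a.1.1 : ℝ) := by
    rw [Prod.fst_sum]; rfl
  have e2 : (∑ a, w a • vertexPoint a : ℝ × ℝ).2 = ∑ a, w a * (a.1.2 : ℝ) := by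
    rw [Prod.snd_sum]; rfl
  funext i
  fin_cases i
  · change (∑ a, w a * (a.1.1 : ℝ)) / m = (∑ a, w a • vertexPoint a : ℝ × ℝ).1 / m
    rw [e1]
  · change (∑ a, w a * (a.1.2 : ℝ)) / m = (∑ a, w a • vertexPoint a : ℝ × ℝ).2 / m
    rw [e2]
  · change (∑ a, w a * ((m - (a.1.1 + a.1.2) : ℕ) : ℝ)) / m = 1 -
      ((∑ a, w a • vertexPoint a : ℝ × ℝ).1 + (∑ a, w a • vertexPoint a : ℝ × ℝ).2) / m
    rw [e1, e2]
    have : ∑ a : Vertex m τ, w a * ((m - (a.1.1 + a.1.2) : ℕ) : ℝ) =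
        m - (∑ a, w a * (a.1.1 : ℝ) + ∑ a, w a * (a.1.2 : ℝ)) := by
      have h1 : (m : ℝ) = ∑ a, w a * m := by rw [← Finset.sum_mul, hw, one_mul]
      conv_rhs => rw [h1]
      rw [← Finset.sum_add_distrib, ← Finset.sum_sub_distrib]
      refine Finset.sum_congr rfl fun a _ => ?_
      rw [Nat.cast_sub (add_le_of_mem_vertexSet hm hτ a.2)]
      push_cast; ring
    rw [this]
    field_simp

/-- The triangles of a triangulation, as sets of vertices. -/
def triangles (m : ℕ) (τ : Geometry.SimplicialComplex ℝ (ℝ × ℝ)) : Set (Finset (Vertex m τ)) :=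
  {U | U.map vertexPoint ∈ τ.faces ∧ U.card = 3}

lemma exists_map_eq (hm : 0 < m) (hτ : IsLatticeTriangulation m τ) {T : Finset (ℝ × ℝ)}
    (hT : T ∈ τ.faces) : ∃ U : Finset (Vertex m τ), U.map vertexPoint = T := by
  classical
  refine ⟨Finset.univ.filter fun a => vertexPoint a ∈ T, ?_⟩
  ext v
  simp only [Finset.mem_map, Finset.mem_filter, Finset.mem_univ, true_and]
  constructor
  · rintro ⟨a, ha, rfl⟩; exact ha
  · intro hv
    obtain ⟨a, ha, rfl⟩ := (mem_vertices_iff hm hτ).1 (mem_vertices_of_mem_face hT hv)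
    exact ⟨⟨a, ha⟩, hv, rfl⟩

lemma mem_convexHull_map_iff {U : Finset (Vertex m τ)} {p : ℝ × ℝ} :
    p ∈ convexHull ℝ ((U.map vertexPoint : Finset (ℝ × ℝ)) : Set (ℝ × ℝ)) ↔
      ∃ w ∈ stdSimplex ℝ (Vertex m τ), (∀ a ∉ U, w a = 0) ∧ ∑ a, w a • vertexPoint a = p := by
  classical
  constructor
  · intro h
    rw [Finset.mem_convexHull'] at h
    obtain ⟨w, hw0, hw1, hwp⟩ := h
    rw [Finset.sum_map] at hw1 hwp
    have hU : ∀ {E : Type} [AddCommMonoid E] (g : Vertex m τ → E),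
        ∑ a ∈ U, g a = ∑ a, if a ∈ U then g a else 0 := fun g => by
      rw [← Finset.sum_filter, Finset.filter_mem_eq_inter, Finset.univ_inter]
    refine ⟨fun a => if a ∈ U then w (vertexPoint a) else 0, ⟨fun a => ?_, ?_⟩, fun a ha => ?_, ?_⟩
    · dsimp only
      split_ifs with ha
      · exact hw0 _ (Finset.mem_map_of_mem _ ha)
      · exact le_rfl
    · rw [← hU, hw1]
    · simp [ha]
    · simp only [ite_smul, zero_smul]
      rw [← hU, hwp]
  · rintro ⟨w, hw, hwU, rfl⟩
    rw [← Finset.sum_subset (Finset.subset_univ U)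
      (fun a _ ha => by rw [hwU a ha, zero_smul])]
    refine (convex_convexHull ℝ _).sum_mem (fun a _ => hw.1 a) ?_ fun a ha =>
      subset_convexHull ℝ _ (by
        rw [Finset.coe_map]; exact Set.mem_image_of_mem _ ha)
    rw [Finset.sum_subset (Finset.subset_univ U) (fun a _ ha => hwU a ha), hw.2]

lemma eq_zero_of_sum_smul_eq_zero {U : Finset (Vertex m τ)} (hU : U.map vertexPoint ∈ τ.faces)
    {v : Vertex m τ → ℝ} (hv : ∀ a ∉ U, v a = 0) (h0 : ∑ a, v a = 0)
    (h1 : ∑ a, v a • vertexPoint a = 0) : v = 0 := by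
  have hind : AffineIndependent ℝ (fun a : U => vertexPoint (a : Vertex m τ)) := by
    let φ : U ↪ (U.map vertexPoint : Finset (ℝ × ℝ)) :=
      ⟨fun a => ⟨vertexPoint (a : Vertex m τ), Finset.mem_map_of_mem _ a.2⟩, fun a b h =>
        Subtype.ext (vertexPoint.injective (congrArg Subtype.val h))⟩
    exact (τ.indep hU).comp_embedding φ
  rw [← Finset.sum_subset (Finset.subset_univ U) (fun a _ ha => hv a ha),
    ← Finset.sum_coe_sort] at h0
  rw [← Finset.sum_subset (Finset.subset_univ U) (fun a _ ha => by rw [hv a ha, zero_smul]),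
    ← Finset.sum_coe_sort U (fun a => v a • vertexPoint a)] at h1
  rw [affineIndependent_iff] at hind
  have := hind Finset.univ (fun a => v a) h0 h1
  funext a
  by_cases ha : a ∈ U
  · exact this ⟨a, ha⟩ (Finset.mem_univ _)
  · exact hv a ha

/-- Since faces meet along common faces, the point lies in the hull of the common vertices. Its
weights there must equal both given ones by affine independence. -/
lemma weights_unique {U U' : Finset (Vertex m τ)} (hU : U.map vertexPoint ∈ τ.faces)
    (hU' : U'.map vertexPoint ∈ τ.faces) {w w' : Vertex m τ → ℝ}
    (hw : w ∈ stdSimplex ℝ (Vertex m τ)) (hw' : w' ∈ stdSimplex ℝ (Vertex m τ))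
    (hwU : ∀ a ∉ U, w a = 0) (hwU' : ∀ a ∉ U', w' a = 0)
    (h : ∑ a, w a • vertexPoint a = ∑ a, w' a • (vertexPoint a : ℝ × ℝ)) : w = w' := by
  classical
  have h1 : ∑ a, w a • vertexPoint a ∈
      convexHull ℝ (((U ∩ U').map vertexPoint : Finset (ℝ × ℝ)) : Set (ℝ × ℝ)) := by
    rw [Finset.map_inter, Finset.coe_inter]
    refine τ.inter_subset_convexHull hU hU' ⟨?_, ?_⟩
    · exact mem_convexHull_map_iff.2 ⟨w, hw, hwU, rfl⟩
    · exact mem_convexHull_map_iff.2 ⟨w', hw', hwU', h.symm⟩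
  obtain ⟨u, hu, huU, hup⟩ := mem_convexHull_map_iff.1 h1
  have key : ∀ {V : Finset (Vertex m τ)} {y : Vertex m τ → ℝ}, V.map vertexPoint ∈ τ.faces →
      y ∈ stdSimplex ℝ (Vertex m τ) → (∀ a ∉ V, y a = 0) → (∀ a ∉ V, u a = 0) →
      ∑ a, y a • vertexPoint a = ∑ a, u a • (vertexPoint a : ℝ × ℝ) → y = u := by
    intro V y hV hy hyV huV hyu
    refine sub_eq_zero.1 (eq_zero_of_sum_smul_eq_zero hV (v := y - u) ?_ ?_ ?_)
    · intro a ha; simp [hyV a ha, huV a ha]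
    · simp only [Pi.sub_apply, Finset.sum_sub_distrib, hy.2, hu.2, sub_self]
    · simp only [Pi.sub_apply, sub_smul, Finset.sum_sub_distrib, hyu, sub_self]
  rw [key hU hw hwU (fun a ha => huU a fun h' => ha (Finset.mem_inter.1 h').1) hup.symm,
    key hU' hw' hwU' (fun a ha => huU a fun h' => ha (Finset.mem_inter.1 h').2)
      (h.symm.trans hup.symm)]

/-- Barycentric coordinates with respect to a triangle, as linear forms. -/
lemma exists_coord (hm : 0 < m) (hτ : IsLatticeTriangulation m τ) {U : Finset (Vertex m τ)}
    (hU : U ∈ triangles m τ) : ∃ c : Vertex m τ → Fin 3 → ℝ,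
    (∀ a ∈ U, (vertexFamily hm hτ).form (c a) a = 1) ∧
    (∀ a ∈ U, ∀ b ∈ U, a ≠ b → (vertexFamily hm hτ).form (c a) b = 0) ∧
    ∀ d e, (vertexFamily hm hτ).form d e =
      ∑ a ∈ U, (vertexFamily hm hτ).form (c a) e * (vertexFamily hm hτ).form d a := by
  classical
  set M := vertexFamily hm hτ with hM
  have hm' : (m : ℝ) ≠ 0 := by exact_mod_cast hm.ne'
  let A : Vertex m τ → Fin 3 → ℝ := fun a i => M.exps a i
  -- The exponent vectors lie in the plane of coordinate sum m ≠ 0, so a linear relation among them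
  -- is an affine relation among the vertices.
  have hli : LinearIndependent ℝ (fun a : U => A a) := by
    rw [Fintype.linearIndependent_iff]
    intro g hg
    let v : Vertex m τ → ℝ := fun a => if h : a ∈ U then g ⟨a, h⟩ else 0
    have hvU : ∀ a ∉ U, v a = 0 := fun a ha => by simp [v, ha]
    have hv : ∀ i, ∑ a, v a * A a i = 0 := by
      intro i
      have := congrFun hg i
      rw [Finset.sum_apply] at this
      rw [← Finset.sum_subset (Finset.subset_univ U) (fun a _ ha => by rw [hvU a ha, zero_mul]),
        ← Finset.sum_coe_sort]
      refine Eq.trans (Finset.sum_congr rfl fun a _ => ?_) this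
      simp [v]
    have hsum : ∑ a, v a = 0 := by
      have h2 : ∑ i, ∑ a, v a * A a i = 0 := Finset.sum_eq_zero fun i _ => hv i
      rw [Finset.sum_comm] at h2
      have h3 : ∀ a, ∑ i, v a * A a i = v a * m := fun a => by
        rw [← Finset.mul_sum]
        congr 1
        exact MonomialFamily.sum_exps_real (M := M) a
      simp only [h3, ← Finset.sum_mul] at h2
      exact (mul_eq_zero.1 h2).resolve_right hm'
    have hpt : ∑ a, v a • (vertexPoint a : ℝ × ℝ) = 0 := by
      ext
      · rw [Prod.fst_sum]; exact hv 0
      · rw [Prod.snd_sum]; exact hv 1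
    have h0 := eq_zero_of_sum_smul_eq_zero hU.1 hvU hsum hpt
    intro a
    have := congrFun h0 a
    simpa [v] using this
  have hne : Nonempty U := by
    have : U.Nonempty := Finset.card_pos.1 (by rw [hU.2]; norm_num)
    exact this.to_subtype
  let B := basisOfLinearIndependentOfCardEqFinrank hli (by
    rw [Fintype.card_coe, hU.2, Module.finrank_fin_fun])
  have hB : ∀ a : U, B a = A a := fun a => by simp [B]
  have hform : ∀ (φ : (Fin 3 → ℝ) →ₗ[ℝ] ℝ) e, M.form (fun i => φ (Pi.single i 1)) e = φ (A e) := by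
    intro φ e
    rw [MonomialFamily.form]
    conv_rhs => rw [LinearMap.pi_apply_eq_sum_univ φ (A e)]
    refine Finset.sum_congr rfl fun i _ => ?_
    rw [smul_eq_mul, mul_comm]
    congr 2
    funext j
    simp [Pi.single_apply, eq_comm]
  let c : Vertex m τ → Fin 3 → ℝ := fun a i =>
    if h : a ∈ U then B.coord ⟨a, h⟩ (Pi.single i 1) else 0
  have hc : ∀ (a : U) e, M.form (c a) e = B.coord a (A e) := by
    intro a e
    rw [← hform]
    congr 1
    funext i
    simp [c]
  refine ⟨c, fun a ha => ?_, fun a ha b hb hab => ?_, fun d e => ?_⟩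
  · rw [hc ⟨a, ha⟩, ← hB ⟨a, ha⟩]; simp
  · rw [hc ⟨a, ha⟩, ← hB ⟨b, hb⟩]
    simp [hab.symm]
  · rw [← Finset.sum_coe_sort]
    have hrep := B.sum_repr (A e)
    have h1 : ∀ i, ∑ a : U, M.form (c a) e * A a i = A e i := by
      intro i
      have := congrFun hrep i
      rw [Finset.sum_apply] at this
      rw [← this]
      exact Finset.sum_congr rfl fun a _ => by rw [hc, hB]; rfl
    change ∑ i, d i * A e i = ∑ a : U, M.form (c a) e * ∑ i, d i * A a i
    simp only [← h1, Finset.mul_sum]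
    rw [Finset.sum_comm]
    exact Finset.sum_congr rfl fun a _ => Finset.sum_congr rfl fun i _ => by ring

/-- Affine functions on Δ become linear forms in homogeneous exponents; the coefficients are the
values at the corners divided by m. -/
lemma form_eq_affineMap (hm : 0 < m) (hτ : IsLatticeTriangulation m τ)
    (f : (ℝ × ℝ) →ᵃ[ℝ] ℝ) (a : Vertex m τ) :
    (vertexFamily hm hτ).form ![f (m, 0) / m, f (0, m) / m, f (0, 0) / m] a =
      f (vertexPoint a) := by
  have hm' : (m : ℝ) ≠ 0 := by exact_mod_cast hm.ne'
  have hf : ∀ p : ℝ × ℝ, f p = p.1 * f.linear (1, 0) + p.2 * f.linear (0, 1) + f 0 := by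
    intro p
    have h1 : f p = f.linear p + f 0 := by
      have := f.map_vadd 0 p
      simpa using this
    have h2 : p = p.1 • ((1 : ℝ), (0 : ℝ)) + p.2 • ((0 : ℝ), (1 : ℝ)) := by ext <;> simp
    rw [h1]
    conv_lhs => rw [h2]
    rw [map_add, map_smul, map_smul, smul_eq_mul, smul_eq_mul]
  rw [MonomialFamily.form, Fin.sum_univ_three]
  change f (m, 0) / m * (a.1.1 : ℝ) + f (0, m) / m * (a.1.2 : ℝ) +
    f (0, 0) / m * ((m - (a.1.1 + a.1.2) : ℕ) : ℝ) = f ((a.1.1 : ℝ), (a.1.2 : ℝ))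
  rw [Nat.cast_sub (add_le_of_mem_vertexSet hm hτ a.2), hf (m, 0), hf (0, m), hf (0, 0),
    hf (a.1.1, a.1.2)]
  push_cast
  field_simp
  ring

/-- The combinatorial data of a convex lattice triangulation. -/
noncomputable def convexTriangulation (hm : 0 < m) (hτ : IsLatticeTriangulation m τ)
    (hν : CertifiesConvexity m τ ν) : ConvexTriangulation (vertexFamily hm hτ) := by
  classical
  exact
  { tri := triangles m τ
    card_tri := fun T hT => hT.2
    coord := fun U => if hU : U ∈ triangles m τ then (exists_coord hm hτ hU).choose else 0
    coord_self := fun U hU => by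
      rw [dif_pos hU]; exact (exists_coord hm hτ hU).choose_spec.1
    coord_ne := fun U hU => by
      rw [dif_pos hU]; exact (exists_coord hm hτ hU).choose_spec.2.1
    form_eq := fun U hU => by
      rw [dif_pos hU]; exact (exists_coord hm hτ hU).choose_spec.2.2
    unique := fun U hU U' hU' w hw w' hw' hwU hwU' h => by
      rw [bary_vertexFamily hm hτ hw.2, bary_vertexFamily hm hτ hw'.2] at h
      exact weights_unique hU.1 hU'.1 hw hw' hwU hwU' (simplexCoord_injective hm h)
    cover := fun x hx => by
      obtain ⟨p, hp, rfl⟩ := exists_simplexCoord_eq hm hx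
      obtain ⟨T, hT, h3, hpT⟩ := exists_triangle_mem hm hτ hp
      obtain ⟨U, rfl⟩ := exists_map_eq hm hτ hT
      obtain ⟨w, hw, hwU, hwp⟩ := mem_convexHull_map_iff.1 hpT
      refine ⟨U, ⟨hT, by rwa [Finset.card_map] at h3⟩, w, hw, hwU, ?_⟩
      rw [bary_vertexFamily hm hτ hw.2, hwp]
    height := fun a => ν (vertexPoint a)
    exists_form_lt := fun U hU => by
      have h3 : (U.map vertexPoint).card = 3 := by rw [Finset.card_map]; exact hU.2
      obtain ⟨f, hf⟩ := hν.linear_on _ hU.1 h3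
      refine ⟨![f (m, 0) / m, f (0, m) / m, f (0, 0) / m], fun a ha => ?_, fun a ha => ?_⟩
      · rw [form_eq_affineMap hm hτ f]
        exact hf (subset_convexHull ℝ _ (Finset.mem_coe.2 (Finset.mem_map_of_mem _ ha)))
      · rw [form_eq_affineMap hm hτ f]
        refine affineMap_lt_of_notMem hm hτ hν hU.1 h3 hf
          ((mem_vertices_iff hm hτ).2 ⟨a.1, a.2, rfl⟩) fun h => ha ?_
        rwa [Finset.mem_map' vertexPoint] at h }

end Complex

/-! ### The square, the upper half of the octahedron and the gluing of quadrants -/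

/-- A sign of a real number. -/
noncomputable def signUnit (r : ℝ) : ℤˣ := if 0 ≤ r then 1 else -1

lemma signUnit_mul_nonneg (r : ℝ) : 0 ≤ (((signUnit r : ℤˣ) : ℤ) : ℝ) * r := by
  unfold signUnit
  split_ifs with h
  · simpa
  · simp; linarith

lemma unit_mul_self (ε : ℤˣ) : ((ε : ℤ) : ℝ) * ((ε : ℤ) : ℝ) = 1 := by
  rcases Int.units_eq_one_or ε with h | h <;> simp [h]

lemma abs_unit (ε : ℤˣ) : |((ε : ℤ) : ℝ)| = 1 := by
  rcases Int.units_eq_one_or ε with h | h <;> simp [h]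

lemma abs_eq_unit_mul {ε : ℤˣ} {r : ℝ} (h : 0 ≤ ((ε : ℤ) : ℝ) * r) : |r| = ((ε : ℤ) : ℝ) * r := by
  rw [← abs_of_nonneg h, abs_mul, abs_unit, one_mul]

lemma unit_mul_abs {ε : ℤˣ} {r : ℝ} (h : 0 ≤ ((ε : ℤ) : ℝ) * r) : ((ε : ℤ) : ℝ) * |r| = r := by
  rw [abs_eq_unit_mul h, ← mul_assoc, unit_mul_self, one_mul]

lemma unit_eq_of_mul_nonneg {ε ε' : ℤˣ} {r : ℝ} (hr : r ≠ 0) (h : 0 ≤ ((ε : ℤ) : ℝ) * r)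
    (h' : 0 ≤ ((ε' : ℤ) : ℝ) * r) : ε = ε' := by
  have h1 : ((ε : ℤ) : ℝ) * r = ((ε' : ℤ) : ℝ) * r := by
    rw [← abs_eq_unit_mul h, ← abs_eq_unit_mul h']
  have h2 := mul_right_cancel₀ hr h1
  exact Units.ext (by exact_mod_cast h2)

section Square

variable {m : ℕ}

lemma mem_square_iff (hm : 0 < m) {p : ℝ × ℝ} : p ∈ square m ↔ |p.1| + |p.2| ≤ m := by
  simp only [square, Set.mem_iUnion, triangle_eq hm]
  constructor
  · rintro ⟨ε, δ, q, ⟨h1, h2, h3⟩, rfl⟩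
    simp only [reflect, abs_mul, abs_unit, one_mul, abs_of_nonneg h1, abs_of_nonneg h2]
    exact h3
  · intro h
    refine ⟨signUnit p.1, signUnit p.2, (|p.1|, |p.2|), ⟨abs_nonneg _, abs_nonneg _, h⟩, ?_⟩
    ext
    · exact unit_mul_abs (signUnit_mul_nonneg _)
    · exact unit_mul_abs (signUnit_mul_nonneg _)

lemma continuous_abs_add_abs : Continuous fun p : ℝ × ℝ => |p.1| + |p.2| := by fun_prop

lemma isClosed_square (hm : 0 < m) : IsClosed (square m) := by
  have : square m = {p : ℝ × ℝ | |p.1| + |p.2| ≤ m} := Set.ext fun p => mem_square_iff hm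
  rw [this]
  exact isClosed_le continuous_abs_add_abs continuous_const

lemma mem_interior_square_iff (hm : 0 < m) {p : ℝ × ℝ} :
    p ∈ interior (square m) ↔ |p.1| + |p.2| < m := by
  have hm' : (0 : ℝ) < m := by exact_mod_cast hm
  constructor
  · intro hp
    have hc : Filter.Tendsto (fun s : ℝ => (1 + s) • p) (nhdsWithin 0 (Set.Ioi 0)) (nhds p) := by
      have : Continuous fun s : ℝ => (1 + s) • p := by fun_prop
      have h := this.tendsto 0
      simp only [add_zero, one_smul] at h
      exact h.mono_left nhdsWithin_le_nhds
    obtain ⟨s, hs1, hs2⟩ := ((hc.eventually (isOpen_interior.mem_nhds hp)).and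
      self_mem_nhdsWithin).exists
    have hs2 : 0 < s := hs2
    have h1 := (mem_square_iff hm).1 (interior_subset hs1)
    have h2 : |((1 + s) • p).1| + |((1 + s) • p).2| = (1 + s) * (|p.1| + |p.2|) := by
      simp only [Prod.smul_fst, Prod.smul_snd, smul_eq_mul, abs_mul,
        abs_of_pos (by linarith : 0 < 1 + s)]
      ring
    rw [h2] at h1
    nlinarith
  · intro hp
    refine interior_maximal (s := square m) (t := {p : ℝ × ℝ | |p.1| + |p.2| < m})
      (fun q hq => (mem_square_iff hm).2 (le_of_lt hq))
      (isOpen_lt continuous_abs_add_abs continuous_const) hp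

lemma mem_frontier_square_iff (hm : 0 < m) {p : ℝ × ℝ} :
    p ∈ frontier (square m) ↔ |p.1| + |p.2| = m := by
  rw [frontier, (isClosed_square hm).closure_eq, Set.mem_sdiff, mem_square_iff hm,
    mem_interior_square_iff hm, not_lt, le_antisymm_iff]

lemma isCompact_square (hm : 0 < m) : IsCompact (square m) := by
  refine (isCompact_Icc (a := ((-m, -m) : ℝ × ℝ)) (b := (m, m))).of_isClosed_subset
    (isClosed_square hm) fun p hp => ?_
  have h := (mem_square_iff hm).1 hp
  have h1 := abs_le.1 (by linarith [abs_nonneg p.2] : |p.1| ≤ m)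
  have h2 := abs_le.1 (by linarith [abs_nonneg p.1] : |p.2| ≤ m)
  exact ⟨⟨h1.1, h2.1⟩, ⟨h1.2, h2.2⟩⟩

end Square

/-- The upper half of the octahedron. -/
def upperOctahedron : Set (Fin 3 → ℝ) := {v | |v 0| + |v 1| + v 2 = 1 ∧ 0 ≤ v 2}

lemma isCompact_upperOctahedron : IsCompact upperOctahedron := by
  refine (isCompact_Icc (a := (fun _ => -1 : Fin 3 → ℝ)) (b := fun _ => 1)).of_isClosed_subset ?_
    fun v hv => ?_
  · exact (isClosed_eq (by fun_prop) continuous_const).inter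
      (isClosed_le continuous_const (continuous_apply 2))
  · obtain ⟨h1, h2⟩ := hv
    have e0 := abs_le.1 (by linarith [abs_nonneg (v 1)] : |v 0| ≤ 1)
    have e1 := abs_le.1 (by linarith [abs_nonneg (v 0)] : |v 1| ≤ 1)
    have e2 : v 2 ≤ 1 := by linarith [abs_nonneg (v 0), abs_nonneg (v 1)]
    constructor
    · intro i
      fin_cases i
      · exact e0.1
      · exact e1.1
      · change -1 ≤ v 2; linarith
    · intro i
      fin_cases i
      · exact e0.2
      · exact e1.2
      · exact e2

/-- The projection of the upper half of the octahedron to the standard simplex. -/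
noncomputable def foldPoint (v : upperOctahedron) : stdSimplex ℝ (Fin 3) :=
  ⟨![|v.1 0|, |v.1 1|, v.1 2], by
    refine ⟨fun i => ?_, ?_⟩
    · fin_cases i
      · exact abs_nonneg _
      · exact abs_nonneg _
      · exact v.2.2
    · rw [Fin.sum_univ_three]; exact v.2.1⟩

lemma continuous_foldPoint : Continuous foldPoint := by
  refine Continuous.subtype_mk (continuous_pi fun i => ?_) _
  fin_cases i
  · exact ((continuous_apply 0).comp continuous_subtype_val).abs
  · exact ((continuous_apply 1).comp continuous_subtype_val).abs
  · change Continuous fun v : upperOctahedron => v.1 2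
    exact (continuous_apply 2).comp continuous_subtype_val

/-- A point of the simplex, moved to a given quadrant. -/
noncomputable def unfoldPoint (ε δ : ℤˣ) (x : stdSimplex ℝ (Fin 3)) : upperOctahedron :=
  ⟨![((ε : ℤ) : ℝ) * x.1 0, ((δ : ℤ) : ℝ) * x.1 1, x.1 2], by
    refine ⟨?_, x.2.1 2⟩
    have := x.2.2
    rw [Fin.sum_univ_three] at this
    change |((ε : ℤ) : ℝ) * x.1 0| + |((δ : ℤ) : ℝ) * x.1 1| + x.1 2 = 1
    rw [abs_mul, abs_mul, abs_unit, abs_unit, one_mul, one_mul, abs_of_nonneg (x.2.1 0),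
      abs_of_nonneg (x.2.1 1), this]⟩

lemma unfoldPoint_nonneg (ε δ : ℤˣ) (x : stdSimplex ℝ (Fin 3)) :
    0 ≤ ((ε : ℤ) : ℝ) * (unfoldPoint ε δ x).1 0 ∧ 0 ≤ ((δ : ℤ) : ℝ) * (unfoldPoint ε δ x).1 1 := by
  constructor
  · change 0 ≤ ((ε : ℤ) : ℝ) * (((ε : ℤ) : ℝ) * x.1 0)
    rw [← mul_assoc, unit_mul_self, one_mul]; exact x.2.1 0
  · change 0 ≤ ((δ : ℤ) : ℝ) * (((δ : ℤ) : ℝ) * x.1 1)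
    rw [← mul_assoc, unit_mul_self, one_mul]; exact x.2.1 1

lemma foldPoint_unfoldPoint (ε δ : ℤˣ) (x : stdSimplex ℝ (Fin 3)) :
    foldPoint (unfoldPoint ε δ x) = x := by
  refine Subtype.ext (funext fun i => ?_)
  fin_cases i
  · change |((ε : ℤ) : ℝ) * x.1 0| = x.1 0
    rw [abs_mul, abs_unit, one_mul, abs_of_nonneg (x.2.1 0)]
  · change |((δ : ℤ) : ℝ) * x.1 1| = x.1 1
    rw [abs_mul, abs_unit, one_mul, abs_of_nonneg (x.2.1 1)]
  · rfl

lemma unfoldPoint_foldPoint {ε δ : ℤˣ} {v : upperOctahedron} (h0 : 0 ≤ ((ε : ℤ) : ℝ) * v.1 0)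
    (h1 : 0 ≤ ((δ : ℤ) : ℝ) * v.1 1) : unfoldPoint ε δ (foldPoint v) = v := by
  refine Subtype.ext (funext fun i => ?_)
  fin_cases i
  · exact unit_mul_abs h0
  · exact unit_mul_abs h1
  · rfl

/-- Homeomorphisms of the simplex, one for each quadrant, which preserve the faces and are
compatible with the gluing. -/
structure QuadrantHomeos where
  J : ℤˣ → ℤˣ → (stdSimplex ℝ (Fin 3) ≃ₜ stdSimplex ℝ (Fin 3))
  eq_zero_iff : ∀ ε δ x i, (J ε δ x).1 i = 0 ↔ x.1 i = 0
  congr_fst : ∀ ε ε' δ x, x.1 0 = 0 → J ε δ x = J ε' δ x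
  congr_snd : ∀ ε δ δ' x, x.1 1 = 0 → J ε δ x = J ε δ' x
  congr_neg : ∀ ε δ x, x.1 2 = 0 → J ε δ x = J (-ε) (-δ) x

namespace QuadrantHomeos

variable (H : QuadrantHomeos) {m : ℕ}

/-- The value of the glued map on a quadrant. -/
noncomputable def piece (m : ℕ) (ε δ : ℤˣ) (v : upperOctahedron) : ℝ × ℝ :=
  reflect ε δ (m * (H.J ε δ (foldPoint v)).1 0, m * (H.J ε δ (foldPoint v)).1 1)

/-- The glued map. -/
noncomputable def glue (m : ℕ) (v : upperOctahedron) : ℝ × ℝ :=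
  H.piece m (signUnit (v.1 0)) (signUnit (v.1 1)) v

variable {H}

/-- `signUnit` picks 1 at zero, but the choice is immaterial: where a coordinate vanishes the
homeomorphisms of the adjacent quadrants agree, and the coordinate of the image that is reflected
vanishes too. -/
lemma glue_eq_piece {ε δ : ℤˣ} {v : upperOctahedron} (h0 : 0 ≤ ((ε : ℤ) : ℝ) * v.1 0)
    (h1 : 0 ≤ ((δ : ℤ) : ℝ) * v.1 1) : H.glue m v = H.piece m ε δ v := by
  have step0 : ∀ ε' δ' : ℤˣ, 0 ≤ ((ε' : ℤ) : ℝ) * v.1 0 → H.piece m ε' δ' v = H.piece m ε δ' v := by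
    intro ε' δ' h
    by_cases hv : v.1 0 = 0
    · have hx : (foldPoint v).1 0 = 0 := by change |v.1 0| = 0; rw [hv, abs_zero]
      have hz := (H.eq_zero_iff ε δ' _ _).2 hx
      unfold piece
      rw [H.congr_fst ε' ε δ' _ hx]
      simp [reflect, hz]
    · rw [unit_eq_of_mul_nonneg hv h h0]
  have step1 : ∀ ε' δ' : ℤˣ, 0 ≤ ((δ' : ℤ) : ℝ) * v.1 1 → H.piece m ε' δ' v = H.piece m ε' δ v := by
    intro ε' δ' h
    by_cases hv : v.1 1 = 0
    · have hx : (foldPoint v).1 1 = 0 := by change |v.1 1| = 0; rw [hv, abs_zero]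
      have hz := (H.eq_zero_iff ε' δ _ _).2 hx
      unfold piece
      rw [H.congr_snd ε' δ' δ _ hx]
      simp [reflect, hz]
    · rw [unit_eq_of_mul_nonneg hv h h1]
  rw [glue, step0 _ _ (signUnit_mul_nonneg _), step1 _ _ (signUnit_mul_nonneg _)]

lemma continuous_piece (ε δ : ℤˣ) : Continuous (H.piece m ε δ) := by
  have h : Continuous fun v => (H.J ε δ (foldPoint v)).1 :=
    continuous_subtype_val.comp ((H.J ε δ).continuous.comp continuous_foldPoint)
  unfold piece reflect
  have h0 := (continuous_apply 0).comp h
  have h1 := (continuous_apply 1).comp h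
  exact (continuous_const.mul (continuous_const.mul h0)).prodMk
    (continuous_const.mul (continuous_const.mul h1))

lemma continuous_glue : Continuous (H.glue m) := by
  let C : ℤˣ × ℤˣ → Set upperOctahedron := fun s =>
    {v | 0 ≤ ((s.1 : ℤ) : ℝ) * v.1 0 ∧ 0 ≤ ((s.2 : ℤ) : ℝ) * v.1 1}
  have c0 : Continuous fun v : upperOctahedron => v.1 0 :=
    (continuous_apply 0).comp continuous_subtype_val
  have c1 : Continuous fun v : upperOctahedron => v.1 1 :=
    (continuous_apply 1).comp continuous_subtype_val
  refine LocallyFinite.continuous (f := C) (locallyFinite_of_finite _) ?_ ?_ ?_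
  · refine Set.eq_univ_of_forall fun v => Set.mem_iUnion.2 ⟨(signUnit (v.1 0), signUnit (v.1 1)), ?_⟩
    exact ⟨signUnit_mul_nonneg _, signUnit_mul_nonneg _⟩
  · rintro ⟨ε, δ⟩
    exact (isClosed_le continuous_const (continuous_const.mul c0)).inter
      (isClosed_le continuous_const (continuous_const.mul c1))
  · rintro ⟨ε, δ⟩
    exact (continuous_piece ε δ).continuousOn.congr fun v hv => glue_eq_piece hv.1 hv.2

lemma piece_abs (ε δ : ℤˣ) (v : upperOctahedron) :
    |(H.piece m ε δ v).1| = m * (H.J ε δ (foldPoint v)).1 0 ∧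
      |(H.piece m ε δ v).2| = m * (H.J ε δ (foldPoint v)).1 1 := by
  have h := (H.J ε δ (foldPoint v)).2.1
  simp only [piece, reflect, abs_mul, abs_unit, one_mul, Nat.abs_cast, abs_of_nonneg (h 0),
    abs_of_nonneg (h 1), and_self]

lemma sum_piece_abs (ε δ : ℤˣ) (v : upperOctahedron) :
    |(H.piece m ε δ v).1| + |(H.piece m ε δ v).2| =
      m - m * (H.J ε δ (foldPoint v)).1 2 := by
  obtain ⟨h0, h1⟩ := piece_abs (H := H) (m := m) ε δ v
  have h := (H.J ε δ (foldPoint v)).2.2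
  rw [Fin.sum_univ_three] at h
  rw [h0, h1]
  linear_combination (m : ℝ) * h

lemma glue_mem (hm : 0 < m) (v : upperOctahedron) : H.glue m v ∈ square m := by
  rw [mem_square_iff hm, glue, sum_piece_abs]
  have := mul_nonneg (Nat.cast_nonneg m)
    ((H.J (signUnit (v.1 0)) (signUnit (v.1 1)) (foldPoint v)).2.1 2)
  linarith

lemma glue_boundary_iff (hm : 0 < m) (v : upperOctahedron) :
    |(H.glue m v).1| + |(H.glue m v).2| = m ↔ v.1 2 = 0 := by
  have hm' : (m : ℝ) ≠ 0 := by exact_mod_cast hm.ne'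
  rw [glue, sum_piece_abs, sub_eq_self, mul_eq_zero, or_iff_right hm', H.eq_zero_iff]
  rfl

/-- The image determines a closed quadrant containing v. Two points with equal image can therefore
be compared in one quadrant, which gives injectivity. -/
lemma glue_sign (hm : 0 < m) (v : upperOctahedron) :
    0 ≤ (H.glue m v).1 * v.1 0 ∧ ((H.glue m v).1 = 0 → v.1 0 = 0) ∧
    0 ≤ (H.glue m v).2 * v.1 1 ∧ ((H.glue m v).2 = 0 → v.1 1 = 0) := by
  have hm' : (m : ℝ) ≠ 0 := by exact_mod_cast hm.ne'
  obtain ⟨a0, a1⟩ := piece_abs (H := H) (m := m) (signUnit (v.1 0)) (signUnit (v.1 1)) v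
  have h := (H.J (signUnit (v.1 0)) (signUnit (v.1 1)) (foldPoint v)).2.1
  have s0 := signUnit_mul_nonneg (v.1 0)
  have s1 := signUnit_mul_nonneg (v.1 1)
  have hz := H.eq_zero_iff (signUnit (v.1 0)) (signUnit (v.1 1)) (foldPoint v)
  refine ⟨?_, fun h' => ?_, ?_, fun h' => ?_⟩
  · have := mul_nonneg (mul_nonneg (Nat.cast_nonneg m) (h 0)) s0
    simp only [glue, piece, reflect]
    linarith
  · change (H.piece m _ _ v).1 = 0 at h'
    rw [h', abs_zero, eq_comm, mul_eq_zero, or_iff_right hm', hz] at a0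
    exact abs_eq_zero.1 a0
  · have := mul_nonneg (mul_nonneg (Nat.cast_nonneg m) (h 1)) s1
    simp only [glue, piece, reflect]
    linarith
  · change (H.piece m _ _ v).2 = 0 at h'
    rw [h', abs_zero, eq_comm, mul_eq_zero, or_iff_right hm', hz] at a1
    exact abs_eq_zero.1 a1

lemma signUnit_mul_of_mul_nonneg {a b : ℝ} (h : 0 ≤ a * b) (h0 : a = 0 → b = 0) :
    0 ≤ ((signUnit a : ℤ) : ℝ) * b := by
  unfold signUnit
  split_ifs with ha
  · rcases ha.eq_or_lt with h1 | h1
    · simp [h0 h1.symm]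
    · simpa using nonneg_of_mul_nonneg_right h h1
  · push Not at ha
    have : b ≤ 0 := by nlinarith
    simpa using this

lemma glue_injective (hm : 0 < m) : Function.Injective (H.glue m) := by
  intro v v' h
  have hm' : (m : ℝ) ≠ 0 := by exact_mod_cast hm.ne'
  set p := H.glue m v with hp
  obtain ⟨a0, b0, a1, b1⟩ := glue_sign (H := H) hm v
  obtain ⟨a0', b0', a1', b1'⟩ := glue_sign (H := H) hm v'
  rw [← hp] at a0 b0 a1 b1
  rw [← h] at a0' b0' a1' b1'
  have e0 := signUnit_mul_of_mul_nonneg a0 b0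
  have e1 := signUnit_mul_of_mul_nonneg a1 b1
  have e0' := signUnit_mul_of_mul_nonneg a0' b0'
  have e1' := signUnit_mul_of_mul_nonneg a1' b1'
  have h1 : H.piece m (signUnit p.1) (signUnit p.2) v =
      H.piece m (signUnit p.1) (signUnit p.2) v' := by
    rw [← glue_eq_piece e0 e1, ← glue_eq_piece e0' e1', ← h]
  obtain ⟨c0, c1⟩ := piece_abs (H := H) (m := m) (signUnit p.1) (signUnit p.2) v
  obtain ⟨c0', c1'⟩ := piece_abs (H := H) (m := m) (signUnit p.1) (signUnit p.2) v'
  rw [h1, c0'] at c0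
  rw [h1, c1'] at c1
  have d0 := mul_left_cancel₀ hm' c0
  have d1 := mul_left_cancel₀ hm' c1
  have hJ : H.J (signUnit p.1) (signUnit p.2) (foldPoint v) =
      H.J (signUnit p.1) (signUnit p.2) (foldPoint v') := by
    have s := (H.J (signUnit p.1) (signUnit p.2) (foldPoint v)).2.2
    have s' := (H.J (signUnit p.1) (signUnit p.2) (foldPoint v')).2.2
    rw [Fin.sum_univ_three] at s s'
    refine Subtype.ext (funext fun i => ?_)
    fin_cases i
    · exact d0.symm
    · exact d1.symm
    · change (H.J (signUnit p.1) (signUnit p.2) (foldPoint v)).1 2 =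
        (H.J (signUnit p.1) (signUnit p.2) (foldPoint v')).1 2
      linarith
  have hf := (H.J _ _).injective hJ
  rw [← unfoldPoint_foldPoint e0 e1, ← unfoldPoint_foldPoint e0' e1', hf]

lemma glue_surjective (hm : 0 < m) {p : ℝ × ℝ} (hp : p ∈ square m) :
    ∃ v, H.glue m v = p := by
  have hm' : (m : ℝ) ≠ 0 := by exact_mod_cast hm.ne'
  have hq : simplexCoord m (|p.1|, |p.2|) ∈ stdSimplex ℝ (Fin 3) := by
    rw [simplexCoord_mem_iff hm, triangle_eq hm]
    exact ⟨abs_nonneg _, abs_nonneg _, (mem_square_iff hm).1 hp⟩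
  let x := (H.J (signUnit p.1) (signUnit p.2)).symm ⟨_, hq⟩
  obtain ⟨h0, h1⟩ := unfoldPoint_nonneg (signUnit p.1) (signUnit p.2) x
  refine ⟨unfoldPoint (signUnit p.1) (signUnit p.2) x, ?_⟩
  rw [glue_eq_piece h0 h1, piece, foldPoint_unfoldPoint, Homeomorph.apply_symm_apply]
  ext
  · change _ * (m * (|p.1| / m)) = p.1
    rw [mul_div_cancel₀ _ hm']; exact unit_mul_abs (signUnit_mul_nonneg _)
  · change _ * (m * (|p.2| / m)) = p.2
    rw [mul_div_cancel₀ _ hm']; exact unit_mul_abs (signUnit_mul_nonneg _)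

/-- The glued map is a homeomorphism from the upper half of the octahedron to the square. -/
noncomputable def glueHomeo (H : QuadrantHomeos) (hm : 0 < m) : upperOctahedron ≃ₜ square m :=
  haveI : CompactSpace upperOctahedron := isCompact_iff_compactSpace.1 isCompact_upperOctahedron
  Continuous.homeoOfEquivCompactToT2
    (f := Equiv.ofBijective (fun v => (⟨H.glue m v, glue_mem hm v⟩ : square m))
      ⟨fun _ _ h => glue_injective hm (congrArg Subtype.val h),
        fun p => by
          obtain ⟨v, hv⟩ := glue_surjective (H := H) hm p.2
          exact ⟨v, Subtype.ext hv⟩⟩)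
    (Continuous.subtype_mk continuous_glue _)

lemma coe_glueHomeo (hm : 0 < m) (v : upperOctahedron) : (H.glueHomeo hm v).1 = H.glue m v := rfl

/-- Antipodal points of the equator fold to the same point, at which the homeomorphisms of opposite
quadrants agree by `congr_neg`. -/
lemma glue_neg {v v' : upperOctahedron} (h : v'.1 = -v.1) (h2 : v.1 2 = 0) :
    H.glue m v' = -H.glue m v := by
  have h0 := signUnit_mul_nonneg (v.1 0)
  have h1 := signUnit_mul_nonneg (v.1 1)
  have hf : foldPoint v' = foldPoint v := by
    refine Subtype.ext (funext fun i => ?_)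
    fin_cases i
    · change |v'.1 0| = |v.1 0|; rw [h, Pi.neg_apply, abs_neg]
    · change |v'.1 1| = |v.1 1|; rw [h, Pi.neg_apply, abs_neg]
    · change v'.1 2 = v.1 2; rw [h, Pi.neg_apply, h2, neg_zero]
  rw [glue_eq_piece (ε := -signUnit (v.1 0)) (δ := -signUnit (v.1 1)) (by
      rw [h]; simpa using h0) (by rw [h]; simpa using h1), glue, piece, piece, hf,
    ← H.congr_neg _ _ _ (show (foldPoint v).1 2 = 0 from h2)]
  ext <;> simp [reflect]

end QuadrantHomeos

/-! ### The projective plane and its affine chart -/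

section ProjectivePlane

lemma continuous_projectivization_mk {X : Type*} [TopologicalSpace X] {f : X → Fin 3 → ℝ}
    (hf : Continuous f) (h : ∀ x, f x ≠ 0) :
    Continuous fun x => (Projectivization.mk ℝ (f x) (h x) : ℙ ℝ (Fin 3 → ℝ)) := by
  have h1 : Continuous (Quotient.mk (projectivizationSetoid ℝ (Fin 3 → ℝ))) := continuous_quot_mk
  exact h1.comp (hf.subtype_mk h)

/-- The orthogonal projection to the line spanned by a vector, as a matrix. -/
noncomputable def lineProjection (v : Fin 3 → ℝ) (i j : Fin 3) : ℝ := v i * v j / ∑ k, v k ^ 2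

lemma sum_sq_pos {v : Fin 3 → ℝ} (hv : v ≠ 0) : 0 < ∑ k, v k ^ 2 := by
  obtain ⟨i, hi⟩ := Function.ne_iff.1 hv
  exact Finset.sum_pos' (fun _ _ => sq_nonneg _)
    ⟨i, Finset.mem_univ _, lt_of_le_of_ne (sq_nonneg _) (Ne.symm (pow_ne_zero 2 hi))⟩

lemma lineProjection_smul {a : ℝ} (ha : a ≠ 0) (v : Fin 3 → ℝ) :
    lineProjection (a • v) = lineProjection v := by
  funext i j
  simp only [lineProjection, Pi.smul_apply, smul_eq_mul, mul_pow, ← Finset.mul_sum]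
  rw [show a * v i * (a * v j) = a ^ 2 * (v i * v j) by ring,
    mul_div_mul_left _ _ (pow_ne_zero 2 ha)]

lemma exists_smul_eq_of_lineProjection_eq {v w : Fin 3 → ℝ} (hv : v ≠ 0) (hw : w ≠ 0)
    (h : lineProjection v = lineProjection w) : ∃ a : ℝ, a • w = v := by
  obtain ⟨i, hi⟩ := Function.ne_iff.1 hv
  have hv' := sum_sq_pos hv
  have hw' := sum_sq_pos hw
  refine ⟨w i / (∑ k, w k ^ 2) * (∑ k, v k ^ 2) / v i, funext fun j => ?_⟩
  have h1 := congrFun (congrFun h i) j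
  simp only [lineProjection] at h1
  have hi' : v i ≠ 0 := hi
  simp only [Pi.smul_apply, smul_eq_mul]
  rw [div_eq_div_iff hv'.ne' hw'.ne'] at h1
  field_simp
  linarith

/-- Sending a line to the matrix of the orthogonal projection onto it is a continuous injection into
a Hausdorff space. -/
instance : T2Space (ℙ ℝ (Fin 3 → ℝ)) := by
  let g : {v : Fin 3 → ℝ // v ≠ 0} → Fin 3 → Fin 3 → ℝ := fun v => lineProjection v.1
  have hg : Continuous g := by
    refine continuous_pi fun i => continuous_pi fun j => ?_
    refine Continuous.div ?_ ?_ fun v => (sum_sq_pos v.2).ne'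
    · exact ((continuous_apply i).comp continuous_subtype_val).mul
        ((continuous_apply j).comp continuous_subtype_val)
    · exact continuous_finsetSum _ fun k _ =>
        ((continuous_apply k).comp continuous_subtype_val).pow 2
  let G : ℙ ℝ (Fin 3 → ℝ) → Fin 3 → Fin 3 → ℝ := Quotient.lift g (by
    rintro ⟨v, hv⟩ ⟨w, hw⟩ ⟨a, ha⟩
    have h1 : (a : ℝ) • w = v := ha
    simp only [g]
    rw [← h1, lineProjection_smul a.ne_zero])
  have hG : Continuous G := hg.quotient_lift _
  refine T2Space.of_injective_continuous (f := G) ?_ hG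
  intro P Q h
  induction P using Projectivization.ind with | h v hv
  induction Q using Projectivization.ind with | h w hw
  exact (Projectivization.mk_eq_mk_iff' ℝ v w hv hw).2
    (exists_smul_eq_of_lineProjection_eq hv hw h)

end ProjectivePlane

lemma ne_zero_of_mem_upperOctahedron (v : upperOctahedron) : v.1 ≠ 0 := by
  intro h
  have := v.2.1
  simp [h] at this

/-- The line spanned by a point of the octahedron. -/
noncomputable def spanPoint (v : upperOctahedron) : ℙ ℝ (Fin 3 → ℝ) :=
  Projectivization.mk ℝ v.1 (ne_zero_of_mem_upperOctahedron v)

lemma continuous_spanPoint : Continuous spanPoint :=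
  continuous_projectivization_mk continuous_subtype_val _

/-- Both vectors have ℓ¹-norm 1, so a scalar between them is ±1; the value -1 is possible only on
the equator, as both last coordinates are nonnegative. -/
lemma spanPoint_eq_iff {v v' : upperOctahedron} :
    spanPoint v = spanPoint v' ↔ v = v' ∨ (v'.1 = -v.1 ∧ v.1 2 = 0) := by
  rw [spanPoint, spanPoint, Projectivization.mk_eq_mk_iff']
  constructor
  · rintro ⟨a, ha⟩
    obtain ⟨h1, h2⟩ := v.2
    obtain ⟨h1', h2'⟩ := v'.2
    have e : ∀ i, v.1 i = a * v'.1 i := fun i => by rw [← ha]; rfl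
    have hn : |a| * (|v'.1 0| + |v'.1 1| + |v'.1 2|) = |v.1 0| + |v.1 1| + |v.1 2| := by
      rw [e 0, e 1, e 2, abs_mul, abs_mul, abs_mul]; ring
    rw [abs_of_nonneg h2, abs_of_nonneg h2', h1, h1', mul_one] at hn
    rcases (abs_eq zero_le_one).1 hn with h | h
    · left
      refine Subtype.ext ?_
      rw [← ha, h, one_smul]
    · right
      have e2 := e 2
      rw [h] at e2
      refine ⟨?_, by linarith⟩
      rw [← ha, h, neg_one_smul, neg_neg]
  · rintro (h | ⟨h, -⟩)
    · exact ⟨1, by rw [one_smul, h]⟩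
    · exact ⟨-1, by rw [h]; simp⟩

lemma spanPoint_surjective : Function.Surjective spanPoint := by
  intro P
  induction P using Projectivization.ind with | h v hv
  have key : ∀ u : Fin 3 → ℝ, u ≠ 0 → 0 ≤ u 2 → ∃ w : upperOctahedron, ∃ r : ℝ, r • u = w.1 := by
    intro u hu h2
    have hs : 0 < |u 0| + |u 1| + u 2 := by
      refine lt_of_le_of_ne (by positivity) fun h => hu ?_
      have e0 : |u 0| = 0 := by linarith [abs_nonneg (u 0), abs_nonneg (u 1)]
      have e1 : |u 1| = 0 := by linarith [abs_nonneg (u 0), abs_nonneg (u 1)]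
      have e2 : u 2 = 0 := by linarith [abs_nonneg (u 0), abs_nonneg (u 1)]
      funext i
      fin_cases i
      · exact abs_eq_zero.1 e0
      · exact abs_eq_zero.1 e1
      · exact e2
    set r := (|u 0| + |u 1| + u 2)⁻¹ with hr
    have hr0 : 0 < r := inv_pos.2 hs
    refine ⟨⟨r • u, ?_, mul_nonneg hr0.le h2⟩, r, rfl⟩
    change |r * u 0| + |r * u 1| + r * u 2 = 1
    rw [abs_mul, abs_mul, abs_of_pos hr0, ← mul_add, ← mul_add, hr, inv_mul_cancel₀ hs.ne']
  rcases le_total 0 (v 2) with h | h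
  · obtain ⟨w, r, hr⟩ := key v hv h
    exact ⟨w, (Projectivization.mk_eq_mk_iff' ℝ _ _ _ _).2 ⟨r, hr⟩⟩
  · obtain ⟨w, r, hr⟩ := key (-v) (neg_ne_zero.2 hv) (by simpa using h)
    exact ⟨w, (Projectivization.mk_eq_mk_iff' ℝ _ _ _ _).2 ⟨-r, by rw [← hr]; simp⟩⟩

namespace QuadrantHomeos

variable (H : QuadrantHomeos) {m : ℕ}

/-- The map from the square to the projective plane. -/
noncomputable def toProjective (hm : 0 < m) (p : square m) : ℙ ℝ (Fin 3 → ℝ) :=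
  spanPoint ((H.glueHomeo hm).symm p)

variable {H}

lemma continuous_toProjective (hm : 0 < m) : Continuous (H.toProjective hm) :=
  continuous_spanPoint.comp (H.glueHomeo hm).symm.continuous

lemma toProjective_eq_iff (hm : 0 < m) (p q : square m) :
    H.toProjective hm p = H.toProjective hm q ↔ (gluing m) p q := by
  obtain ⟨v, rfl⟩ := (H.glueHomeo hm).surjective p
  obtain ⟨w, rfl⟩ := (H.glueHomeo hm).surjective q
  rw [toProjective, toProjective, Homeomorph.symm_apply_apply, Homeomorph.symm_apply_apply,
    spanPoint_eq_iff]
  change _ ↔ (H.glueHomeo hm v = H.glueHomeo hm w ∨ _)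
  rw [(H.glueHomeo hm).injective.eq_iff]
  refine or_congr_right ?_
  rw [mem_frontier_square_iff hm, mem_frontier_square_iff hm]
  simp only [coe_glueHomeo, glue_boundary_iff hm]
  constructor
  · rintro ⟨h, h2⟩
    exact ⟨h2, by rw [h, Pi.neg_apply, h2, neg_zero], glue_neg h h2⟩
  · rintro ⟨h, h', h2⟩
    refine ⟨?_, h⟩
    let u : upperOctahedron := ⟨-v.1, by
      have := v.2.1
      rw [h] at this
      refine ⟨?_, by simp [h]⟩
      simpa [h] using this⟩
    have hu : H.glue m u = -H.glue m v := glue_neg rfl h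
    have : u = w := glue_injective (H := H) hm (by rw [hu, h2])
    rw [← this]

/-- The homeomorphism from the glued square to the projective plane. -/
noncomputable def projectiveHomeo (H : QuadrantHomeos) (hm : 0 < m) :
    GluedSquare m ≃ₜ ℙ ℝ (Fin 3 → ℝ) :=
  haveI : CompactSpace (square m) := isCompact_iff_compactSpace.1 (isCompact_square hm)
  Continuous.homeoOfEquivCompactToT2
    (f := Equiv.ofBijective
      (Quotient.lift (H.toProjective hm) fun p q h => (toProjective_eq_iff hm p q).2 h)
      ⟨by
          intro P Q
          induction P, Q using Quotient.inductionOn₂ with | h p q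
          intro h
          exact Quotient.sound ((toProjective_eq_iff (H := H) hm p q).1 h),
        fun P => by
          obtain ⟨v, hv⟩ := spanPoint_surjective P
          refine ⟨Quotient.mk _ (H.glueHomeo hm v), ?_⟩
          change spanPoint ((H.glueHomeo hm).symm (H.glueHomeo hm v)) = P
          rw [Homeomorph.symm_apply_apply, hv]⟩)
    ((continuous_toProjective hm).quotient_lift _)

lemma glue_symm_pos (hm : 0 < m) {p : ℝ × ℝ} (hp : p ∈ interior (square m)) :
    0 < ((H.glueHomeo hm).symm ⟨p, interior_subset hp⟩).1 2 := by
  set v := (H.glueHomeo hm).symm ⟨p, interior_subset hp⟩ with hv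
  refine lt_of_le_of_ne v.2.2 fun h => ?_
  have h1 := (glue_boundary_iff (H := H) hm v).2 h.symm
  have h2 : H.glue m v = p := by
    rw [← coe_glueHomeo hm, hv, Homeomorph.apply_symm_apply]
  rw [h2] at h1
  exact ((mem_interior_square_iff hm).1 hp).ne h1

/-- The point of the octahedron over a point of the affine plane. -/
noncomputable def affinePoint (q : ℝ × ℝ) : upperOctahedron :=
  ⟨![q.1 / (1 + |q.1| + |q.2|), q.2 / (1 + |q.1| + |q.2|), 1 / (1 + |q.1| + |q.2|)], by
    have h : 0 < 1 + |q.1| + |q.2| := by positivity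
    refine ⟨?_, (div_pos one_pos h).le⟩
    change |q.1 / (1 + |q.1| + |q.2|)| + |q.2 / (1 + |q.1| + |q.2|)| + 1 / (1 + |q.1| + |q.2|) = 1
    rw [abs_div, abs_div, abs_of_pos h]
    field_simp
    ring⟩

lemma continuous_affinePoint : Continuous affinePoint := by
  have h : ∀ q : ℝ × ℝ, 1 + |q.1| + |q.2| ≠ 0 := fun q => by positivity
  refine Continuous.subtype_mk (continuous_pi fun i => ?_) _
  fin_cases i
  · exact Continuous.div (by fun_prop) (by fun_prop) h
  · exact Continuous.div (by fun_prop) (by fun_prop) h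
  · exact Continuous.div (by fun_prop) (by fun_prop) h

lemma affinePoint_pos (q : ℝ × ℝ) : 0 < (affinePoint q).1 2 := by
  change 0 < 1 / (1 + |q.1| + |q.2|)
  positivity

lemma affinePoint_div {v : upperOctahedron} (hv : 0 < v.1 2) :
    affinePoint (v.1 0 / v.1 2, v.1 1 / v.1 2) = v := by
  have h := v.2.1
  have e : 1 + |v.1 0 / v.1 2| + |v.1 1 / v.1 2| = 1 / v.1 2 := by
    rw [abs_div, abs_div, abs_of_pos hv]
    field_simp
    linarith
  refine Subtype.ext (funext fun i => ?_)
  fin_cases i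
  · change v.1 0 / v.1 2 / (1 + |v.1 0 / v.1 2| + |v.1 1 / v.1 2|) = v.1 0
    rw [e]; field_simp
  · change v.1 1 / v.1 2 / (1 + |v.1 0 / v.1 2| + |v.1 1 / v.1 2|) = v.1 1
    rw [e]; field_simp
  · change 1 / (1 + |v.1 0 / v.1 2| + |v.1 1 / v.1 2|) = v.1 2
    rw [e]; field_simp

lemma div_affinePoint (q : ℝ × ℝ) :
    ((affinePoint q).1 0 / (affinePoint q).1 2, (affinePoint q).1 1 / (affinePoint q).1 2) = q := by
  have h : 1 + |q.1| + |q.2| ≠ 0 := by positivity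
  ext
  · change q.1 / (1 + |q.1| + |q.2|) / (1 / (1 + |q.1| + |q.2|)) = q.1
    field_simp
  · change q.2 / (1 + |q.1| + |q.2|) / (1 / (1 + |q.1| + |q.2|)) = q.2
    field_simp

lemma spanPoint_affinePoint (q : ℝ × ℝ) : spanPoint (affinePoint q) = affineChart q := by
  rw [spanPoint, affineChart, Projectivization.mk_eq_mk_iff']
  refine ⟨1 / (1 + |q.1| + |q.2|), funext fun i => ?_⟩
  fin_cases i
  · change 1 / (1 + |q.1| + |q.2|) * q.1 = q.1 / (1 + |q.1| + |q.2|)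
    ring
  · change 1 / (1 + |q.1| + |q.2|) * q.2 = q.2 / (1 + |q.1| + |q.2|)
    ring
  · change 1 / (1 + |q.1| + |q.2|) * 1 = 1 / (1 + |q.1| + |q.2|)
    ring

lemma glue_mem_interior (hm : 0 < m) {v : upperOctahedron} (hv : 0 < v.1 2) :
    H.glue m v ∈ interior (square m) := by
  rw [mem_interior_square_iff hm]
  refine lt_of_le_of_ne ((mem_square_iff hm).1 (glue_mem hm v)) fun h => ?_
  exact hv.ne' ((glue_boundary_iff hm v).1 h)

/-- The homeomorphism from the interior of the square to the affine plane. -/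
noncomputable def affineHomeo (H : QuadrantHomeos) (hm : 0 < m) :
    interior (square m) ≃ₜ ℝ × ℝ where
  toFun p :=
    (((H.glueHomeo hm).symm ⟨p, interior_subset p.2⟩).1 0 /
        ((H.glueHomeo hm).symm ⟨p, interior_subset p.2⟩).1 2,
      ((H.glueHomeo hm).symm ⟨p, interior_subset p.2⟩).1 1 /
        ((H.glueHomeo hm).symm ⟨p, interior_subset p.2⟩).1 2)
  invFun q := ⟨H.glue m (affinePoint q), glue_mem_interior hm (affinePoint_pos q)⟩
  left_inv p := by
    refine Subtype.ext ?_
    dsimp only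
    rw [affinePoint_div (glue_symm_pos hm p.2), ← coe_glueHomeo hm, Homeomorph.apply_symm_apply]
  right_inv q := by
    have : (H.glueHomeo hm).symm ⟨H.glue m (affinePoint q),
        interior_subset (glue_mem_interior hm (affinePoint_pos q))⟩ = affinePoint q :=
      (H.glueHomeo hm).symm_apply_apply (affinePoint q)
    dsimp only
    rw [this, div_affinePoint]
  continuous_toFun := by
    have h : Continuous fun p : interior (square m) =>
        ((H.glueHomeo hm).symm ⟨p, interior_subset p.2⟩).1 :=
      continuous_subtype_val.comp ((H.glueHomeo hm).symm.continuous.comp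
        (continuous_subtype_val.subtype_mk _))
    have h2 : ∀ p : interior (square m),
        ((H.glueHomeo hm).symm ⟨p, interior_subset p.2⟩).1 2 ≠ 0 :=
      fun p => (glue_symm_pos hm p.2).ne'
    exact (((continuous_apply 0).comp h).div ((continuous_apply 2).comp h) h2).prodMk
      (((continuous_apply 1).comp h).div ((continuous_apply 2).comp h) h2)
  continuous_invFun :=
    Continuous.subtype_mk (continuous_glue.comp continuous_affinePoint) _

lemma affinePoint_affineHomeo (hm : 0 < m) (p : interior (square m)) :
    affinePoint (H.affineHomeo hm p) = (H.glueHomeo hm).symm ⟨p, interior_subset p.2⟩ :=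
  affinePoint_div (glue_symm_pos hm p.2)

lemma affineChart_affineHomeo (hm : 0 < m) (p : interior (square m)) :
    affineChart (H.affineHomeo hm p) = H.toProjective hm ⟨p, interior_subset p.2⟩ := by
  rw [← spanPoint_affinePoint, affinePoint_affineHomeo, toProjective]

end QuadrantHomeos

/-! ### The patchwork polynomial and its homogenization -/

section Polynomial

variable {m : ℕ} {τ : Geometry.SimplicialComplex ℝ (ℝ × ℝ)} {ν : ℝ × ℝ → ℝ}
  {σ : ℕ → ℕ → ℤˣ} {t : ℝ}

/-- The coefficients of the patchwork polynomial. -/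
noncomputable def signedCoeff (ν : ℝ × ℝ → ℝ) (σ : ℕ → ℕ → ℤˣ) (t : ℝ) (a : ℕ × ℕ) : ℝ :=
  ((σ a.1 a.2 : ℤ) : ℝ) * t ^ ν (natPoint a)

/-- A pair of exponents as a finitely supported function. -/
noncomputable def exponent (a : ℕ × ℕ) : Fin 2 →₀ ℕ := Finsupp.single 0 a.1 + Finsupp.single 1 a.2

lemma exponent_zero (a : ℕ × ℕ) : exponent a 0 = a.1 := by simp [exponent]

lemma exponent_one (a : ℕ × ℕ) : exponent a 1 = a.2 := by simp [exponent]

lemma exponent_injective : Function.Injective exponent := fun a b h =>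
  Prod.ext (by rw [← exponent_zero, h, exponent_zero]) (by rw [← exponent_one, h, exponent_one])

lemma patchworkPolynomial_eq : patchworkPolynomial m τ ν σ t =
    ∑ a ∈ vertexSet m τ, MvPolynomial.monomial (exponent a) (signedCoeff ν σ t a) := by
  unfold patchworkPolynomial vertexSet
  refine Finset.sum_congr rfl fun a _ => ?_
  rw [MvPolynomial.monomial_eq, mul_assoc, exponent, Finsupp.prod_add_index', Finsupp.prod_single_index,
    Finsupp.prod_single_index]
  · rfl
  · simp
  · simp
  · simp
  · intros; rw [pow_add]

open Classical in
lemma coeff_patchworkPolynomial (e : Fin 2 →₀ ℕ) :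
    (patchworkPolynomial m τ ν σ t).coeff e =
      ∑ a ∈ vertexSet m τ, if exponent a = e then signedCoeff ν σ t a else 0 := by
  rw [patchworkPolynomial_eq, MvPolynomial.coeff_sum]
  exact Finset.sum_congr rfl fun a _ => MvPolynomial.coeff_monomial _ _ _

lemma coeff_exponent {a : ℕ × ℕ} (ha : a ∈ vertexSet m τ) :
    (patchworkPolynomial m τ ν σ t).coeff (exponent a) = signedCoeff ν σ t a := by
  classical
  rw [coeff_patchworkPolynomial, Finset.sum_eq_single a, if_pos rfl]
  · intro b _ hb
    rw [if_neg fun h => hb (exponent_injective h)]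
  · exact fun h => (h ha).elim

lemma signedCoeff_ne_zero (ht : 0 < t) (a : ℕ × ℕ) : signedCoeff ν σ t a ≠ 0 :=
  mul_ne_zero (by simp) (Real.rpow_pos_of_pos ht _).ne'

lemma support_subset : ∀ e ∈ (patchworkPolynomial m τ ν σ t).support,
    ∃ a ∈ vertexSet m τ, exponent a = e := by
  classical
  intro e he
  rw [MvPolynomial.mem_support_iff, coeff_patchworkPolynomial] at he
  obtain ⟨a, ha, h⟩ := Finset.exists_ne_zero_of_sum_ne_zero he
  exact ⟨a, ha, by by_contra hne; exact h (if_neg hne)⟩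

lemma degree_exponent (a : ℕ × ℕ) : (exponent a).sum (fun _ n => n) = a.1 + a.2 := by
  rw [exponent, Finsupp.sum_add_index', Finsupp.sum_single_index, Finsupp.sum_single_index] <;>
    simp

/-- The corner (m, 0) is always a vertex and its coefficient is nonzero. Hence homogenization gives
the monomials of `vertexFamily`. -/
lemma totalDegree_patchworkPolynomial (hm : 0 < m) (hτ : IsLatticeTriangulation m τ)
    (ht : 0 < t) : (patchworkPolynomial m τ ν σ t).totalDegree = m := by
  apply le_antisymm
  · refine Finset.sup_le fun e he => ?_
    obtain ⟨a, ha, rfl⟩ := support_subset e he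
    rw [degree_exponent]
    exact add_le_of_mem_vertexSet hm hτ ha
  · obtain ⟨a, ha⟩ := exists_corner hm hτ 0
    have h0 : a.1.1 = m := by simpa using ha 0
    have h1 : a.1.2 = 0 := by simpa using ha 1
    have := MvPolynomial.le_totalDegree (p := patchworkPolynomial m τ ν σ t) (s := exponent a.1) (by
      rw [MvPolynomial.mem_support_iff, coeff_exponent a.2]
      exact signedCoeff_ne_zero ht _)
    rw [degree_exponent, h0, h1] at this
    exact this

lemma eval_homogenization (hm : 0 < m) (hτ : IsLatticeTriangulation m τ) (ht : 0 < t)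
    (v : Fin 3 → ℝ) : MvPolynomial.eval v (homogenization (patchworkPolynomial m τ ν σ t)) =
      (vertexFamily hm hτ).poly (fun a => signedCoeff ν σ t a) v := by
  classical
  rw [homogenization, totalDegree_patchworkPolynomial hm hτ ht, map_sum]
  simp only [map_mul, map_pow, MvPolynomial.eval_C, MvPolynomial.eval_X]
  have h1 : ∀ g : (Fin 2 →₀ ℕ) → ℝ, ∑ e ∈ (patchworkPolynomial m τ ν σ t).support,
      (patchworkPolynomial m τ ν σ t).coeff e * g e =
      ∑ a : Vertex m τ, signedCoeff ν σ t a * g (exponent a) := by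
    intro g
    have h2 : (patchworkPolynomial m τ ν σ t).support ⊆ (vertexSet m τ).image exponent :=
      fun e he => by
        obtain ⟨a, ha, rfl⟩ := support_subset e he
        exact Finset.mem_image_of_mem _ ha
    rw [Finset.sum_subset h2 fun e _ he => by
      rw [MvPolynomial.notMem_support_iff.1 he, zero_mul],
      Finset.sum_image exponent_injective.injOn,
      Finset.sum_coe_sort (vertexSet m τ) (fun a => signedCoeff ν σ t a * g (exponent a))]
    exact Finset.sum_congr rfl fun a ha => by rw [coeff_exponent ha]
  simp only [mul_assoc]
  rw [h1, MonomialFamily.poly]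
  refine Finset.sum_congr rfl fun a _ => ?_
  rw [Fin.prod_univ_three, exponent_zero, exponent_one, ← mul_assoc (v 0 ^ _)]
  rfl

lemma eval_patchworkPolynomial (hm : 0 < m) (hτ : IsLatticeTriangulation m τ) (q : ℝ × ℝ) :
    MvPolynomial.eval ![q.1, q.2] (patchworkPolynomial m τ ν σ t) =
      (vertexFamily hm hτ).poly (fun a => signedCoeff ν σ t a) ![q.1, q.2, 1] := by
  rw [patchworkPolynomial, map_sum, MonomialFamily.poly,
    ← Finset.sum_coe_sort]
  refine Finset.sum_congr rfl fun a _ => ?_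
  simp only [map_mul, map_pow, MvPolynomial.eval_C, MvPolynomial.eval_X]
  rw [Fin.prod_univ_three, mul_assoc]
  change _ = signedCoeff ν σ t a.1 * (q.1 ^ a.1.1 * q.2 ^ a.1.2 * 1 ^ _)
  rw [one_pow, mul_one]
  rfl

lemma spanPoint_mem_projectiveCurve_iff (hm : 0 < m) (hτ : IsLatticeTriangulation m τ)
    (ht : 0 < t) (v : upperOctahedron) :
    spanPoint v ∈ projectiveCurve (patchworkPolynomial m τ ν σ t) ↔
      (vertexFamily hm hτ).poly (fun a => signedCoeff ν σ t a) v.1 = 0 := by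
  constructor
  · rintro ⟨u, hu, h, h0⟩
    rw [spanPoint, Projectivization.mk_eq_mk_iff'] at h
    obtain ⟨r, hr⟩ := h
    rw [eval_homogenization hm hτ ht] at h0
    rw [← hr]
    exact (MonomialFamily.poly_smul r).trans (by rw [h0, mul_zero])
  · intro h
    exact ⟨v.1, ne_zero_of_mem_upperOctahedron v, rfl, by rwa [eval_homogenization hm hτ ht]⟩

lemma mem_affineCurve_iff (hm : 0 < m) (hτ : IsLatticeTriangulation m τ) (q : ℝ × ℝ) :
    q ∈ affineCurve (patchworkPolynomial m τ ν σ t) ↔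
      (vertexFamily hm hτ).poly (fun a => signedCoeff ν σ t a)
        (QuadrantHomeos.affinePoint q).1 = 0 := by
  have h : (QuadrantHomeos.affinePoint q).1 =
      fun i => (1 / (1 + |q.1| + |q.2|)) * ![q.1, q.2, 1] i := by
    funext i
    fin_cases i
    · change q.1 / (1 + |q.1| + |q.2|) = 1 / (1 + |q.1| + |q.2|) * q.1
      ring
    · change q.2 / (1 + |q.1| + |q.2|) = 1 / (1 + |q.1| + |q.2|) * q.2
      ring
    · change 1 / (1 + |q.1| + |q.2|) = 1 / (1 + |q.1| + |q.2|) * 1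
      ring
  have h0 : (1 / (1 + |q.1| + |q.2|)) ≠ 0 := by positivity
  rw [h, MonomialFamily.poly_smul, mul_eq_zero, or_iff_right (pow_ne_zero _ h0),
    ← eval_patchworkPolynomial]
  rfl

end Polynomial

/-! ### Signs in the quadrants and the midlines -/

section Signs

variable {m : ℕ} {τ : Geometry.SimplicialComplex ℝ (ℝ × ℝ)} {ν : ℝ × ℝ → ℝ}
  {σ : ℕ → ℕ → ℤˣ}

/-- The distribution of signs in a quadrant, transferred to the first quadrant. -/
def quadrantSign (σ : ℕ → ℕ → ℤˣ) (ε δ : ℤˣ) (a : ℕ × ℕ) : ℤˣ := σ a.1 a.2 * ε ^ a.1 * δ ^ a.2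

lemma extendedSign_eq_quadrantSign (ε δ : ℤˣ) (a : ℕ × ℕ) :
    extendedSign σ ((ε : ℤ) * a.1, (δ : ℤ) * a.2) = quadrantSign σ ε δ a := by
  have h := extendedSign_rule σ a.1 a.2 ε δ
  have h1 : ∀ x y z w : ℤˣ, x * y * z * w = 1 → y = x * z * w := by decide
  exact h1 _ _ _ _ h

lemma latticePoint_eq_reflect (ε δ : ℤˣ) (a : ℕ × ℕ) :
    latticePoint ((ε : ℤ) * a.1, (δ : ℤ) * a.2) = reflect ε δ (natPoint a) := by
  simp [latticePoint, reflect, natPoint]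

lemma reflect_reflect (ε δ : ℤˣ) (p : ℝ × ℝ) : reflect ε δ (reflect ε δ p) = p := by
  ext
  · simp only [reflect]; rw [← mul_assoc, unit_mul_self, one_mul]
  · simp only [reflect]; rw [← mul_assoc, unit_mul_self, one_mul]

lemma reflect_injective (ε δ : ℤˣ) : Function.Injective (reflect ε δ) :=
  Function.LeftInverse.injective (reflect_reflect ε δ)

lemma latticePoint_injective : Function.Injective latticePoint := by
  rintro ⟨a, b⟩ ⟨c, d⟩ h
  simpa [latticePoint] using h

/-- The midlines in terms of the vertices in the first quadrant. -/
lemma mem_affineMidlines_iff (hm : 0 < m) (hτ : IsLatticeTriangulation m τ) {p : ℝ × ℝ} :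
    p ∈ affineMidlines τ σ ↔ ∃ (ε δ : ℤˣ) (a b c : Vertex m τ), a ≠ b ∧ a ≠ c ∧ b ≠ c ∧
      ({a, b, c} : Finset (Vertex m τ)).map vertexPoint ∈ τ.faces ∧
      quadrantSign σ ε δ a ≠ quadrantSign σ ε δ b ∧
      quadrantSign σ ε δ a ≠ quadrantSign σ ε δ c ∧
      p ∈ segment ℝ (midpoint ℝ (reflect ε δ (vertexPoint a)) (reflect ε δ (vertexPoint b)))
        (midpoint ℝ (reflect ε δ (vertexPoint a)) (reflect ε δ (vertexPoint c))) := by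
  classical
  constructor
  · rintro ⟨a, b, c, hab, hac, hbc, ⟨F, ⟨ε, δ, T, hT, hF⟩, hFabc⟩, hsab, hsac, hp⟩
    have key : ∀ x ∈ ({latticePoint a, latticePoint b, latticePoint c} : Set (ℝ × ℝ)),
        ∃ u : Vertex m τ, reflect ε δ (vertexPoint u) = x := by
      intro x hx
      rw [← hFabc, hF] at hx
      obtain ⟨y, hy, rfl⟩ := hx
      obtain ⟨u, hu, rfl⟩ := (mem_vertices_iff hm hτ).1 (mem_vertices_of_mem_face hT hy)
      exact ⟨⟨u, hu⟩, rfl⟩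
    obtain ⟨a', ha'⟩ := key (latticePoint a) (by simp)
    obtain ⟨b', hb'⟩ := key (latticePoint b) (by simp)
    obtain ⟨c', hc'⟩ := key (latticePoint c) (by simp)
    have hs : ∀ (x : ℤ × ℤ) (u : Vertex m τ), reflect ε δ (vertexPoint u) = latticePoint x →
        extendedSign σ x = quadrantSign σ ε δ u := by
      intro x u h
      have h1 : reflect ε δ (vertexPoint u) =
        latticePoint ((ε : ℤ) * u.1.1, (δ : ℤ) * u.1.2) := (latticePoint_eq_reflect ε δ u.1).symm
      rw [← extendedSign_eq_quadrantSign, latticePoint_injective (h1.symm.trans h)]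
    refine ⟨ε, δ, a', b', c', ?_, ?_, ?_, ?_, ?_, ?_, ?_⟩
    · rintro rfl; exact hab (latticePoint_injective (ha'.symm.trans hb'))
    · rintro rfl; exact hac (latticePoint_injective (ha'.symm.trans hc'))
    · rintro rfl; exact hbc (latticePoint_injective (hb'.symm.trans hc'))
    · have : ({a', b', c'} : Finset (Vertex m τ)).map vertexPoint = T := by
        apply Finset.coe_injective
        apply (reflect_injective ε δ).image_injective
        rw [← hF, hFabc, ← ha', ← hb', ← hc']
        simp [Set.image_insert_eq]
      rw [this]; exact hT
    · rwa [← hs a a' ha', ← hs b b' hb']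
    · rwa [← hs a a' ha', ← hs c c' hc']
    · rwa [ha', hb', hc']
  · rintro ⟨ε, δ, a, b, c, hab, hac, hbc, hT, hsab, hsac, hp⟩
    have hl : ∀ u : Vertex m τ, latticePoint ((ε : ℤ) * u.1.1, (δ : ℤ) * u.1.2) =
      reflect ε δ (vertexPoint u) := fun u => latticePoint_eq_reflect ε δ u.1
    have hne : ∀ u v : Vertex m τ, u ≠ v →
        (((ε : ℤ) * u.1.1, (δ : ℤ) * u.1.2) : ℤ × ℤ) ≠ ((ε : ℤ) * v.1.1, (δ : ℤ) * v.1.2) := by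
      intro u v huv h
      refine huv (vertexPoint.injective (reflect_injective ε δ ?_))
      rw [← hl, ← hl, h]
    refine ⟨_, _, _, hne a b hab, hne a c hac, hne b c hbc,
      ⟨(({a, b, c} : Finset (Vertex m τ)).map vertexPoint).image (reflect ε δ),
        ⟨ε, δ, _, hT, Finset.coe_image⟩, ?_⟩, ?_, ?_, ?_⟩
    · rw [hl, hl, hl]
      simp
    · rwa [extendedSign_eq_quadrantSign, extendedSign_eq_quadrantSign]
    · rwa [extendedSign_eq_quadrantSign, extendedSign_eq_quadrantSign]
    · rwa [hl, hl, hl]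

/-- Three weights at given vertices. -/
noncomputable def threeWeights {ι : Type*} [DecidableEq ι] (a b c : ι) (x y z : ℝ) : ι → ℝ :=
  Pi.single a x + Pi.single b y + Pi.single c z

section ThreeWeights

variable {ι : Type*} [DecidableEq ι] [Fintype ι] {a b c : ι} {x y z : ℝ}

lemma sum_threeWeights_smul {E : Type*} [AddCommGroup E] [Module ℝ E] (g : ι → E) :
    ∑ e, threeWeights a b c x y z e • g e = x • g a + y • g b + z • g c := by
  have h : ∀ (a : ι) (x : ℝ), ∑ e, (Pi.single a x : ι → ℝ) e • g e = x • g a := fun a x => by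
    rw [Finset.sum_eq_single a]
    · rw [Pi.single_eq_same]
    · intro b _ hb
      rw [Pi.single_eq_of_ne hb, zero_smul]
    · simp
  simp only [threeWeights, Pi.add_apply, add_smul, Finset.sum_add_distrib, h]

lemma sum_threeWeights : ∑ e, threeWeights a b c x y z e = x + y + z := by
  have := sum_threeWeights_smul (a := a) (b := b) (c := c) (x := x) (y := y) (z := z)
    (fun _ => (1 : ℝ))
  simpa using this

lemma threeWeights_eq_zero {e : ι} (he : e ∉ ({a, b, c} : Finset ι)) :
    threeWeights a b c x y z e = 0 := by
  simp only [Finset.mem_insert, Finset.mem_singleton, not_or] at he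
  simp [threeWeights, Pi.single_eq_of_ne he.1, Pi.single_eq_of_ne he.2.1,
    Pi.single_eq_of_ne he.2.2]

lemma threeWeights_mem (hx : 0 ≤ x) (hy : 0 ≤ y) (hz : 0 ≤ z) (h : x + y + z = 1) :
    threeWeights a b c x y z ∈ stdSimplex ℝ ι := by
  refine ⟨fun e => ?_, by rw [sum_threeWeights, h]⟩
  have h : ∀ (a : ι) (x : ℝ), 0 ≤ x → 0 ≤ (Pi.single a x : ι → ℝ) e := fun a x hx => by
    rw [Pi.single_apply]; split_ifs <;> simp [hx]
  exact add_nonneg (add_nonneg (h _ _ hx) (h _ _ hy)) (h _ _ hz)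

end ThreeWeights

lemma add_midpoints_eq (ε δ : ℤˣ) (A B C : ℝ × ℝ) {r s : ℝ} (h : r + s = 1) :
    r • midpoint ℝ (reflect ε δ A) (reflect ε δ B) + s • midpoint ℝ (reflect ε δ A) (reflect ε δ C) =
      reflect ε δ ((1 / 2 : ℝ) • A + (r / 2) • B + (s / 2) • C) := by
  obtain rfl : s = 1 - r := by linarith
  ext <;> simp [midpoint_eq_smul_add, reflect] <;> ring

lemma units_eq_neg_of_ne {x y : ℤˣ} (h : x ≠ y) : y = -x := by
  revert x y; decide

/-- A point of the segment lies on a midline if and only if the sign function vanishes. -/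
lemma reflect_mem_affineMidlines_iff (hm : 0 < m) (hτ : IsLatticeTriangulation m τ) {ε δ : ℤˣ}
    {U : Finset (Vertex m τ)} (hU : U ∈ triangles m τ) {w : Vertex m τ → ℝ}
    (hw : w ∈ stdSimplex ℝ (Vertex m τ)) (hwU : ∀ a ∉ U, w a = 0) :
    reflect ε δ (∑ a, w a • vertexPoint a) ∈ affineMidlines τ σ ↔
      ∑ a : Vertex m τ, ((quadrantSign σ ε δ a : ℤ) : ℝ) * w a = 0 := by
  classical
  rw [mem_affineMidlines_iff hm hτ]
  constructor
  · rintro ⟨ε', δ', a, b, c, hab, hac, hbc, hT, hsab, hsac, r, s, hr, hs, hrs, hp⟩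
    rw [add_midpoints_eq ε' δ' _ _ _ hrs, ← sum_threeWeights_smul] at hp
    set w' := threeWeights a b c (1 / 2) (r / 2) (s / 2) with hw'def
    have hw' : w' ∈ stdSimplex ℝ (Vertex m τ) :=
      threeWeights_mem (by norm_num) (by linarith) (by linarith) (by linarith)
    have hnn : ∀ u ∈ stdSimplex ℝ (Vertex m τ), 0 ≤ (∑ a, u a • (vertexPoint a : ℝ × ℝ)).1 ∧
        0 ≤ (∑ a, u a • (vertexPoint a : ℝ × ℝ)).2 := by
      intro u hu
      rw [Prod.fst_sum, Prod.snd_sum]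
      exact ⟨Finset.sum_nonneg fun a _ => mul_nonneg (hu.1 a) (Nat.cast_nonneg _),
        Finset.sum_nonneg fun a _ => mul_nonneg (hu.1 a) (Nat.cast_nonneg _)⟩
    have hp1 : ((ε' : ℤ) : ℝ) * (∑ a, w' a • (vertexPoint a : ℝ × ℝ)).1 =
      ((ε : ℤ) : ℝ) * (∑ a, w a • (vertexPoint a : ℝ × ℝ)).1 := congrArg Prod.fst hp
    have hp2 : ((δ' : ℤ) : ℝ) * (∑ a, w' a • (vertexPoint a : ℝ × ℝ)).2 =
      ((δ : ℤ) : ℝ) * (∑ a, w a • (vertexPoint a : ℝ × ℝ)).2 := congrArg Prod.snd hp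
    -- The midline may come from another quadrant when the point lies on an axis. Absolute values
    -- identify the folded points, and then the weights.
    have hq1 : (∑ a, w' a • (vertexPoint a : ℝ × ℝ)).1 = (∑ a, w a • (vertexPoint a : ℝ × ℝ)).1 := by
      have := congrArg abs hp1
      rwa [abs_mul, abs_mul, abs_unit, abs_unit, one_mul, one_mul, abs_of_nonneg (hnn w' hw').1,
        abs_of_nonneg (hnn w hw).1] at this
    have hq2 : (∑ a, w' a • (vertexPoint a : ℝ × ℝ)).2 = (∑ a, w a • (vertexPoint a : ℝ × ℝ)).2 := by
      have := congrArg abs hp2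
      rwa [abs_mul, abs_mul, abs_unit, abs_unit, one_mul, one_mul, abs_of_nonneg (hnn w' hw').2,
        abs_of_nonneg (hnn w hw).2] at this
    have hww' : w' = w := weights_unique hT hU.1 hw' hw
      (fun e he => threeWeights_eq_zero he) hwU (Prod.ext hq1 hq2)
    have hsum : ∑ a : Vertex m τ, ((quadrantSign σ ε' δ' a : ℤ) : ℝ) * w a = 0 := by
      have h1 := sum_threeWeights_smul (a := a) (b := b) (c := c) (x := 1 / 2) (y := r / 2)
        (z := s / 2) (fun a : Vertex m τ => ((quadrantSign σ ε' δ' a : ℤ) : ℝ))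
      rw [← hw'def, hww', units_eq_neg_of_ne hsab, units_eq_neg_of_ne hsac] at h1
      simp only [smul_eq_mul] at h1
      rw [Finset.sum_congr rfl fun a _ => mul_comm _ _, h1]
      push_cast
      linear_combination (-((quadrantSign σ ε' δ' a : ℤ) : ℝ) / 2) * hrs
    rw [← hsum]
    -- If the two quadrants differ in one sign, the point lies on the corresponding axis, so all
    -- vertices in its support have that coordinate 0 and the signs there agree.
    refine Finset.sum_congr rfl fun e _ => ?_
    by_cases he : w e = 0
    · rw [he, mul_zero, mul_zero]
    have hz : ∀ (f : Vertex m τ → ℕ), ∑ a, w a * (f a : ℝ) = 0 → f e = 0 := by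
      intro f hf
      have := (Finset.sum_eq_zero_iff_of_nonneg
        (fun a _ => mul_nonneg (hw.1 a) (Nat.cast_nonneg (f a)))).1 hf e (Finset.mem_univ e)
      exact_mod_cast (mul_eq_zero.1 this).resolve_left he
    have e1 : ε ^ e.1.1 = ε' ^ e.1.1 := by
      by_cases hx : (∑ a, w a • (vertexPoint a : ℝ × ℝ)).1 = 0
      · rw [Prod.fst_sum] at hx
        rw [hz (fun a => a.1.1) hx, pow_zero, pow_zero]
      · rw [hq1] at hp1
        rw [Units.ext (by exact_mod_cast (mul_right_cancel₀ hx hp1).symm : (ε : ℤ) = ε')]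
    have e2 : δ ^ e.1.2 = δ' ^ e.1.2 := by
      by_cases hx : (∑ a, w a • (vertexPoint a : ℝ × ℝ)).2 = 0
      · rw [Prod.snd_sum] at hx
        rw [hz (fun a => a.1.2) hx, pow_zero, pow_zero]
      · rw [hq2] at hp2
        rw [Units.ext (by exact_mod_cast (mul_right_cancel₀ hx hp2).symm : (δ : ℤ) = δ')]
    rw [quadrantSign, quadrantSign, e1, e2]
  · intro h0
    obtain ⟨x, y, z, hxy, hxz, hyz, rfl⟩ := Finset.card_eq_three.1 hU.2
    have hsplit : ∀ {E : Type} [AddCommMonoid E] (g : Vertex m τ → E),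
        (∀ a ∉ ({x, y, z} : Finset (Vertex m τ)), g a = 0) → ∑ a, g a = g x + g y + g z := by
      intro E _ g hg
      rw [← Finset.sum_subset (Finset.subset_univ _) (fun a _ ha => hg a ha),
        Finset.sum_insert (by simp [hxy, hxz]), Finset.sum_insert (by simp [hyz]),
        Finset.sum_singleton, add_assoc]
    have h1 := hsplit w hwU
    rw [hw.2] at h1
    rw [hsplit _ fun a ha => by rw [hwU a ha, mul_zero]] at h0
    have hsm : ∑ a, w a • (vertexPoint a : ℝ × ℝ) =
        w x • vertexPoint x + w y • vertexPoint y + w z • vertexPoint z :=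
      hsplit (fun a => w a • (vertexPoint a : ℝ × ℝ)) fun a ha => by rw [hwU a ha, zero_smul]
    have main : ∀ a b c : Vertex m τ, a ≠ b → a ≠ c → b ≠ c → ({a, b, c} : Finset (Vertex m τ)) =
        {x, y, z} → quadrantSign σ ε δ a ≠ quadrantSign σ ε δ b →
        quadrantSign σ ε δ a ≠ quadrantSign σ ε δ c →
        w a + w b + w c = 1 →
        ((quadrantSign σ ε δ a : ℤ) : ℝ) * w a + ((quadrantSign σ ε δ b : ℤ) : ℝ) * w b +
          ((quadrantSign σ ε δ c : ℤ) : ℝ) * w c = 0 →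
        ∑ a, w a • (vertexPoint a : ℝ × ℝ) =
          w a • vertexPoint a + w b • vertexPoint b + w c • vertexPoint c →
        ∃ (ε' δ' : ℤˣ) (a b c : Vertex m τ), a ≠ b ∧ a ≠ c ∧ b ≠ c ∧
          ({a, b, c} : Finset (Vertex m τ)).map vertexPoint ∈ τ.faces ∧
          quadrantSign σ ε' δ' a ≠ quadrantSign σ ε' δ' b ∧
          quadrantSign σ ε' δ' a ≠ quadrantSign σ ε' δ' c ∧
          reflect ε δ (∑ a, w a • vertexPoint a) ∈
            segment ℝ (midpoint ℝ (reflect ε' δ' (vertexPoint a)) (reflect ε' δ' (vertexPoint b)))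
              (midpoint ℝ (reflect ε' δ' (vertexPoint a)) (reflect ε' δ' (vertexPoint c))) := by
      intro a b c hab hac hbc habc hsab hsac hs1 hs0 hsum
      rw [units_eq_neg_of_ne hsab, units_eq_neg_of_ne hsac] at hs0
      -- When the sign of a differs from the other two, vanishing of f means that a has weight
      -- exactly 1/2. This is the midline.
      have h2 : w a = w b + w c := by
        have h3 : ((quadrantSign σ ε δ a : ℤ) : ℝ) ≠ 0 := by simp
        apply mul_left_cancel₀ h3
        push_cast at hs0
        linarith
      have h3 : w a = 1 / 2 := by linarith
      refine ⟨ε, δ, a, b, c, hab, hac, hbc, habc ▸ hU.1, hsab, hsac, 2 * w b, 2 * w c,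
        by linarith [hw.1 b], by linarith [hw.1 c], by linarith, ?_⟩
      rw [add_midpoints_eq ε δ _ _ _ (by linarith), hsum, h3]
      congr 3
      · congr 2; ring
      · ring
    by_cases e1 : quadrantSign σ ε δ x = quadrantSign σ ε δ y
    · by_cases e2 : quadrantSign σ ε δ x = quadrantSign σ ε δ z
      · exfalso
        rw [← e1, ← e2, ← mul_add, ← mul_add, ← h1, mul_one] at h0
        simp at h0
      · refine main z x y hxz.symm hyz.symm hxy ?_ (Ne.symm e2) (fun h => e2 (e1.trans h.symm))
          (by linarith) (by linarith) (by rw [hsm]; abel)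
        ext; simp only [Finset.mem_insert, Finset.mem_singleton]; tauto
    · by_cases e2 : quadrantSign σ ε δ x = quadrantSign σ ε δ z
      · refine main y x z hxy.symm hyz hxz ?_ (Ne.symm e1) (fun h => e1 (e2.trans h.symm))
          (by linarith) (by linarith) (by rw [hsm]; abel)
        ext; simp only [Finset.mem_insert, Finset.mem_singleton]; tauto
      · exact main x y z hxy hxz hyz rfl e1 e2 h1.symm h0 hsm

/-- The points of the midlines are limits of points of the midlines inside of the square. -/
lemma affineMidlines_subset_closure (hm : 0 < m) (hτ : IsLatticeTriangulation m τ) :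
    affineMidlines τ σ ⊆ closure (affineMidlines τ σ ∩ interior (square m)) := by
  classical
  intro p hp
  obtain ⟨ε, δ, a, b, c, hab, hac, hbc, hT, hsab, hsac, hp⟩ := (mem_affineMidlines_iff hm hτ).1 hp
  rw [← closure_openSegment] at hp
  refine closure_mono ?_ hp
  intro z hz
  refine ⟨(mem_affineMidlines_iff hm hτ).2 ⟨ε, δ, a, b, c, hab, hac, hbc, hT, hsab, hsac,
    openSegment_subset_segment _ _ _ hz⟩, ?_⟩
  obtain ⟨r, s, hr, hs, hrs, rfl⟩ := hz
  rw [add_midpoints_eq ε δ _ _ _ hrs, mem_interior_square_iff hm]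
  have hle : ∀ u : Vertex m τ, (u.1.1 : ℝ) + u.1.2 ≤ m := fun u => by
    exact_mod_cast add_le_of_mem_vertexSet hm hτ u.2
  have hne : ¬ ((a.1.1 : ℝ) + a.1.2 = m ∧ (b.1.1 : ℝ) + b.1.2 = m ∧ (c.1.1 : ℝ) + c.1.2 = m) := by
    rintro ⟨h1, h2, h3⟩
    -- Three vertices on the line k + l = m satisfy this affine relation. Its triviality would force
    -- b = c.
    let v := threeWeights a b c ((b.1.1 : ℝ) - c.1.1) ((c.1.1 : ℝ) - a.1.1) ((a.1.1 : ℝ) - b.1.1)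
    have hv : v = 0 := by
      refine eq_zero_of_sum_smul_eq_zero hT (fun e he => threeWeights_eq_zero he) ?_ ?_
      · rw [sum_threeWeights]; ring
      · rw [sum_threeWeights_smul]
        ext
        · change ((b.1.1 : ℝ) - c.1.1) * a.1.1 + ((c.1.1 : ℝ) - a.1.1) * b.1.1 +
            ((a.1.1 : ℝ) - b.1.1) * c.1.1 = 0
          ring
        · change ((b.1.1 : ℝ) - c.1.1) * a.1.2 + ((c.1.1 : ℝ) - a.1.1) * b.1.2 +
            ((a.1.1 : ℝ) - b.1.1) * c.1.2 = 0
          linear_combination ((b.1.1 : ℝ) - c.1.1) * h1 + ((c.1.1 : ℝ) - a.1.1) * h2 +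
            ((a.1.1 : ℝ) - b.1.1) * h3
    have hva := congrFun hv a
    simp only [v, threeWeights, Pi.add_apply, Pi.single_eq_same, Pi.single_eq_of_ne hab,
      Pi.single_eq_of_ne hac, add_zero, Pi.zero_apply] at hva
    have e1 : b.1.1 = c.1.1 := by exact_mod_cast sub_eq_zero.1 hva
    have e2 : b.1.2 = c.1.2 := by
      rw [e1] at h2
      have : (b.1.2 : ℝ) = c.1.2 := by linarith
      exact_mod_cast this
    exact hbc (Subtype.ext (Prod.ext e1 e2))
  have habs : |(reflect ε δ ((1 / 2 : ℝ) • vertexPoint a + (r / 2) • vertexPoint b +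
      (s / 2) • vertexPoint c)).1| + |(reflect ε δ ((1 / 2 : ℝ) • vertexPoint a +
      (r / 2) • vertexPoint b + (s / 2) • vertexPoint c)).2| =
      1 / 2 * ((a.1.1 : ℝ) + a.1.2) + r / 2 * ((b.1.1 : ℝ) + b.1.2) +
        s / 2 * ((c.1.1 : ℝ) + c.1.2) := by
    change |((ε : ℤ) : ℝ) * (1 / 2 * (a.1.1 : ℝ) + r / 2 * (b.1.1 : ℝ) + s / 2 * (c.1.1 : ℝ))| +
      |((δ : ℤ) : ℝ) * (1 / 2 * (a.1.2 : ℝ) + r / 2 * (b.1.2 : ℝ) + s / 2 * (c.1.2 : ℝ))| = _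
    rw [abs_mul, abs_mul, abs_unit, abs_unit, abs_of_nonneg (by positivity),
      abs_of_nonneg (by positivity)]
    ring
  rw [habs]
  have ha := hle a
  have hb := mul_le_mul_of_nonneg_left (hle b) (half_pos hr).le
  have hc := mul_le_mul_of_nonneg_left (hle c) (half_pos hs).le
  have hm2 : (m : ℝ) = 1 / 2 * m + r / 2 * m + s / 2 * m := by
    linear_combination (-(m : ℝ) / 2) * hrs
  by_contra hcon
  push Not at hcon
  refine hne ⟨by linarith, ?_, ?_⟩
  · exact mul_left_cancel₀ (half_pos hr).ne' (by linarith)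
  · exact mul_left_cancel₀ (half_pos hs).ne' (by linarith)

end Signs

/-! ### Compatibility of the quadrants and the conclusion -/

section Gluing

variable {m : ℕ} {τ : Geometry.SimplicialComplex ℝ (ℝ × ℝ)} {ν : ℝ × ℝ → ℝ}
  {σ : ℕ → ℕ → ℤˣ} {t : ℝ}

lemma quadrantSign_neg (ε δ : ℤˣ) (a : ℕ × ℕ) :
    quadrantSign σ ε δ a = (-1) ^ (a.1 + a.2) * quadrantSign σ (-ε) (-δ) a := by
  have h1 : ∀ x e d p q : ℤˣ, x * e * d = p * q * (x * (p * e) * (q * d)) := by decide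
  rw [quadrantSign, quadrantSign, neg_pow ε, neg_pow δ, pow_add]
  exact h1 _ _ _ _ _

lemma poly_signedCoeff (hm : 0 < m) (hτ : IsLatticeTriangulation m τ) {ε δ : ℤˣ}
    {v : upperOctahedron} (h0 : 0 ≤ ((ε : ℤ) : ℝ) * v.1 0) (h1 : 0 ≤ ((δ : ℤ) : ℝ) * v.1 1) :
    (vertexFamily hm hτ).poly (fun a => signedCoeff ν σ t a) v.1 =
      (vertexFamily hm hτ).poly
        (fun a => ((quadrantSign σ ε δ a : ℤ) : ℝ) * t ^ ν (vertexPoint a)) (foldPoint v).1 := by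
  refine Finset.sum_congr rfl fun a _ => ?_
  rw [Fin.prod_univ_three, Fin.prod_univ_three]
  change ((σ a.1.1 a.1.2 : ℤ) : ℝ) * t ^ ν (vertexPoint a) *
    (v.1 0 ^ a.1.1 * v.1 1 ^ a.1.2 * v.1 2 ^ _) = _ * (|v.1 0| ^ a.1.1 * |v.1 1| ^ a.1.2 * v.1 2 ^ _)
  have e0 : v.1 0 ^ a.1.1 = ((ε : ℤ) : ℝ) ^ a.1.1 * |v.1 0| ^ a.1.1 := by
    rw [← mul_pow, unit_mul_abs h0]
  have e1 : v.1 1 ^ a.1.2 = ((δ : ℤ) : ℝ) ^ a.1.2 * |v.1 1| ^ a.1.2 := by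
    rw [← mul_pow, unit_mul_abs h1]
  rw [e0, e1]
  simp only [quadrantSign]
  push_cast
  ring

/-- For small values of the parameter, the quadrants can be mapped to the simplex in such a way
that the curve goes to the midlines. -/
lemma exists_quadrantHomeos (hm : 0 < m) (hτ : IsLatticeTriangulation m τ)
    (hν : CertifiesConvexity m τ ν) (σ : ℕ → ℕ → ℤˣ) :
    ∃ t₀ : ℝ, 0 < t₀ ∧ ∀ t : ℝ, 0 < t → t < t₀ → ∃ H : QuadrantHomeos, ∀ v : upperOctahedron,
      H.glue m v ∈ affineMidlines τ σ ↔
        (vertexFamily hm hτ).poly (fun a => signedCoeff ν σ t a) v.1 = 0 := by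
  obtain ⟨L₀, hL₀⟩ := (convexTriangulation hm hτ hν).exists_homeomorph
  -- With L = -log t the coefficients exp(-L ν) are t ^ ν, and L > L₀ means t < exp(-L₀).
  refine ⟨Real.exp (-L₀), Real.exp_pos _, fun t ht htt => ?_⟩
  have hL : -Real.log t > L₀ := by
    have := (Real.log_lt_iff_lt_exp ht).2 htt
    linarith
  obtain ⟨J, hzero, hcurve, hsame, hopp⟩ := hL₀ _ hL
  have hcoeff : ∀ a, (convexTriangulation hm hτ hν).coeff (-Real.log t) a =
      t ^ ν (vertexPoint a) := fun a => by
    rw [Real.rpow_def_of_pos ht, ConvexTriangulation.coeff, neg_mul, neg_neg]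
    rfl
  let s : ℤˣ → ℤˣ → Vertex m τ → ℤˣ := fun ε δ a => quadrantSign σ ε δ a
  have hm' : (m : ℝ) ≠ 0 := by exact_mod_cast hm.ne'
  let H : QuadrantHomeos :=
    { J := fun ε δ => J (s ε δ)
      eq_zero_iff := fun ε δ => hzero (s ε δ)
      congr_fst := fun ε ε' δ x hx => hsame _ _ x 0 hx fun a ha => by
        have ha : a.1.1 = 0 := ha
        simp only [s, quadrantSign, ha, pow_zero]
      congr_snd := fun ε δ δ' x hx => hsame _ _ x 1 hx fun a ha => by
        have ha : a.1.2 = 0 := ha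
        simp only [s, quadrantSign, ha, pow_zero]
      congr_neg := fun ε δ x hx => by
        have hsum : ∀ a : Vertex m τ, (vertexFamily hm hτ).exps a 2 = 0 → a.1.1 + a.1.2 = m :=
          fun a ha => by
            have h1 : m - (a.1.1 + a.1.2) = 0 := ha
            have h2 := add_le_of_mem_vertexSet hm hτ a.2
            omega
        -- On the outer side k + l = m the signs of opposite quadrants agree for even m and are
        -- opposite for odd m.
        rcases Nat.even_or_odd m with he | ho
        · refine hsame _ _ x 2 hx fun a ha => ?_
          change quadrantSign σ ε δ a = quadrantSign σ (-ε) (-δ) a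
          rw [quadrantSign_neg, hsum a ha, he.neg_one_pow, one_mul]
        · refine hopp _ _ x 2 hx fun a ha => ?_
          change quadrantSign σ ε δ a = -quadrantSign σ (-ε) (-δ) a
          rw [quadrantSign_neg, hsum a ha, ho.neg_one_pow, neg_one_mul] }
  refine ⟨H, fun v => ?_⟩
  have h0 := signUnit_mul_nonneg (v.1 0)
  have h1 := signUnit_mul_nonneg (v.1 1)
  set ε := signUnit (v.1 0)
  set δ := signUnit (v.1 1)
  obtain ⟨U, hU, w, hw, hwU, hwJ⟩ := (convexTriangulation hm hτ hν).cover _ (H.J ε δ (foldPoint v)).2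
  have hsum : ∑ a, w a • (vertexPoint a : ℝ × ℝ) =
      (m * (H.J ε δ (foldPoint v)).1 0, m * (H.J ε δ (foldPoint v)).1 1) := by
    have h2 := hwJ
    rw [bary_vertexFamily hm hτ hw.2] at h2
    rw [← h2]
    ext
    · exact (mul_div_cancel₀ _ hm').symm
    · exact (mul_div_cancel₀ _ hm').symm
  have hglue : H.glue m v = reflect ε δ (∑ a, w a • vertexPoint a) := by
    rw [hsum]; rfl
  rw [hglue, reflect_mem_affineMidlines_iff hm hτ hU hw hwU, poly_signedCoeff hm hτ h0 h1]
  have h2 := hcurve (s ε δ) (foldPoint v) w ⟨hw, U, hU, hwU⟩ hwJ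
  simp only [hcoeff] at h2
  exact h2

end Gluing

namespace QuadrantHomeos

variable {H : QuadrantHomeos} {m : ℕ} {τ : Geometry.SimplicialComplex ℝ (ℝ × ℝ)} {ν : ℝ × ℝ → ℝ}
  {σ : ℕ → ℕ → ℤˣ} {t : ℝ}

lemma image_affineHomeo (hm : 0 < m) (hτ : IsLatticeTriangulation m τ)
    (hH : ∀ v : upperOctahedron, H.glue m v ∈ affineMidlines τ σ ↔
      (vertexFamily hm hτ).poly (fun a => signedCoeff ν σ t a) v.1 = 0) :
    H.affineHomeo hm '' {p | (p : ℝ × ℝ) ∈ affineMidlines τ σ} =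
      affineCurve (patchworkPolynomial m τ ν σ t) := by
  rw [Homeomorph.image_eq_preimage_symm]
  ext q
  rw [mem_affineCurve_iff hm hτ, ← hH]
  rfl

lemma image_toProjective (hm : 0 < m) (hτ : IsLatticeTriangulation m τ) (ht : 0 < t)
    (hH : ∀ v : upperOctahedron, H.glue m v ∈ affineMidlines τ σ ↔
      (vertexFamily hm hτ).poly (fun a => signedCoeff ν σ t a) v.1 = 0) :
    H.toProjective hm '' {p | (p : ℝ × ℝ) ∈ affineMidlines τ σ} =
      projectiveCurve (patchworkPolynomial m τ ν σ t) := by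
  ext P
  constructor
  · rintro ⟨p, hp, rfl⟩
    rw [toProjective, spanPoint_mem_projectiveCurve_iff hm hτ ht, ← hH, ← coe_glueHomeo hm,
      Homeomorph.apply_symm_apply]
    exact hp
  · intro hP
    obtain ⟨v, rfl⟩ := spanPoint_surjective P
    rw [spanPoint_mem_projectiveCurve_iff hm hτ ht, ← hH] at hP
    exact ⟨H.glueHomeo hm v, hP, by rw [toProjective, Homeomorph.symm_apply_apply]⟩

/-- The curve is closed, being the image of a compact set. Conversely its points at infinity come
from boundary points of midlines, which are limits of interior ones; so it has no isolated points or
branches at infinity. -/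
lemma projectiveCurve_eq_closure (hm : 0 < m) (hτ : IsLatticeTriangulation m τ) (ht : 0 < t)
    (hH : ∀ v : upperOctahedron, H.glue m v ∈ affineMidlines τ σ ↔
      (vertexFamily hm hτ).poly (fun a => signedCoeff ν σ t a) v.1 = 0) :
    projectiveCurve (patchworkPolynomial m τ ν σ t) =
      closure (affineChart '' affineCurve (patchworkPolynomial m τ ν σ t)) := by
  apply subset_antisymm
  · rw [← image_toProjective hm hτ ht hH]
    rintro _ ⟨p, hp, rfl⟩
    have hmem : p ∈ closure {q : square m | (q : ℝ × ℝ) ∈ affineMidlines τ σ ∩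
        interior (square m)} := by
      rw [closure_subtype]
      refine closure_mono ?_ (affineMidlines_subset_closure hm hτ hp)
      exact fun q hq => ⟨⟨q, interior_subset hq.2⟩, hq, rfl⟩
    refine map_mem_closure (continuous_toProjective hm) hmem ?_
    rintro q ⟨hq, hqi⟩
    refine ⟨H.affineHomeo hm ⟨q, hqi⟩, ?_, affineChart_affineHomeo hm ⟨q, hqi⟩⟩
    rw [← image_affineHomeo hm hτ hH]
    exact ⟨_, hq, rfl⟩
  · have : CompactSpace upperOctahedron := isCompact_iff_compactSpace.1 isCompact_upperOctahedron
    have hC : projectiveCurve (patchworkPolynomial m τ ν σ t) = spanPoint ''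
        {v | (vertexFamily hm hτ).poly (fun a => signedCoeff ν σ t a) v.1 = 0} := by
      ext P
      obtain ⟨v, rfl⟩ := spanPoint_surjective P
      refine ⟨fun h => ⟨v, (spanPoint_mem_projectiveCurve_iff hm hτ ht v).1 h, rfl⟩, ?_⟩
      rintro ⟨u, hu, h⟩
      rw [← h]
      exact (spanPoint_mem_projectiveCurve_iff hm hτ ht u).2 hu
    have hclosed : IsClosed (projectiveCurve (patchworkPolynomial m τ ν σ t)) := by
      rw [hC]
      refine (IsClosed.isCompact ?_).image continuous_spanPoint |>.isClosed
      refine isClosed_eq ?_ continuous_const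
      exact continuous_finsetSum _ fun a _ => continuous_const.mul (continuous_finsetProd _
        fun i _ => ((continuous_apply i).comp continuous_subtype_val).pow _)
    refine closure_minimal ?_ hclosed
    rintro _ ⟨q, hq, rfl⟩
    rw [← spanPoint_affinePoint, spanPoint_mem_projectiveCurve_iff hm hτ ht]
    exact (mem_affineCurve_iff hm hτ q).1 hq

end QuadrantHomeos

end Patchwork

open Patchwork in
theorem mainTheorem2 (m : ℕ) (hm : 0 < m)
    (τ : Geometry.SimplicialComplex ℝ (ℝ × ℝ)) (hτ : IsLatticeTriangulation m τ)
    (ν : ℝ × ℝ → ℝ) (hν : CertifiesConvexity m τ ν)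
    (σ : ℕ → ℕ → ℤˣ) :
    ∃ t₀ : ℝ, 0 < t₀ ∧ ∀ t : ℝ, 0 < t → t < t₀ →
      (∃ Φ : interior (square m) ≃ₜ ℝ × ℝ,
        Φ '' {p | (p : ℝ × ℝ) ∈ affineMidlines τ σ} =
          affineCurve (patchworkPolynomial m τ ν σ t)) ∧
      (∃ Ψ : GluedSquare m ≃ₜ ℙ ℝ (Fin 3 → ℝ),
        Ψ '' projectiveMidlines m τ σ =
          projectiveCurve (patchworkPolynomial m τ ν σ t)) ∧
      projectiveCurve (patchworkPolynomial m τ ν σ t) =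
        closure (affineChart '' affineCurve (patchworkPolynomial m τ ν σ t)) := by
  obtain ⟨t₀, ht₀, h⟩ := exists_quadrantHomeos hm hτ hν σ
  refine ⟨t₀, ht₀, fun t ht htt => ?_⟩
  obtain ⟨H, hH⟩ := h t ht htt
  refine ⟨⟨H.affineHomeo hm, QuadrantHomeos.image_affineHomeo hm hτ hH⟩,
    ⟨H.projectiveHomeo hm, ?_⟩, QuadrantHomeos.projectiveCurve_eq_closure hm hτ ht hH⟩
  rw [projectiveMidlines, Set.image_image]
  exact QuadrantHomeos.image_toProjective hm hτ ht hH
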